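/- Let $\beta>0$, and let $\mathcal G$ be a complex function of $\tau=u+iv$, defined for $\operatorname{Re}\tau\notin\beta\mathbb Z$, such that: (a) on every open strip $k\beta<u<(k+1)\beta$ ($k\in\mathbb Z$) $\mathcal G$ is analytic and extends continuously to the closed strip (the extensions from the two sides of a line $u=k\beta$ may differ); (b) $\mathcal G(\tau+\beta)=\mathcal G(\tau)$ (boson case) or $\mathcal G(\tau+\beta)=-\mathcal G(\tau)$ (fermion case); (c) there are real constants $C,\alpha$ with $|\mathcal G(u+iv)|\le C(1+|v|)^\alpha$ for all $v\in\mathbb R$, $u\notin\beta\mathbb Z$ (the jumps below then satisfy a bound of the same kind). Put $\zeta_n=n\pi/\beta$ and $\mathcal G_n=\int_{-\beta}^{\beta}\mathcal G(u)e^{i\zeta_nu}\,du$ for $n\in\mathbb Z$. Let $\mathcal G^{(+)}$ and $\mathcal G^{(-)}$ be the parts of the Fourier series of $\mathcal G$ with indices $n\ge0$ and $n<0$: on $[-\beta,\beta]$ they are the $L^2$ functions whose Fourier coefficients are those of $\mathcal G$ with $n\geq 0$, respectively $n<0$; $\mathcal G^{(+)}(\tau)=\frac1{2\beta}\sum_{n\ge0}\mathcal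 G_ne^{-i\zeta_n\tau}$ for $\operatorname{Im}\tau<0$ and $\mathcal G^{(-)}(\tau)=\frac1{2\beta}\sum_{n<0}\mathcal G_ne^{-i\zeta_n\tau}$ for $\operatorname{Im}\tau>0$; and $\mathcal G=\mathcal G^{(+)}+\mathcal G^{(-)}$ off the lines $\operatorname{Re}\tau\in\beta\mathbb Z$. Let $\Xi_\pm=\{k\beta+iv: k\in\mathbb Z,\ \pm v\ge0\}$. For $k\in\mathbb Z$ and $\pm v>0$ let $$J^{(\pm)}_{(k\beta)}(v)=\pm i\lim_{\epsilon\to0^+}\left\{\mathcal G^{(\pm)}(k\beta+\epsilon+iv)-\mathcal G^{(\pm)}(k\beta-\epsilon+iv)\right\},$$ and let $\tilde J^{(+)}_{(k\beta)}(\zeta)=\int_0^{\infty}J^{(+)}_{(k\beta)}(v)e^{-\zeta v}dv$ for $\operatorname{Re}\zeta>0$ and $\tilde J^{(-)}_{(k\beta)}(\zeta)=\int_{-\infty}^0J^{(-)}_{(k\beta)}(v)e^{-\zeta v}dv$ for $\operatorname{Re}\zeta<0$. Then: (i) $\mathcal G^{(\pm)}$ exist and are holomorphic in the cut domains $\mathbb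 C\setminus\Xi_\pm$, and the limits defining the jumps exist. (ii) For $k=0,1$ the integrals defining $\tilde J^{(\pm)}_{(k\beta)}$ converge absolutely and $\tilde J^{(+)}_{(k\beta)}$, $\tilde J^{(-)}_{(k\beta)}$ are holomorphic in $\operatorname{Re}\zeta>0$, respectively $\operatorname{Re}\zeta<0$. For every $\delta>0$ they belong to the Hardy space $H^2$ of the half-plane $\operatorname{Re}\zeta>\delta$, respectively $\operatorname{Re}\zeta<-\delta$. (iii-a) In the boson case put $\tilde{\mathcal G}^{(\pm)}=\tilde J^{(\pm)}_{(0)}+\tilde J^{(\pm)}_{(\beta)}$. Then $\tilde{\mathcal G}^{(+)}(2m\pi/\beta)=\mathcal G_{2m}$ for $m=1,2,\dots$ and $\tilde{\mathcal G}^{(-)}(2m\pi/\beta)=\mathcal G_{2m}$ for $m=-1,-2,\dots$. (iii-b) In the fermion case put $\tilde{\mathcal G}^{(\pm)}=\tilde J^{(\pm)}_{(0)}-\tilde J^{(\pm)}_{(\beta)}$. Then $\tilde{\mathcal G}^{(+)}((2m+1)\pi/\beta)=\mathcal G_{2m+1}$ for $m=0,1,2,\dots$ and $\tilde{\mathcal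 G}^{(-)}((2m+1)\pi/\beta)=\mathcal G_{2m+1}$ for $m=-1,-2,\dots$. In both cases $\tilde{\mathcal G}^{(\pm)}$ is the unique Carlsonian interpolation of these data. That is: say that $H$ is Carlsonian in a half-plane $P$ with boundary line $L$ parallel to the imaginary axis if $H$ is holomorphic in $P$, continuous on $\overline P$, $|H(\zeta)|\le Ce^{A|\zeta|}$ on $\overline P$, and $|H(\zeta)|\le Ce^{c|\operatorname{Im}\zeta|}$ on $L$ for some $c<\beta/2$. Then $\tilde{\mathcal G}^{(+)}$ lies in $H^2$ of, and is Carlsonian in, every half-plane $\operatorname{Re}\zeta>\delta$ with $\delta>0$; and if, for some $\delta\ge0$, $H$ is in $H^2$ of, or is Carlsonian in, $\operatorname{Re}\zeta>\delta$ and takes the above values at all the above points lying in this half-plane, then $H=\tilde{\mathcal G}^{(+)}$ there. The same holds for $\tilde{\mathcal G}^{(-)}$ and the half-planes $\operatorname{Re}\zeta<-\delta$. -/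

import Mathlib

open MeasureTheory Filter Topology Set

noncomputable section

namespace ThermalGreen

/-- The statistics of the field. -/
inductive Statistics where
  | boson
  | fermion

/-- The factor picked up under translation by `β`: `1` for bosons, `-1` for fermions. -/
def Statistics.sign : Statistics → ℂ
  | Statistics.boson => 1
  | Statistics.fermion => -1

/-- The upward cuts `Ξ₊ = {kβ + iv : v ≥ 0, k ∈ ℤ}`. -/
def cutUp (β : ℝ) : Set ℂ :=
  {τ | ∃ k : ℤ, ∃ v : ℝ, 0 ≤ v ∧ τ = (k : ℂ) * (β : ℂ) + (v : ℂ) * Complex.I}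

/-- The downward cuts `Ξ₋ = {kβ + iv : v ≤ 0, k ∈ ℤ}`. -/
def cutDown (β : ℝ) : Set ℂ :=
  {τ | ∃ k : ℤ, ∃ v : ℝ, v ≤ 0 ∧ τ = (k : ℂ) * (β : ℂ) + (v : ℂ) * Complex.I}

/-- The periodic cut plane `ℂ \ (Ξ₊ ∪ Ξ₋)`. -/
def cutPlane (β : ℝ) : Set ℂ := (cutUp β ∪ cutDown β)ᶜ

/-- The open strip `kβ < Re τ < (k+1)β`. -/
def strip (β : ℝ) (k : ℤ) : Set ℂ :=
  {τ | (k : ℝ) * β < τ.re ∧ τ.re < ((k : ℝ) + 1) * β}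

/-- The closed strip `kβ ≤ Re τ ≤ (k+1)β`. -/
def closedStrip (β : ℝ) (k : ℤ) : Set ℂ :=
  {τ | (k : ℝ) * β ≤ τ.re ∧ τ.re ≤ ((k : ℝ) + 1) * β}

/-- A thermal Green function at inverse temperature `β`. On each open strip it is analytic and
extends continuously to the closed strip; the extensions from the two sides of a line
`Re τ = kβ` may differ, and the values of `G` on these lines play no role. -/
structure IsThermalGreen (β : ℝ) (s : Statistics) (G : ℂ → ℂ) : Prop where
  analytic : ∀ k : ℤ, DifferentiableOn ℂ G (strip β k)
  continuous_boundary : ∀ k : ℤ, ∃ g : ℂ → ℂ,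
    ContinuousOn g (closedStrip β k) ∧ EqOn g G (strip β k)
  periodic : ∀ τ ∈ cutPlane β, G (τ + (β : ℂ)) = s.sign * G τ
  slow_growth : ∃ C α : ℝ, ∀ τ ∈ cutPlane β, ‖G τ‖ ≤ C * (1 + |τ.im|) ^ α

/-- `ζₙ = nπ/β`. -/
def matsubara (β : ℝ) (n : ℤ) : ℝ := (n : ℝ) * Real.pi / β

/-- The Fourier coefficient `Gₙ = ∫_{-β}^{β} G(u) exp(i ζₙ u) du`. -/
def greenCoeff (β : ℝ) (G : ℂ → ℂ) (n : ℤ) : ℂ :=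
  ∫ u in (-β)..β, G (u : ℂ) * Complex.exp (Complex.I * (matsubara β n : ℂ) * (u : ℂ))

/-- The `n`-th term `(2β)⁻¹ Gₙ exp(-i ζₙ τ)` of the Fourier series of `G`. -/
def greenTerm (β : ℝ) (G : ℂ → ℂ) (n : ℤ) (τ : ℂ) : ℂ :=
  1 / (2 * (β : ℂ)) * greenCoeff β G n *
    Complex.exp (-(Complex.I * (matsubara β n : ℂ) * τ))

/-- `G = G⁽⁺⁾ + G⁽⁻⁾`, the parts of the Fourier series with indices `n ≥ 0` and `n < 0`:
as series in the half-planes `Im τ < 0` and `Im τ > 0` respectively, as Fourier series of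
`L²[-β, β]` functions on the real axis, and with sum `G` on the whole cut plane. -/
structure IsSplitting (β : ℝ) (G Gp Gm : ℂ → ℂ) : Prop where
  series_plus : ∀ τ : ℂ, τ.im < 0 → HasSum (fun n : ℕ => greenTerm β G (n : ℤ) τ) (Gp τ)
  series_minus : ∀ τ : ℂ, 0 < τ.im →
    HasSum (fun n : ℕ => greenTerm β G (-((n : ℤ) + 1)) τ) (Gm τ)
  memLp_plus : MemLp (fun u : ℝ => Gp (u : ℂ)) 2 (volume.restrict (Icc (-β) β))
  memLp_minus : MemLp (fun u : ℝ => Gm (u : ℂ)) 2 (volume.restrict (Icc (-β) β))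
  coeff_plus : ∀ n : ℤ, greenCoeff β Gp n = if 0 ≤ n then greenCoeff β G n else 0
  coeff_minus : ∀ n : ℤ, greenCoeff β Gm n = if n < 0 then greenCoeff β G n else 0
  add : ∀ τ ∈ cutPlane β, G τ = Gp τ + Gm τ

/-- `i {F(kβ + e + iv) - F(kβ - e + iv)}`. -/
def gapPlus (β : ℝ) (F : ℂ → ℂ) (k : ℤ) (v e : ℝ) : ℂ :=
  Complex.I * (F ((k : ℂ) * (β : ℂ) + (e : ℂ) + (v : ℂ) * Complex.I)
    - F ((k : ℂ) * (β : ℂ) - (e : ℂ) + (v : ℂ) * Complex.I))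

/-- `-i {F(kβ + e + iv) - F(kβ - e + iv)}`. -/
def gapMinus (β : ℝ) (F : ℂ → ℂ) (k : ℤ) (v e : ℝ) : ℂ :=
  -Complex.I * (F ((k : ℂ) * (β : ℂ) + (e : ℂ) + (v : ℂ) * Complex.I)
    - F ((k : ℂ) * (β : ℂ) - (e : ℂ) + (v : ℂ) * Complex.I))

/-- The jump of `G⁽⁺⁾` across the cut `Re τ = kβ`, used for `v > 0`. -/
def jumpPlus (β : ℝ) (Gp : ℂ → ℂ) (k : ℤ) (v : ℝ) : ℂ :=
  limUnder (𝓝[>] (0 : ℝ)) (gapPlus β Gp k v)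

/-- The jump of `G⁽⁻⁾` across the cut `Re τ = kβ`, used for `v < 0`. -/
def jumpMinus (β : ℝ) (Gm : ℂ → ℂ) (k : ℤ) (v : ℝ) : ℂ :=
  limUnder (𝓝[>] (0 : ℝ)) (gapMinus β Gm k v)

/-- `∫_0^∞ J(v) exp(-ζ v) dv`. -/
def laplacePlus (J : ℝ → ℂ) (ζ : ℂ) : ℂ :=
  ∫ v in Ioi (0 : ℝ), J v * Complex.exp (-(ζ * (v : ℂ)))

/-- `∫_{-∞}^0 J(v) exp(-ζ v) dv`. -/
def laplaceMinus (J : ℝ → ℂ) (ζ : ℂ) : ℂ :=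
  ∫ v in Iio (0 : ℝ), J v * Complex.exp (-(ζ * (v : ℂ)))

/-- The half-plane `Re ζ > δ`. -/
def rightHalfPlane (δ : ℝ) : Set ℂ := {ζ | δ < ζ.re}

/-- The half-plane `Re ζ < -δ`. -/
def leftHalfPlane (δ : ℝ) : Set ℂ := {ζ | ζ.re < -δ}

/-- The Hardy space `H²` of the half-plane `Re ζ > δ`. -/
def IsHardyRight (δ : ℝ) (F : ℂ → ℂ) : Prop :=
  DifferentiableOn ℂ F (rightHalfPlane δ) ∧
    ∃ M : NNReal, ∀ ξ : ℝ, δ < ξ →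
      ∫⁻ η : ℝ, ‖F ((ξ : ℂ) + (η : ℂ) * Complex.I)‖ₑ ^ 2 ≤ (M : ENNReal)

/-- The Hardy space `H²` of the half-plane `Re ζ < -δ`. -/
def IsHardyLeft (δ : ℝ) (F : ℂ → ℂ) : Prop :=
  DifferentiableOn ℂ F (leftHalfPlane δ) ∧
    ∃ M : NNReal, ∀ ξ : ℝ, ξ < -δ →
      ∫⁻ η : ℝ, ‖F ((ξ : ℂ) + (η : ℂ) * Complex.I)‖ₑ ^ 2 ≤ (M : ENNReal)

/-- The Carlson class of the half-plane `Re ζ > δ`, for nodes with spacing `π / b`: holomorphic,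
continuous up to the boundary, of exponential type, and of type less than `b` on the boundary
line. -/
def IsCarlsonRight (b δ : ℝ) (F : ℂ → ℂ) : Prop :=
  DiffContOnCl ℂ F (rightHalfPlane δ) ∧
    (∃ C A : ℝ, ∀ ζ : ℂ, δ ≤ ζ.re → ‖F ζ‖ ≤ C * Real.exp (A * ‖ζ‖)) ∧
    ∃ C c : ℝ, c < b ∧
      ∀ η : ℝ, ‖F ((δ : ℂ) + (η : ℂ) * Complex.I)‖ ≤ C * Real.exp (c * |η|)

/-- The Carlson class of the half-plane `Re ζ < -δ`. -/
def IsCarlsonLeft (b δ : ℝ) (F : ℂ → ℂ) : Prop :=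
  DiffContOnCl ℂ F (leftHalfPlane δ) ∧
    (∃ C A : ℝ, ∀ ζ : ℂ, ζ.re ≤ -δ → ‖F ζ‖ ≤ C * Real.exp (A * ‖ζ‖)) ∧
    ∃ C c : ℝ, c < b ∧
      ∀ η : ℝ, ‖F (-(δ : ℂ) + (η : ℂ) * Complex.I)‖ ≤ C * Real.exp (c * |η|)

/-- `F` is the unique Carlsonian interpolation in `Re ζ > 0` of the data `Gₙ` at `ζₙ`, `n ∈ S`
(a set of positive integers of fixed parity, so that the spacing of the nodes is
`2π/β = π/(β/2)`): it interpolates, it lies in `H²` and in the Carlson class of all half-planes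
`Re ζ > δ > 0`, and it coincides with every interpolating function of either kind. -/
structure IsUniqueInterpolantRight (β : ℝ) (G : ℂ → ℂ) (S : Set ℤ) (F : ℂ → ℂ) : Prop where
  interpolates : ∀ n ∈ S, F (matsubara β n : ℂ) = greenCoeff β G n
  hardy : ∀ δ : ℝ, 0 < δ → IsHardyRight δ F
  carlson : ∀ δ : ℝ, 0 < δ → IsCarlsonRight (β / 2) δ F
  unique_hardy : ∀ (δ : ℝ) (H : ℂ → ℂ), 0 ≤ δ → IsHardyRight δ H →
    (∀ n ∈ S, δ < matsubara β n → H (matsubara β n : ℂ) = greenCoeff β G n) →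
    EqOn H F (rightHalfPlane δ)
  unique_carlson : ∀ (δ : ℝ) (H : ℂ → ℂ), 0 ≤ δ → IsCarlsonRight (β / 2) δ H →
    (∀ n ∈ S, δ < matsubara β n → H (matsubara β n : ℂ) = greenCoeff β G n) →
    EqOn H F (rightHalfPlane δ)

/-- The same in the half-plane `Re ζ < 0`, for a set `S` of negative integers. -/
structure IsUniqueInterpolantLeft (β : ℝ) (G : ℂ → ℂ) (S : Set ℤ) (F : ℂ → ℂ) : Prop where
  interpolates : ∀ n ∈ S, F (matsubara β n : ℂ) = greenCoeff β G n
  hardy : ∀ δ : ℝ, 0 < δ → IsHardyLeft δ F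
  carlson : ∀ δ : ℝ, 0 < δ → IsCarlsonLeft (β / 2) δ F
  unique_hardy : ∀ (δ : ℝ) (H : ℂ → ℂ), 0 ≤ δ → IsHardyLeft δ H →
    (∀ n ∈ S, matsubara β n < -δ → H (matsubara β n : ℂ) = greenCoeff β G n) →
    EqOn H F (leftHalfPlane δ)
  unique_carlson : ∀ (δ : ℝ) (H : ℂ → ℂ), 0 ≤ δ → IsCarlsonLeft (β / 2) δ H →
    (∀ n ∈ S, matsubara β n < -δ → H (matsubara β n : ℂ) = greenCoeff β G n) →
    EqOn H F (leftHalfPlane δ)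

end ThermalGreen

end

open ThermalGreen

namespace ThermalGreen

/-! Let J_k be the jump of G itself across Re τ = kβ (`thermalJump`). For n ≥ 1 the function G(τ)
exp(iζₙτ) decays in the upper half-plane, so Cauchy's theorem in the strips -β < u < 0 and 0 < u < β
pushes the integral defining Gₙ onto the vertical sides. The lines ±β are identified by
2β-periodicity, which holds for both statistics, and the sides combine into Gₙ = LJ_0(ζₙ) + (-1)ⁿ
LJ_1(ζₙ), with L the Laplace transform (`IsThermalGreen.greenCoeff_eq`). On the indices in question
(-1)ⁿ is the sign of the statistics, which is the interpolation property.

Put w = exp(-iπτ/β). Inserting this formula into the series of G⁽⁺⁾ produces geometric series under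
the Laplace integrals: G⁽⁺⁾ is the constant term of index 0 plus two integrals `stieltjes`,
evaluated at w and -w. They are holomorphic unless w or -w lies in [1, ∞), that is, off the upward
cuts. On the unit circle their singularities are weak enough for L², and their coefficients follow
by Fubini. The minus part is obtained from the reflection τ ↦ -τ. The difference G - G⁽⁺⁾ - G⁽⁻⁾
then has no Fourier coefficients on [-β, β]; Parseval's identity and the identity theorem make it
vanish (`IsThermalGreen.greenPlus_add_greenMinus`). In any splitting G⁽⁻⁾ is continuous across the
lines at heights v > 0, so there the jump of G⁽⁺⁾ is that of G.

The jumps are continuous and grow slower than every exponential, so their Laplace transforms are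
holomorphic and bounded on Re ζ ≥ δ > 0, and Plancherel's theorem puts them in H²
(`IsSubexponential.isHardyRight_laplacePlus`).

Uniqueness is Carlson's theorem. Competitors of either class have type less than β/2 along vertical
lines after a slight shrinking of the half-plane (`HasCarlsonBound`), and a difference of two
interpolants vanishes at nodes with spacing π/(β/2). Dividing by the sine leaves a function of
exponential type that decays exponentially in the imaginary directions, and such a function is zero
(`eq_zero_of_exp_decay`). -/

/-! ### Phragmén–Lindelöf estimates and Carlson's theorem. -/

/-- Phragmen-Lindelöf in a sector: a function on the right half-plane which is of exponential type
in the real direction and decays exponentially in the imaginary directions is bounded on the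
positive real axis by its constant. -/
theorem norm_le_of_exp_decay {F : ℂ → ℂ} {C a ε : ℝ} (ha : 0 < a) (hε : 0 < ε)
    (hd : DiffContOnCl ℂ F {z | 0 < z.re})
    (hF : ∀ z : ℂ, 0 ≤ z.re → ‖F z‖ ≤ C * Real.exp (a * z.re - ε * |z.im|)) {x : ℝ} (hx : 0 < x) :
    ‖F x‖ ≤ C := by
  -- On the rays arg z = ±α the exponent a Re z - ε |Im z| vanishes, so F is bounded by C there. The
  -- power z ↦ z^γ carries the right half-plane to the sector between these rays.
  set α : ℝ := Real.arctan (a / ε) with hα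
  have hα0 : 0 < α := Real.arctan_pos.2 (by positivity)
  have hα1 : α < Real.pi / 2 := Real.arctan_lt_pi_div_two _
  have hcos : 0 < Real.cos α := Real.cos_arctan_pos _
  have hsin : a * Real.cos α = ε * Real.sin α := by
    have := Real.tan_arctan (a / ε)
    rw [← hα, Real.tan_eq_sin_div_cos] at this
    field_simp at this
    linarith
  have hC : 0 ≤ C := by
    have h := (norm_nonneg _).trans (hF 0 (by simp))
    simpa using h
  set γ : ℝ := 2 * α / Real.pi with hγ
  have hγ0 : 0 < γ := by positivity
  have hγ1 : γ < 1 := by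
    rw [hγ, div_lt_one Real.pi_pos]; linarith
  have hγα : Real.pi / 2 * γ = α := by
    rw [hγ]; field_simp
  have hre_pos : ∀ z : ℂ, 0 < z.re → 0 < (z ^ (γ : ℂ)).re := by
    intro z hz
    rw [Complex.cpow_ofReal_re]
    have hz0 : z ≠ 0 := by rintro rfl; simp at hz
    have harg := Complex.abs_arg_lt_pi_div_two_iff.2 (Or.inl hz)
    have : |z.arg * γ| < Real.pi / 2 := by
      rw [abs_mul, abs_of_pos hγ0]
      nlinarith [abs_nonneg z.arg]
    have h2 := abs_lt.1 this
    have := Real.cos_pos_of_mem_Ioo ⟨h2.1, h2.2⟩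
    have h3 : 0 < ‖z‖ := norm_pos_iff.2 hz0
    positivity
  have hcont : ∀ z : ℂ, 0 ≤ z.re → ContinuousAt (fun z : ℂ => z ^ (γ : ℂ)) z := by
    intro z hz
    exact Complex.continuousAt_cpow_const_of_re_pos (Or.inl hz) (by simpa using hγ0)
  have hcl : closure {z : ℂ | 0 < z.re} = {z : ℂ | 0 ≤ z.re} := Complex.closure_setOfPred_lt_re 0
  have hre_nonneg : ∀ z : ℂ, 0 ≤ z.re → 0 ≤ (z ^ (γ : ℂ)).re := by
    intro z hz
    have hmaps : MapsTo (fun z : ℂ => z ^ (γ : ℂ)) {z : ℂ | 0 < z.re} {z : ℂ | 0 < z.re} :=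
      fun z hz => hre_pos z hz
    have hz' : z ∈ closure {z : ℂ | 0 < z.re} := by rw [hcl]; exact hz
    have := (hmaps.closure_of_continuousOn
      (fun w hw => (hcont w (by rw [hcl] at hw; exact hw)).continuousWithinAt)) hz'
    rw [hcl] at this
    exact this
  have hnorm : ∀ z : ℂ, ‖z ^ (γ : ℂ)‖ ≤ ‖z‖ ^ γ := by
    intro z
    by_cases hz : z = 0
    · subst hz
      rw [Complex.zero_cpow (by exact_mod_cast hγ0.ne')]
      simp only [norm_zero]
      positivity
    · exact (Complex.norm_cpow_real z γ).le
  -- After the substitution the growth has order γ < 1, so any factor exp(-δz) with δ > 0 forces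
  -- decay along the real axis without increasing the bound on the imaginary axis. Finally δ → 0.
  have hmain : ∀ δ : ℝ, 0 < δ → ∀ y : ℝ, 0 < y →
      ‖Complex.exp (-(δ * y : ℝ)) * F ((y : ℂ) ^ (γ : ℂ))‖ ≤ C := by
    intro δ hδ y hy
    have key := PhragmenLindelof.right_half_plane_of_tendsto_zero_on_real
      (f := fun z : ℂ => Complex.exp (-(δ * z)) * F (z ^ (γ : ℂ))) (C := C) (z := (y : ℂ))
      ?_ ?_ ?_ ?_ (by simpa using hy.le)
    · simpa using key
    · refine DiffContOnCl.smul (f := F ∘ (fun z : ℂ => z ^ (γ : ℂ))) (c := fun z : ℂ => Complex.exp (-(δ * z))) ?_ ?_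
      · exact Differentiable.diffContOnCl (by fun_prop)
      · refine hd.comp ⟨?_, ?_⟩ (fun z hz => hre_pos z hz)
        · intro z hz
          refine (DifferentiableAt.cpow_const differentiableAt_id ?_).differentiableWithinAt
          exact Or.inl hz
        · intro z hz
          rw [hcl] at hz
          exact (hcont z hz).continuousWithinAt
    · refine ⟨1, by norm_num, a, ?_⟩
      refine Asymptotics.IsBigO.of_bound (C * Real.exp a) ?_
      rw [eventually_inf_principal]
      refine Eventually.of_forall fun z hz => ?_
      have hz' : 0 < z.re := hz
      rw [norm_mul, Complex.norm_exp, Real.norm_eq_abs, Real.abs_exp, Real.rpow_one]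
      have h1 : Real.exp ((-((δ : ℂ) * z)).re) ≤ 1 := by
        rw [Real.exp_le_one_iff]
        simp
        positivity
      have h2 := hF _ (hre_nonneg z hz'.le)
      have h3 : (z ^ (γ : ℂ)).re ≤ 1 + ‖z‖ := by
        refine ((Complex.re_le_norm _).trans (hnorm z)).trans ?_
        rcases le_total ‖z‖ 1 with h | h
        · have := Real.rpow_le_one (norm_nonneg z) h hγ0.le
          linarith [norm_nonneg z]
        · have := Real.rpow_le_rpow_of_exponent_le h hγ1.le
          rw [Real.rpow_one] at this
          linarith
      have h4 : Real.exp (a * (z ^ (γ : ℂ)).re - ε * |(z ^ (γ : ℂ)).im|)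
          ≤ Real.exp a * Real.exp (a * ‖z‖) := by
        rw [← Real.exp_add, Real.exp_le_exp]
        have : 0 ≤ ε * |(z ^ (γ : ℂ)).im| := by positivity
        nlinarith
      calc _ ≤ 1 * (C * (Real.exp a * Real.exp (a * ‖z‖))) := by
            gcongr
            exact h2.trans (by gcongr)
        _ = _ := by ring
    · rw [tendsto_zero_iff_norm_tendsto_zero]
      have hlim : Tendsto (fun x : ℝ => C * Real.exp (-(x ^ γ * (δ * x ^ (1 - γ) - a)))) atTop (𝓝 0) := by
        have h1 : Tendsto (fun x : ℝ => x ^ γ * (δ * x ^ (1 - γ) - a)) atTop atTop := by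
          refine Tendsto.atTop_mul_atTop₀ (tendsto_rpow_atTop hγ0) ?_
          refine tendsto_atTop_add_const_right _ _ ?_
          exact (tendsto_rpow_atTop (by linarith)).const_mul_atTop hδ
        simpa using (Real.tendsto_exp_neg_atTop_nhds_zero.comp h1).const_mul C
      refine squeeze_zero' (Eventually.of_forall fun _ => norm_nonneg _) ?_ hlim
      filter_upwards [eventually_gt_atTop 0] with x hx
      have h2 := hF ((x : ℂ) ^ (γ : ℂ)) (hre_nonneg x (by simpa using hx.le))
      rw [norm_mul, Complex.norm_exp]
      rw [Complex.cpow_ofReal_re, Complex.arg_ofReal_of_nonneg hx.le] at h2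
      have h3 : Real.exp (a * (‖(x : ℂ)‖ ^ γ * Real.cos (0 * γ)) - ε * |((x : ℂ) ^ (γ : ℂ)).im|)
          ≤ Real.exp (a * x ^ γ) := by
        rw [Real.exp_le_exp]
        have : 0 ≤ ε * |((x : ℂ) ^ (γ : ℂ)).im| := by positivity
        have h4 : ‖(x : ℂ)‖ = x := by simp [hx.le]
        rw [h4, zero_mul, Real.cos_zero, mul_one]
        linarith
      calc _ ≤ Real.exp (-(δ * x)) * (C * Real.exp (a * x ^ γ)) := by
            gcongr
            · simp
            · exact h2.trans (by gcongr)
        _ = C * Real.exp (-(δ * x) + a * x ^ γ) := by rw [Real.exp_add]; ring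
        _ = _ := by
            congr 2
            have : x = x ^ γ * x ^ (1 - γ) := by
              rw [← Real.rpow_add hx]; simp
            nth_rewrite 1 [this]
            ring
    · intro y
      rw [norm_mul]
      have h1 : ‖Complex.exp (-((δ : ℂ) * (y * Complex.I)))‖ = 1 := by
        rw [Complex.norm_exp]; simp
      rw [h1, one_mul]
      rcases eq_or_ne y 0 with rfl | hy0
      · have := hF 0 (by simp)
        rw [Complex.ofReal_zero, zero_mul, Complex.zero_cpow (by exact_mod_cast hγ0.ne')]
        simpa using this
      · have h2 := hF ((y * Complex.I : ℂ) ^ (γ : ℂ)) (hre_nonneg _ (by simp))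
        refine h2.trans ?_
        have h3 : a * (((y * Complex.I : ℂ) ^ (γ : ℂ))).re - ε * |(((y * Complex.I : ℂ) ^ (γ : ℂ))).im| = 0 := by
          rw [Complex.cpow_ofReal_re, Complex.cpow_ofReal_im]
          have hs : 0 < Real.sin α := Real.sin_pos_of_pos_of_lt_pi hα0 (by linarith [Real.pi_pos])
          have hn : 0 < ‖(y * Complex.I : ℂ)‖ ^ γ := by
            have : 0 < ‖(y * Complex.I : ℂ)‖ := by simpa using hy0
            positivity
          have : Real.cos (Complex.arg (y * Complex.I) * γ) = Real.cos α ∧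
              |Real.sin (Complex.arg (y * Complex.I) * γ)| = Real.sin α := by
            rcases lt_or_gt_of_ne hy0 with h | h
            · have : Complex.arg (y * Complex.I) = -(Real.pi / 2) :=
                Complex.arg_eq_neg_pi_div_two_iff.2 ⟨by simp, by simpa using h⟩
              rw [this, neg_mul, hγα, Real.cos_neg, Real.sin_neg, abs_neg, abs_of_pos hs]
              exact ⟨rfl, rfl⟩
            · have : Complex.arg (y * Complex.I) = Real.pi / 2 :=
                Complex.arg_eq_pi_div_two_iff.2 ⟨by simp, by simpa using h⟩
              rw [this, hγα, abs_of_pos hs]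
              exact ⟨rfl, rfl⟩
          rw [this.1, abs_mul, this.2, abs_of_pos hn]
          linear_combination (‖(y * Complex.I : ℂ)‖ ^ γ) * hsin
        rw [h3, Real.exp_zero, mul_one]
  have hy : 0 < x ^ (1 / γ) := by positivity
  have hyx : (((x ^ (1 / γ) : ℝ)) : ℂ) ^ (γ : ℂ) = x := by
    rw [← Complex.ofReal_cpow hy.le, ← Real.rpow_mul hx.le]
    rw [one_div_mul_cancel hγ0.ne', Real.rpow_one]
  have hlim : Tendsto (fun δ : ℝ => ‖Complex.exp (-(δ * x ^ (1 / γ) : ℝ)) * F x‖) (𝓝[>] 0)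
      (𝓝 ‖Complex.exp (-(0 * x ^ (1 / γ) : ℝ)) * F x‖) := by
    refine Tendsto.mono_left ?_ nhdsWithin_le_nhds
    exact Continuous.tendsto (by fun_prop) 0
  have := le_of_tendsto hlim (eventually_mem_nhdsWithin.mono fun δ hδ => by
    have := hmain δ hδ _ hy
    rw [hyx] at this
    exact this)
  simpa using this

/-- A function on the right half-plane which is of exponential type in the real direction and
decays exponentially in the imaginary directions vanishes. -/
theorem eq_zero_of_exp_decay {g : ℂ → ℂ} {C A ε : ℝ} (hε : 0 < ε)
    (hd : DiffContOnCl ℂ g {z | 0 < z.re})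
    (hg : ∀ z : ℂ, 0 ≤ z.re → ‖g z‖ ≤ C * Real.exp (A * z.re - ε * |z.im|)) {x : ℝ} (hx : 0 < x) :
    g x = 0 := by
  have hC : 0 ≤ C := by
    have h := (norm_nonneg _).trans (hg 0 (by simp))
    simpa using h
  -- The factor exp(ωz) changes only the rate A to A + ω, which does not enter the bound of
  -- `norm_le_of_exp_decay`; hence ω may tend to infinity.
  have key : ∀ ω : ℝ, 0 < A + ω → ‖g x‖ ≤ C * Real.exp (-(ω * x)) := by
    intro ω hω
    have h := norm_le_of_exp_decay (F := fun z => Complex.exp (ω * z) * g z) (C := C) hω hε ?_ ?_ hx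
    · rw [norm_mul, Complex.norm_exp] at h
      rw [Real.exp_neg, ← div_eq_mul_inv, le_div_iff₀ (Real.exp_pos _), mul_comm]
      simpa using h
    · exact DiffContOnCl.smul (c := fun z : ℂ => Complex.exp (ω * z))
        (Differentiable.diffContOnCl (by fun_prop)) hd
    · intro z hz
      rw [norm_mul, Complex.norm_exp]
      have h1 : ((ω : ℂ) * z).re = ω * z.re := by simp
      rw [h1]
      calc _ ≤ Real.exp (ω * z.re) * (C * Real.exp (A * z.re - ε * |z.im|)) := by
            gcongr; exact hg z hz
        _ = C * (Real.exp (ω * z.re) * Real.exp (A * z.re - ε * |z.im|)) := by ring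
        _ = _ := by rw [← Real.exp_add]; congr 2; ring
  have hlim : Tendsto (fun ω : ℝ => C * Real.exp (-(ω * x))) atTop (𝓝 0) := by
    simpa using (Real.tendsto_exp_neg_atTop_nhds_zero.comp
      (tendsto_id.atTop_mul_const hx)).const_mul C
  have := ge_of_tendsto hlim (b := ‖g x‖) ((eventually_gt_atTop (-A)).mono fun ω hω =>
    key ω (by linarith))
  exact norm_le_zero_iff.1 this

/-- For |Im z| ≥ 1 the smaller of the two exponentials in the sine is at most half the larger one.
-/
theorem exp_abs_im_le_norm_sin {z : ℂ} (hz : 1 ≤ |z.im|) :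
    Real.exp |z.im| / 4 ≤ ‖Complex.sin z‖ := by
  have h1 : ‖Complex.sin z‖ = ‖Complex.exp (-z * Complex.I) - Complex.exp (z * Complex.I)‖ / 2 := by
    rw [Complex.sin, norm_div, norm_mul]; simp
  have h2 : ‖Complex.exp (-z * Complex.I)‖ = Real.exp z.im := by
    rw [Complex.norm_exp]; simp
  have h3 : ‖Complex.exp (z * Complex.I)‖ = Real.exp (-z.im) := by
    rw [Complex.norm_exp]; simp
  have h4 := abs_norm_sub_norm_le (Complex.exp (-z * Complex.I)) (Complex.exp (z * Complex.I))
  rw [h2, h3] at h4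
  have h5 : Real.exp |z.im| - Real.exp (-|z.im|) ≤ |Real.exp z.im - Real.exp (-z.im)| := by
    rcases abs_cases z.im with ⟨h, _⟩ | ⟨h, _⟩
    · rw [h]; exact le_abs_self _
    · rw [h, neg_neg, abs_sub_comm]; exact le_abs_self _
  have h6 : Real.exp (-|z.im|) ≤ Real.exp |z.im| / 2 := by
    have e1 : Real.exp (-|z.im|) ≤ 1 := Real.exp_le_one_iff.2 (by linarith)
    have e2 := Real.add_one_le_exp |z.im|
    linarith
  rw [h1]
  linarith

/-- The quotient `f / sin`, with its value at the zeros of `sin` given by the derivatives. -/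
noncomputable def divSin (f : ℂ → ℂ) (z : ℂ) : ℂ :=
  open Classical in
  if Complex.sin z = 0 then deriv f z / Complex.cos z else f z / Complex.sin z

/-- The zeros of the sine are simple and f vanishes at them, so near each of them the quotient is a
quotient of the two `dslope`s, the lower one being nonzero. -/
theorem differentiableAt_divSin {f : ℂ → ℂ} {U : Set ℂ} (hU : IsOpen U)
    (hf : DifferentiableOn ℂ f U) (h0 : ∀ z ∈ U, Complex.sin z = 0 → f z = 0) {z : ℂ} (hz : z ∈ U) :
    DifferentiableAt ℂ (divSin f) z := by
  by_cases hs : Complex.sin z = 0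
  · have hcos : Complex.cos z ≠ 0 := by
      intro h
      have := Complex.sin_sq_add_cos_sq z
      simp [hs, h] at this
    have hne : ∀ᶠ w in 𝓝[≠] z, Complex.sin w ≠ 0 :=
      (Complex.hasDerivAt_sin z).eventually_ne hcos
    have heq : divSin f =ᶠ[𝓝 z] fun w => dslope f z w / dslope Complex.sin z w := by
      have := eventually_nhdsWithin_iff.1 hne
      filter_upwards [this] with w hw
      by_cases hwz : w = z
      · subst hwz
        rw [dslope_same, dslope_same, divSin, if_pos hs, Complex.deriv_sin]
      · rw [dslope_of_ne _ hwz, dslope_of_ne _ hwz, divSin, if_neg (hw hwz), slope_def_field,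
          slope_def_field, h0 z hz hs, hs]
        have : w - z ≠ 0 := sub_ne_zero.2 hwz
        simp only [sub_zero]
        rw [div_div_div_cancel_right₀ this]
    refine DifferentiableAt.congr_of_eventuallyEq ?_ heq
    refine DifferentiableAt.div ?_ ?_ ?_
    · exact ((Complex.differentiableOn_dslope (hU.mem_nhds hz)).2 hf).differentiableAt
        (hU.mem_nhds hz)
    · exact ((Complex.differentiableOn_dslope (s := univ) (c := z) univ_mem).2
        Complex.differentiable_sin.differentiableOn).differentiableAt univ_mem
    · rw [dslope_same, Complex.deriv_sin]; exact hcos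
  · have heq : divSin f =ᶠ[𝓝 z] fun w => f w / Complex.sin w := by
      filter_upwards [(Complex.continuous_sin.continuousAt (x := z)).eventually_ne hs] with w hw
      rw [divSin, if_neg hw]
    refine DifferentiableAt.congr_of_eventuallyEq ?_ heq
    exact (hf.differentiableAt (hU.mem_nhds hz)).div Complex.differentiable_sin.differentiableAt hs

/-- **Carlson's theorem**, for functions defined slightly beyond the imaginary axis. -/
theorem carlson_of_nodes_nat_mul_pi {f : ℂ → ℂ} {C A c : ℝ} (hc : c < 1)
    (hf : DifferentiableOn ℂ f {z | -Real.pi < z.re})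
    (hb : ∀ z : ℂ, -Real.pi < z.re → ‖f z‖ ≤ C * Real.exp (A * |z.re| + c * |z.im|))
    (h0 : ∀ k : ℕ, f ((k : ℂ) * Real.pi) = 0) {x : ℝ} (hx : 0 < x) : f x = 0 := by
  have hC : 0 ≤ C := by
    have h := (norm_nonneg _).trans (hb 0 (by simp [Real.pi_pos]))
    simpa using h
  have hU : IsOpen {z : ℂ | -Real.pi < z.re} := isOpen_lt continuous_const Complex.continuous_re
  have hzero : ∀ z ∈ {z : ℂ | -Real.pi < z.re}, Complex.sin z = 0 → f z = 0 := by
    intro z hz hs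
    obtain ⟨k, rfl⟩ := Complex.sin_eq_zero_iff.1 hs
    have hz' : -Real.pi < k * Real.pi := by simpa using hz
    have hk : (-1 : ℝ) < k := by nlinarith [Real.pi_pos]
    have hk' : (-1 : ℤ) < k := by exact_mod_cast hk
    obtain ⟨n, rfl⟩ := Int.eq_ofNat_of_zero_le (show 0 ≤ k by omega)
    exact_mod_cast h0 n
  have hg : ∀ z : ℂ, -Real.pi < z.re → DifferentiableAt ℂ (divSin f) z := fun z hz =>
    differentiableAt_divSin hU hf hzero hz
  -- The circle of radius 2 misses the zeros of the sine because 0 < 2 < π. By periodicity of |sin|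
  -- the same m serves every circle of radius 2 about kπ.
  obtain ⟨m, hm, hmsin⟩ : ∃ m : ℝ, 0 < m ∧ ∀ w ∈ Metric.sphere (0 : ℂ) 2, m ≤ ‖Complex.sin w‖ := by
    have hK : IsCompact (Metric.sphere (0 : ℂ) 2) := isCompact_sphere _ _
    obtain ⟨w, hw, hmin⟩ := hK.exists_isMinOn ⟨2, by simp⟩
      (Complex.continuous_sin.norm.continuousOn)
    refine ⟨‖Complex.sin w‖, ?_, fun v hv => hmin hv⟩
    rw [norm_pos_iff]
    intro hs
    obtain ⟨k, rfl⟩ := Complex.sin_eq_zero_iff.1 hs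
    simp only [mem_sphere_zero_iff_norm, norm_mul, Complex.norm_intCast, Complex.norm_real,
      Real.norm_eq_abs, abs_of_pos Real.pi_pos] at hw
    have hp := Real.pi_gt_three
    rcases eq_or_ne k 0 with rfl | hk
    · simp at hw
    · have : (1 : ℝ) ≤ |(k : ℝ)| := by exact_mod_cast Int.one_le_abs hk
      nlinarith
  set B : ℝ := |A| with hB
  have hb' : ∀ z : ℂ, -Real.pi < z.re → ‖f z‖ ≤ C * Real.exp (B * |z.re| + c * |z.im|) := by
    intro z hz
    refine (hb z hz).trans ?_
    gcongr
    exact le_abs_self _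
  have hsincos : ∀ (k : ℕ) (w : ℂ), ‖Complex.sin (w - k * Real.pi)‖ = ‖Complex.sin w‖ := by
    intro k w
    rw [Complex.sin_sub, Complex.sin_nat_mul_pi, mul_zero, sub_zero, norm_mul]
    have : ‖Complex.cos ((k : ℂ) * Real.pi)‖ = 1 := by
      have h := Complex.sin_sq_add_cos_sq ((k : ℂ) * Real.pi)
      rw [Complex.sin_nat_mul_pi] at h
      have h2 : ‖Complex.cos ((k : ℂ) * Real.pi)‖ ^ 2 = 1 := by
        rw [← norm_pow]
        simpa using congrArg norm h
      exact (pow_eq_one_iff_of_nonneg (norm_nonneg _) two_ne_zero).1 h2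
    rw [this, mul_one]
  -- The 4 exceeds 2 + π/2, the change of the real part between z and the circle used below, and 2
  -- bounds |Im| on that circle. The term 1 - c absorbs the factor exp(-(1 - c)|Im z|) for |Im z| <
  -- 1.
  set K : ℝ := C / m * Real.exp (B * 4 + |c| * 2 + 1 - c) with hK
  have hK0 : 0 ≤ K := by positivity
  have hgb : ∀ z : ℂ, 0 ≤ z.re →
      ‖divSin f z‖ ≤ (4 * C + K) * Real.exp (B * z.re - (1 - c) * |z.im|) := by
    intro z hz
    rcases le_or_gt 1 |z.im| with hy | hy
    · have hs := exp_abs_im_le_norm_sin hy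
      have hs0 : 0 < ‖Complex.sin z‖ := lt_of_lt_of_le (by positivity) hs
      rw [divSin, if_neg (norm_pos_iff.1 hs0), norm_div, div_le_iff₀ hs0]
      have h1 := hb' z (by linarith [Real.pi_pos])
      rw [abs_of_nonneg hz] at h1
      calc ‖f z‖ ≤ C * Real.exp (B * z.re + c * |z.im|) := h1
        _ = (4 * C) * Real.exp (B * z.re - (1 - c) * |z.im|) * (Real.exp |z.im| / 4) := by
            have : B * z.re + c * |z.im| = (B * z.re - (1 - c) * |z.im|) + |z.im| := by ring
            rw [this, Real.exp_add]; ring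
        _ ≤ (4 * C + K) * Real.exp (B * z.re - (1 - c) * |z.im|) * ‖Complex.sin z‖ := by
            gcongr
            linarith
    -- Near the real axis the maximum principle is applied in the disc of radius 2 about the nearest
    -- node kπ. It contains z because (π/2)² + 1 ≤ 4, and it stays in Re > -π because 2 < π and k ≥
    -- 0.
    · set k : ℕ := (round (z.re / Real.pi)).toNat with hk
      have hround : 0 ≤ round (z.re / Real.pi) := by
        rw [round_eq, Int.floor_nonneg]
        have := Real.pi_pos
        positivity
      have hkr : (k : ℝ) = (round (z.re / Real.pi) : ℝ) := by
        have : ((k : ℤ) : ℝ) = (round (z.re / Real.pi) : ℝ) := by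
          rw [hk, Int.toNat_of_nonneg hround]
        exact_mod_cast this
      have hdist : |z.re - k * Real.pi| ≤ Real.pi / 2 := by
        have h := abs_sub_round (z.re / Real.pi)
        rw [← hkr] at h
        have : z.re - k * Real.pi = (z.re / Real.pi - k) * Real.pi := by
          field_simp [Real.pi_ne_zero]
        rw [this, abs_mul, abs_of_pos Real.pi_pos]
        nlinarith [Real.pi_pos]
      set a : ℂ := (k : ℂ) * Real.pi with ha
      have hare : a.re = k * Real.pi := by simp [ha]
      have haim : a.im = 0 := by simp [ha]
      have hza : z ∈ closure (Metric.ball a 2) := by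
        rw [closure_ball _ (by norm_num), Metric.mem_closedBall, dist_eq_norm]
        have h1 : ‖z - a‖ ^ 2 ≤ 2 ^ 2 := by
          rw [← Complex.normSq_eq_norm_sq, Complex.normSq_apply]
          have e1 : (z - a).re = z.re - k * Real.pi := by simp [hare]
          have e2 : (z - a).im = z.im := by simp [haim]
          rw [e1, e2]
          have hp := Real.pi_lt_d2
          have := Real.pi_gt_three
          have h3 : (z.re - k * Real.pi) ^ 2 ≤ (Real.pi / 2) ^ 2 := sq_le_sq' (by linarith [abs_le.1 hdist]) (abs_le.1 hdist).2
          have h4 : z.im ^ 2 ≤ 1 := by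
            rw [← sq_abs]; nlinarith [abs_nonneg z.im]
          nlinarith
        exact le_of_sq_le_sq h1 (by norm_num)
      have hk0 : (0 : ℝ) ≤ k := Nat.cast_nonneg k
      have hsub : ∀ w ∈ closure (Metric.ball a 2), -Real.pi < w.re := by
        intro w hw
        rw [closure_ball _ (by norm_num), Metric.mem_closedBall, dist_eq_norm] at hw
        have h1 := (abs_le.1 ((Complex.abs_re_le_norm (w - a)).trans hw)).1
        rw [Complex.sub_re, hare] at h1
        have : 0 ≤ k * Real.pi := by positivity
        linarith [Real.pi_gt_three]
      have hmax := Complex.norm_le_of_forall_mem_frontier_norm_le (f := divSin f)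
        (U := Metric.ball a 2) (C := C / m * Real.exp (B * (z.re + 4) + |c| * 2))
        Metric.isBounded_ball ⟨?_, ?_⟩ ?_ hza
      · refine hmax.trans ?_
        calc C / m * Real.exp (B * (z.re + 4) + |c| * 2)
            ≤ C / m * Real.exp ((B * 4 + |c| * 2 + 1 - c) + (B * z.re - (1 - c) * |z.im|)) := by
              have : B * (z.re + 4) + |c| * 2 ≤
                  (B * 4 + |c| * 2 + 1 - c) + (B * z.re - (1 - c) * |z.im|) := by nlinarith
              gcongr ?_ * ?_
              exact Real.exp_le_exp.2 this
          _ = K * Real.exp (B * z.re - (1 - c) * |z.im|) := by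
              rw [Real.exp_add, hK]; ring
          _ ≤ _ := by
              gcongr
              linarith
      · intro w hw
        exact (hg w (hsub w (subset_closure hw))).differentiableWithinAt
      · intro w hw
        exact (hg w (hsub w hw)).continuousAt.continuousWithinAt
      · intro w hw
        have hwre := hsub w (frontier_subset_closure hw)
        rw [frontier_ball _ (by norm_num), mem_sphere_iff_norm] at hw
        have hs := hmsin (w - a) (by simpa using hw)
        rw [ha, hsincos] at hs
        have hs0 : 0 < ‖Complex.sin w‖ := lt_of_lt_of_le hm hs
        have h1 : |w.re| ≤ z.re + 4 := by
          have h2 := abs_le.1 ((Complex.abs_re_le_norm (w - a)).trans hw.le)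
          rw [Complex.sub_re, hare] at h2
          have h3 := abs_le.1 hdist
          have := Real.pi_lt_d2
          have : 0 ≤ k * Real.pi := by positivity
          rw [abs_le]
          constructor <;> linarith
        have h2 : |w.im| ≤ 2 := by
          have h2 := (Complex.abs_im_le_norm (w - a)).trans hw.le
          simpa [haim] using h2
        rw [divSin, if_neg (norm_pos_iff.1 hs0), norm_div]
        calc ‖f w‖ / ‖Complex.sin w‖ ≤ (C * Real.exp (B * |w.re| + c * |w.im|)) / m := by
              gcongr
              exact hb' w hwre
          _ = C / m * Real.exp (B * |w.re| + c * |w.im|) := by ring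
          _ ≤ _ := by
              gcongr
              · exact le_abs_self c
  have hgx := eq_zero_of_exp_decay (g := divSin f) (ε := 1 - c) (by linarith) ⟨?_, ?_⟩ hgb hx
  · have hx' : -Real.pi < (x : ℂ).re := by
      simp only [Complex.ofReal_re]; linarith [Real.pi_pos]
    by_cases hs : Complex.sin (x : ℂ) = 0
    · exact hzero _ hx' hs
    · rw [divSin, if_neg hs, div_eq_zero_iff] at hgx
      exact hgx.resolve_right hs
  · intro w hw
    exact (hg w (by have : 0 < w.re := hw; linarith [Real.pi_pos])).differentiableWithinAt
  · intro w hw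
    rw [Complex.closure_setOfPred_lt_re] at hw
    exact (hg w (by have : 0 ≤ w.re := hw; linarith [Real.pi_pos])).continuousAt.continuousWithinAt

/-! ### Pointwise bounds for functions of H². -/

/-- Mean value property of F², with the factor 1/(2π) ≤ 1 thrown away. The angle runs over (-π, π)
to match polar coordinates. -/
theorem enorm_sq_le_lintegral_circle {F : ℂ → ℂ} {ζ : ℂ} {s : ℝ} (hs : 0 < s)
    (hF : DifferentiableOn ℂ F (Metric.closedBall ζ s)) :
    ‖F ζ‖ₑ ^ 2 ≤ ∫⁻ θ in Ioo (-Real.pi) Real.pi, ‖F (circleMap ζ s θ)‖ₑ ^ 2 := by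
  have hd : DiffContOnCl ℂ (fun z => F z ^ 2) (Metric.ball ζ |s|) := by
    have : DifferentiableOn ℂ (fun z => F z ^ 2) (closure (Metric.ball ζ |s|)) := by
      rw [closure_ball _ (by simpa using hs.ne'), abs_of_pos hs]
      exact hF.pow 2
    exact this.diffContOnCl
  have h1 := hd.circleAverage
  rw [Real.circleAverage_def, Complex.real_smul] at h1
  have hper : ∫ θ in (0 : ℝ)..2 * Real.pi, F (circleMap ζ s θ) ^ 2 =
      ∫ θ in (-Real.pi)..Real.pi, F (circleMap ζ s θ) ^ 2 := by
    have hp : Function.Periodic (fun θ => F (circleMap ζ s θ) ^ 2) (2 * Real.pi) := by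
      intro θ
      simp only [periodic_circleMap ζ s θ]
    have := hp.intervalIntegral_add_eq 0 (-Real.pi)
    rw [zero_add] at this
    rw [this]
    congr 1
    ring
  rw [hper, intervalIntegral.integral_of_le (by linarith [Real.pi_pos]),
    integral_Ioc_eq_integral_Ioo] at h1
  have h2 : ‖F ζ‖ₑ ^ 2 = ‖(((2 * Real.pi)⁻¹ : ℝ) : ℂ)‖ₑ *
      ‖∫ θ in Ioo (-Real.pi) Real.pi, F (circleMap ζ s θ) ^ 2‖ₑ := by
    rw [← enorm_pow, ← h1, enorm_mul]
  have h3 : ‖(((2 * Real.pi)⁻¹ : ℝ) : ℂ)‖ₑ ≤ 1 := by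
    rw [← ofReal_norm, ENNReal.ofReal_le_one, Complex.norm_real, Real.norm_eq_abs,
      abs_of_pos (by positivity)]
    exact inv_le_one_of_one_le₀ (by linarith [Real.pi_gt_three])
  calc ‖F ζ‖ₑ ^ 2 ≤ 1 * ∫⁻ θ in Ioo (-Real.pi) Real.pi, ‖F (circleMap ζ s θ) ^ 2‖ₑ := by
        rw [h2]
        gcongr
        exact enorm_integral_le_lintegral_enorm _
    _ = _ := by simp only [one_mul, enorm_pow]

/-- A function of the Hardy space `H²` of a half-plane is bounded on smaller half-planes. -/
theorem IsHardyRight.exists_norm_le {δ δ' : ℝ} {F : ℂ → ℂ} (hF : IsHardyRight δ F) (h : δ < δ') :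
    ∃ C : ℝ, ∀ ζ : ℂ, δ' ≤ ζ.re → ‖F ζ‖ ≤ C := by
  obtain ⟨hd, M, hM⟩ := hF
  set r : ℝ := (δ' - δ) / 2 with hr
  have hr0 : 0 < r := by rw [hr]; linarith
  have hopen : IsOpen (rightHalfPlane δ) := isOpen_lt continuous_const Complex.continuous_re
  -- The area integral of |F|² over the disc of radius r about ζ is estimated twice: by 2rM from
  -- above, integrating along vertical lines, and by (r/2)²|F(ζ)|² from below, in polar coordinates.
  have key : ∀ ζ : ℂ, δ' ≤ ζ.re →
      ENNReal.ofReal (r / 2) * ENNReal.ofReal (r / 2) * ‖F ζ‖ₑ ^ 2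
        ≤ ENNReal.ofReal (2 * r) * M := by
    intro ζ hζ
    have hsub : ∀ z : ℂ, ‖z‖ ≤ r → ζ + z ∈ rightHalfPlane δ := by
      intro z hz
      have h1 := (abs_le.1 (Complex.abs_re_le_norm z)).1
      change δ < (ζ + z).re
      rw [Complex.add_re]
      linarith
    set g : ℂ → ENNReal := (Metric.ball (0 : ℂ) r).indicator fun z => ‖F (ζ + z)‖ₑ ^ 2 with hg
    have hup : ∫⁻ z, g z ≤ ENNReal.ofReal (2 * r) * M := by
      rw [← (Complex.volume_preserving_equiv_real_prod.symm).lintegral_comp_emb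
        Complex.measurableEquivRealProd.symm.measurableEmbedding]
      refine (lintegral_prod_le _).trans ?_
      have : ∀ x : ℝ, ∫⁻ y : ℝ, g (Complex.measurableEquivRealProd.symm (x, y)) ≤
          (Ioo (-r) r).indicator (fun _ => (M : ENNReal)) x := by
        intro x
        by_cases hx : x ∈ Ioo (-r) r
        · rw [indicator_of_mem hx]
          have h1 : δ < ζ.re + x := by linarith [hx.1]
          refine le_trans ?_ (hM (ζ.re + x) h1)
          rw [← lintegral_add_left_eq_self (μ := volume)
            (fun η : ℝ => ‖F (((ζ.re + x : ℝ) : ℂ) + (η : ℂ) * Complex.I)‖ₑ ^ 2) ζ.im]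
          refine lintegral_mono fun y => ?_
          refine (indicator_le_self _ _ _).trans ?_
          rw [Complex.measurableEquivRealProd_symm_apply]
          refine le_of_eq ?_
          congr 3
          apply Complex.ext <;> simp
        · rw [indicator_of_notMem hx]
          refine le_of_eq ?_
          rw [lintegral_eq_zero_of_ae_eq_zero]
          refine Eventually.of_forall fun y => ?_
          refine indicator_of_notMem (fun hmem => ?_) _
          · rw [mem_ball_zero_iff] at hmem
            have h1 := (Complex.abs_re_le_norm _).trans_lt hmem
            rw [Complex.measurableEquivRealProd_symm_apply] at h1
            exact hx (abs_lt.1 h1)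
      refine (lintegral_mono this).trans ?_
      rw [lintegral_indicator measurableSet_Ioo, setLIntegral_const, Real.volume_Ioo, mul_comm]
      gcongr
      linarith
    refine le_trans ?_ hup
    rw [← Complex.lintegral_comp_polarCoord_symm]
    have hmap : ∀ p : ℝ × ℝ, ζ + Complex.polarCoord.symm p = circleMap ζ p.1 p.2 := by
      intro p
      rw [Complex.polarCoord_symm_apply, circleMap, Complex.exp_mul_I]
      push_cast
      ring
    -- Only radii s in (r/2, r) are kept, so that the Jacobian s is at least r/2.
    calc ENNReal.ofReal (r / 2) * ENNReal.ofReal (r / 2) * ‖F ζ‖ₑ ^ 2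
        = ∫⁻ s in Ioo (r / 2) r, ENNReal.ofReal (r / 2) * ‖F ζ‖ₑ ^ 2 := by
          rw [setLIntegral_const, Real.volume_Ioo]
          have : r - r / 2 = r / 2 := by ring
          rw [this]; ring
      _ ≤ ∫⁻ s in Ioo (r / 2) r, ∫⁻ θ in Ioo (-Real.pi) Real.pi,
            ENNReal.ofReal s * ‖F (circleMap ζ s θ)‖ₑ ^ 2 := by
          refine setLIntegral_mono' measurableSet_Ioo fun s hs => ?_
          rw [lintegral_const_mul' _ _ ENNReal.ofReal_ne_top]
          gcongr
          · exact hs.1.le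
          · refine enorm_sq_le_lintegral_circle (by linarith [hs.1]) (hd.mono ?_)
            intro z hz
            have := hsub (z - ζ) (by
              rw [Metric.mem_closedBall, dist_eq_norm] at hz
              linarith [hs.2])
            simpa using this
      _ = ∫⁻ p in Ioo (r / 2) r ×ˢ Ioo (-Real.pi) Real.pi,
            ENNReal.ofReal p.1 * ‖F (circleMap ζ p.1 p.2)‖ₑ ^ 2 := by
          rw [Measure.volume_eq_prod, setLIntegral_prod]
          have hc : ContinuousOn (fun p : ℝ × ℝ => F (circleMap ζ p.1 p.2))
              (Ioo (r / 2) r ×ˢ Ioo (-Real.pi) Real.pi) := by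
            refine hd.continuousOn.comp (t := rightHalfPlane δ) ?_ ?_
            · unfold circleMap
              fun_prop
            · rintro ⟨s, θ⟩ ⟨hs, -⟩
              have := hsub (circleMap 0 s θ) (by
                rw [norm_circleMap_zero, abs_of_pos (by linarith [hs.1])]
                exact hs.2.le)
              have h2 : circleMap ζ s θ = ζ + circleMap 0 s θ := by simp [circleMap]
              simpa [h2] using this
          have hm : AEMeasurable (fun p : ℝ × ℝ => F (circleMap ζ p.1 p.2))
              ((volume.prod volume).restrict (Ioo (r / 2) r ×ˢ Ioo (-Real.pi) Real.pi)) :=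
            hc.aemeasurable (measurableSet_Ioo.prod measurableSet_Ioo)
          exact (measurable_fst.ennreal_ofReal.aemeasurable).mul (hm.enorm.pow_const 2)
      _ ≤ ∫⁻ p in polarCoord.target, ENNReal.ofReal p.1 • g (Complex.polarCoord.symm p) := by
          have hset : Ioo (r / 2) r ×ˢ Ioo (-Real.pi) Real.pi ⊆ polarCoord.target := by
            rintro ⟨s, θ⟩ ⟨hs, hθ⟩
            exact ⟨by have := hs.1; simp at this ⊢; linarith, hθ⟩
          refine le_trans ?_ (lintegral_mono_set hset)
          refine setLIntegral_mono' (measurableSet_Ioo.prod measurableSet_Ioo) ?_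
          rintro ⟨s, θ⟩ ⟨hs, -⟩
          rw [smul_eq_mul, hg, indicator_of_mem, hmap]
          rw [mem_ball_zero_iff, Complex.norm_polarCoord_symm, abs_of_pos (by linarith [hs.1])]
          exact hs.2
  refine ⟨Real.sqrt (2 * r * M / (r / 2 * (r / 2))), fun ζ hζ => ?_⟩
  have h1 := key ζ hζ
  apply Real.le_sqrt_of_sq_le
  rw [le_div_iff₀ (by positivity)]
  rw [← ENNReal.ofReal_mul (by positivity), ← ofReal_norm, ← ENNReal.ofReal_pow (norm_nonneg _),
    ← ENNReal.ofReal_mul (by positivity), ← ENNReal.ofReal_coe_nnreal,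
    ← ENNReal.ofReal_mul (by positivity), ENNReal.ofReal_le_ofReal_iff (by positivity)] at h1
  linarith

/-! ### Carlson classes in half-planes and uniqueness of interpolation. -/

theorem isOpen_rightHalfPlane (δ : ℝ) : IsOpen (rightHalfPlane δ) :=
  isOpen_lt continuous_const Complex.continuous_re

theorem closure_rightHalfPlane (δ : ℝ) : closure (rightHalfPlane δ) = {ζ | δ ≤ ζ.re} :=
  Complex.closure_setOfPred_lt_re δ

theorem convex_rightHalfPlane (δ : ℝ) : Convex ℝ (rightHalfPlane δ) :=
  convex_halfSpace_re_gt δ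

/-- Phragmen-Lindelöf: a function of exponential type in the right half-plane is controlled
inside by its type on the boundary. -/
theorem exists_norm_le_exp_of_boundary {f : ℂ → ℂ} {C₀ C A c : ℝ} (hA : 0 ≤ A) (hc : 0 ≤ c)
    (hd : DiffContOnCl ℂ f {z | 0 < z.re})
    (hf : ∀ z : ℂ, 0 ≤ z.re → ‖f z‖ ≤ C₀ * Real.exp (A * ‖z‖))
    (him : ∀ y : ℝ, ‖f (y * Complex.I)‖ ≤ C * Real.exp (c * |y|)) {z : ℂ} (hz : 0 ≤ z.re) :
    ‖f z‖ ≤ (max C₀ C) * Real.exp (A * z.re + c * |z.im|) := by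
  have hC₀ : 0 ≤ C₀ := by
    have h := (norm_nonneg _).trans (hf 0 (by simp))
    simpa using h
  -- The bound exp(c|Im z|) is the modulus of a single exponential only where Im z has constant
  -- sign, hence the two quadrants, σ being that sign. The factor makes h bounded on both edges of
  -- its quadrant.
  set h : ℝ → ℂ → ℂ := fun σ z => Complex.exp ((Complex.I * σ * c - A) * z) * f z with hh
  have hnorm : ∀ (σ : ℝ) (z : ℂ),
      ‖h σ z‖ = Real.exp (-(A * z.re + c * (σ * z.im))) * ‖f z‖ := by
    intro σ z
    rw [hh, norm_mul, Complex.norm_exp]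
    congr 2
    simp
    ring
  have hdh : ∀ σ, DiffContOnCl ℂ (h σ) {z | 0 < z.re} := fun σ =>
    DiffContOnCl.smul (c := fun z : ℂ => Complex.exp ((Complex.I * σ * c - A) * z))
      (Differentiable.diffContOnCl (by fun_prop)) hd
  have hgrow : ∀ (σ : ℝ) (z : ℂ), 0 ≤ z.re → 0 ≤ σ * z.im →
      ‖h σ z‖ ≤ C₀ * Real.exp (A * ‖z‖) := by
    intro σ z h1 h2
    rw [hnorm]
    calc _ ≤ 1 * (C₀ * Real.exp (A * ‖z‖)) := by
          gcongr
          · rw [Real.exp_le_one_iff]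
            have : 0 ≤ A * z.re + c * (σ * z.im) := by positivity
            linarith
          · exact hf z h1
      _ = _ := one_mul _
  have hreal : ∀ (σ x : ℝ), 0 ≤ x → ‖h σ x‖ ≤ max C₀ C := by
    intro σ x hx
    rw [hnorm]
    have h1 := hf x (by simpa using hx)
    have hxn : ‖(x : ℂ)‖ = x := by simp [hx]
    rw [hxn] at h1
    calc _ ≤ Real.exp (-(A * x)) * (C₀ * Real.exp (A * x)) := by
          simp only [Complex.ofReal_re, Complex.ofReal_im, mul_zero, add_zero]
          gcongr
      _ = C₀ * (Real.exp (-(A * x)) * Real.exp (A * x)) := by ring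
      _ = C₀ := by rw [← Real.exp_add]; simp
      _ ≤ _ := le_max_left _ _
  have himag : ∀ (σ y : ℝ), σ * y = |y| → ‖h σ (y * Complex.I)‖ ≤ max C₀ C := by
    intro σ y hy
    rw [hnorm]
    have e1 : ((y : ℂ) * Complex.I).re = 0 := by simp
    have e2 : ((y : ℂ) * Complex.I).im = y := by simp
    rw [e1, e2, hy]
    calc _ ≤ Real.exp (-(c * |y|)) * (C * Real.exp (c * |y|)) := by
          rw [mul_zero, zero_add]
          gcongr
          exact him y
      _ = C * (Real.exp (-(c * |y|)) * Real.exp (c * |y|)) := by ring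
      _ = C := by rw [← Real.exp_add]; simp
      _ ≤ _ := le_max_right _ _
  have hfin : ∀ σ : ℝ, σ * z.im = |z.im| → ‖h σ z‖ ≤ max C₀ C →
      ‖f z‖ ≤ (max C₀ C) * Real.exp (A * z.re + c * |z.im|) := by
    intro σ hσ h1
    rw [hnorm, hσ, Real.exp_neg, inv_mul_le_iff₀ (Real.exp_pos _)] at h1
    linarith
  rcases le_total 0 z.im with hi | hi
  · refine hfin 1 (by rw [one_mul, abs_of_nonneg hi]) ?_
    refine PhragmenLindelof.quadrant_I ((hdh 1).mono fun w hw => hw.1) ⟨1, by norm_num, A, ?_⟩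
      (hreal 1) (fun y hy => himag 1 y (by rw [one_mul, abs_of_nonneg hy])) hz hi
    refine Asymptotics.IsBigO.of_bound C₀ ?_
    rw [eventually_inf_principal]
    refine Eventually.of_forall fun w hw => ?_
    rw [Real.norm_eq_abs, Real.abs_exp, Real.rpow_one]
    exact hgrow 1 w (le_of_lt hw.1) (by have : 0 < w.im := hw.2; linarith)
  · refine hfin (-1) (by rw [abs_of_nonpos hi]; ring) ?_
    refine PhragmenLindelof.quadrant_IV ((hdh (-1)).mono fun w hw => hw.1) ⟨1, by norm_num, A, ?_⟩
      (hreal (-1)) (fun y hy => himag (-1) y (by rw [abs_of_nonpos hy]; ring)) hz hi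
    refine Asymptotics.IsBigO.of_bound C₀ ?_
    rw [eventually_inf_principal]
    refine Eventually.of_forall fun w hw => ?_
    rw [Real.norm_eq_abs, Real.abs_exp, Real.rpow_one]
    exact hgrow (-1) w (le_of_lt hw.1) (by have : w.im < 0 := hw.2; linarith)

/-- Functions on a half-plane of exponential type, of type less than `b` along vertical lines. -/
def HasCarlsonBound (b δ : ℝ) (F : ℂ → ℂ) : Prop :=
  ∃ C A c : ℝ, 0 ≤ C ∧ 0 ≤ A ∧ 0 ≤ c ∧ c < b ∧
    ∀ ζ : ℂ, δ < ζ.re → ‖F ζ‖ ≤ C * Real.exp (A * |ζ.re| + c * |ζ.im|)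

/-- By Phragmén–Lindelöf the type on the boundary line persists inside the half-plane. The resulting
estimate does not mention boundary values and is available for Hardy functions too, so that one
uniqueness argument serves both classes. -/
theorem IsCarlsonRight.hasCarlsonBound {b δ : ℝ} {F : ℂ → ℂ} (hb : 0 < b)
    (hF : IsCarlsonRight b δ F) : HasCarlsonBound b δ F := by
  obtain ⟨hd, ⟨C₀, A, hA⟩, C, c, hcb, hc⟩ := hF
  have hC₀ : 0 ≤ C₀ := by
    have h := (norm_nonneg _).trans (hA δ (by simp))
    exact nonneg_of_mul_nonneg_left h (Real.exp_pos _)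
  have hC : 0 ≤ C := by
    have h := (norm_nonneg _).trans (hc 0)
    exact nonneg_of_mul_nonneg_left h (Real.exp_pos _)
  set A' := max A 0
  set c' := max c 0
  set C₁ := C₀ * Real.exp (A' * |δ|) with hC₁
  have key : ∀ z : ℂ, 0 ≤ z.re →
      ‖F (δ + z)‖ ≤ max C₁ C * Real.exp (A' * z.re + c' * |z.im|) := by
    intro z hz
    refine exists_norm_le_exp_of_boundary (f := fun z => F (δ + z)) (le_max_right _ _)
      (le_max_right _ _) ?_ ?_ ?_ hz
    · refine hd.comp (g := fun z : ℂ => (δ : ℂ) + z) (Differentiable.diffContOnCl (by fun_prop)) ?_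
      intro w hw
      have : 0 < w.re := hw
      simpa [rightHalfPlane] using this
    · intro w hw
      refine (hA _ (by simpa using hw)).trans ?_
      rw [hC₁, mul_assoc, ← Real.exp_add]
      gcongr
      have h1 : ‖(δ : ℂ) + w‖ ≤ |δ| + ‖w‖ := by
        simpa using norm_add_le (δ : ℂ) w
      calc A * ‖(δ : ℂ) + w‖ ≤ A' * ‖(δ : ℂ) + w‖ := by gcongr; exact le_max_left _ _
        _ ≤ A' * (|δ| + ‖w‖) := by
            have : 0 ≤ A' := le_max_right _ _
            gcongr
        _ = _ := by ring
    · intro y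
      refine (hc y).trans ?_
      gcongr
      exact le_max_left _ _
  have hA' : 0 ≤ A' := le_max_right _ _
  refine ⟨max C₁ C * Real.exp (A' * |δ|), A', c', by positivity, hA', le_max_right _ _,
    max_lt hcb hb, fun ζ hζ => ?_⟩
  have h := key (ζ - δ) (by simp; linarith)
  rw [add_sub_cancel] at h
  refine h.trans ?_
  rw [mul_assoc, ← Real.exp_add]
  refine mul_le_mul_of_nonneg_left (Real.exp_le_exp.2 ?_) (by positivity)
  simp only [Complex.sub_re, Complex.ofReal_re, Complex.sub_im, Complex.ofReal_im, sub_zero]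
  have : ζ.re - δ ≤ |δ| + |ζ.re| := by linarith [le_abs_self ζ.re, neg_abs_le δ]
  nlinarith

theorem hasCarlsonBound_of_bounded {b δ C : ℝ} {F : ℂ → ℂ} (hb : 0 < b)
    (hF : ∀ ζ : ℂ, δ < ζ.re → ‖F ζ‖ ≤ C) : HasCarlsonBound b δ F := by
  refine ⟨|C|, 0, 0, abs_nonneg _, le_rfl, le_rfl, hb, fun ζ hζ => ?_⟩
  simpa using (hF ζ hζ).trans (le_abs_self C)

theorem HasCarlsonBound.mono {b δ δ' : ℝ} {F : ℂ → ℂ} (h : δ ≤ δ') (hF : HasCarlsonBound b δ F) :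
    HasCarlsonBound b δ' F := by
  obtain ⟨C, A, c, h1, h2, h3, h4, h5⟩ := hF
  exact ⟨C, A, c, h1, h2, h3, h4, fun ζ hζ => h5 ζ (lt_of_le_of_lt h hζ)⟩

theorem HasCarlsonBound.sub {b δ : ℝ} {F H : ℂ → ℂ} (hF : HasCarlsonBound b δ F)
    (hH : HasCarlsonBound b δ H) : HasCarlsonBound b δ (fun ζ => F ζ - H ζ) := by
  obtain ⟨C, A, c, h1, h2, h3, h4, h5⟩ := hF
  obtain ⟨C', A', c', h1', h2', h3', h4', h5'⟩ := hH
  refine ⟨C + C', max A A', max c c', by positivity, h2.trans (le_max_left _ _),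
    h3.trans (le_max_left _ _), max_lt h4 h4', fun ζ hζ => ?_⟩
  refine (norm_sub_le _ _).trans ?_
  rw [add_mul]
  gcongr
  · refine (h5 ζ hζ).trans ?_
    gcongr
    · exact le_max_left _ _
    · exact le_max_left _ _
  · refine (h5' ζ hζ).trans ?_
    gcongr
    · exact le_max_right _ _
    · exact le_max_right _ _

/-- **Carlson's theorem** in a half-plane: a function of type less than `b` along vertical lines
vanishes if it vanishes at equidistant points with spacing `π / b`. -/
theorem HasCarlsonBound.eqOn_zero {b δ a : ℝ} {f : ℂ → ℂ} (hb : 0 < b)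
    (hd : DifferentiableOn ℂ f (rightHalfPlane δ)) (hf : HasCarlsonBound b δ f)
    (h0 : ∀ n : ℕ, δ < a + n * (Real.pi / b) → f ((a + n * (Real.pi / b) : ℝ) : ℂ) = 0) :
    EqOn f 0 (rightHalfPlane δ) := by
  obtain ⟨C, A, c, hC, hA, hc, hcb, hbd⟩ := hf
  have hp : 0 < Real.pi / b := div_pos Real.pi_pos hb
  -- The extra 1 places the node x₀ more than one spacing to the right of δ: after rescaling,
  -- `carlson_of_nodes_nat_mul_pi` needs holomorphy on Re z > -π.
  obtain ⟨N, hN⟩ := exists_nat_gt ((δ - a) / (Real.pi / b) + 1)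
  set x₀ : ℝ := a + N * (Real.pi / b) with hx₀
  have hx₀δ : δ + Real.pi / b < x₀ := by
    have : ((δ - a) / (Real.pi / b) + 1) * (Real.pi / b) < N * (Real.pi / b) := by gcongr
    rw [add_mul, div_mul_cancel₀ _ hp.ne'] at this
    rw [hx₀]; linarith
  have hre : ∀ z : ℂ, ((x₀ : ℂ) + z / b).re = x₀ + z.re / b := by
    intro z
    simp [Complex.div_ofReal_re]
  have him : ∀ z : ℂ, ((x₀ : ℂ) + z / b).im = z.im / b := by
    intro z
    simp [Complex.div_ofReal_im]
  have hin : ∀ z : ℂ, -Real.pi < z.re → δ < ((x₀ : ℂ) + z / b).re := by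
    intro z hz
    rw [hre]
    have : -Real.pi / b < z.re / b := by gcongr
    rw [neg_div] at this
    linarith
  have hvan : ∀ x : ℝ, 0 < x → f ((x₀ : ℂ) + x / b) = 0 := by
    intro x hx
    refine carlson_of_nodes_nat_mul_pi (f := fun z => f ((x₀ : ℂ) + z / b)) (c := c / b)
      (C := C * Real.exp (A * |x₀|)) (A := A / b) ((div_lt_one hb).2 hcb) ?_ ?_ ?_ hx
    · exact hd.comp (by fun_prop) hin
    · intro z hz
      refine (hbd _ (hin z hz)).trans ?_
      rw [hre, him, mul_assoc, ← Real.exp_add, abs_div z.im, abs_of_pos hb]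
      refine mul_le_mul_of_nonneg_left (Real.exp_le_exp.2 ?_) hC
      have h1 : |x₀ + z.re / b| ≤ |x₀| + |z.re| / b := by
        refine (abs_add_le _ _).trans ?_
        rw [abs_div, abs_of_pos hb]
      calc A * |x₀ + z.re / b| + c * (|z.im| / b) ≤ A * (|x₀| + |z.re| / b) + c * (|z.im| / b) := by
            gcongr
        _ = _ := by ring
    · intro k
      have h2 : a + ((N + k : ℕ) : ℝ) * (Real.pi / b) = x₀ + k * Real.pi / b := by
        rw [hx₀]; push_cast; ring
      have h1 := h0 (N + k) (by
        rw [h2]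
        have : 0 ≤ k * Real.pi / b := by have := Real.pi_pos; positivity
        linarith)
      rw [h2] at h1
      rw [← h1]
      push_cast
      rfl
  have hana : AnalyticOnNhd ℂ f (rightHalfPlane δ) := hd.analyticOnNhd (isOpen_rightHalfPlane δ)
  have hx₁ : ((x₀ + 1 / b : ℝ) : ℂ) ∈ rightHalfPlane δ := by
    change δ < ((x₀ + 1 / b : ℝ) : ℂ).re
    rw [Complex.ofReal_re]
    have : 0 < 1 / b := by positivity
    linarith
  refine hana.eqOn_zero_of_preconnected_of_frequently_eq_zero
    (convex_rightHalfPlane δ).isPreconnected hx₁ ?_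
  have ht : Tendsto (fun t : ℝ => ((x₀ + 1 / b + t : ℝ) : ℂ)) (𝓝[>] 0)
      (𝓝[≠] ((x₀ + 1 / b : ℝ) : ℂ)) := by
    refine tendsto_nhdsWithin_iff.2 ⟨?_, ?_⟩
    · refine Tendsto.mono_left ?_ nhdsWithin_le_nhds
      have : Continuous fun t : ℝ => ((x₀ + 1 / b + t : ℝ) : ℂ) := by fun_prop
      simpa using this.tendsto 0
    · filter_upwards [self_mem_nhdsWithin] with t ht
      have ht' : 0 < t := ht
      simp only [mem_compl_iff, mem_singleton_iff, Complex.ofReal_inj]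
      linarith
  refine ht.frequently (Eventually.frequently ?_)
  filter_upwards [self_mem_nhdsWithin] with t ht
  have ht' : 0 < t := ht
  have := hvan (1 + b * t) (by positivity)
  convert this using 2
  have hb' : (b : ℂ) ≠ 0 := by exact_mod_cast hb.ne'
  push_cast
  field_simp
  ring

theorem eqOn_rightHalfPlane_of_forall_gt {F H : ℂ → ℂ} {δ : ℝ}
    (h : ∀ δ' : ℝ, δ < δ' → EqOn H F (rightHalfPlane δ')) : EqOn H F (rightHalfPlane δ) := by
  intro ζ hζ
  obtain ⟨δ', h1, h2⟩ := exists_between (show δ < ζ.re from hζ)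
  exact h δ' h1 h2

/-- The bounded holomorphic interpolation is unique in the class of functions satisfying
Carlson's bound in slightly smaller half-planes. -/
theorem eqOn_of_carlson {b a δ : ℝ} {F H : ℂ → ℂ} (hb : 0 < b)
    (hFd : ∀ δ' : ℝ, δ < δ' → DifferentiableOn ℂ F (rightHalfPlane δ'))
    (hFb : ∀ δ' : ℝ, δ < δ' → HasCarlsonBound b δ' F)
    (hHd : DifferentiableOn ℂ H (rightHalfPlane δ))
    (hHb : ∀ δ' : ℝ, δ < δ' → HasCarlsonBound b δ' H)
    (h0 : ∀ n : ℕ, δ < a + n * (Real.pi / b) →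
      H ((a + n * (Real.pi / b) : ℝ) : ℂ) = F ((a + n * (Real.pi / b) : ℝ) : ℂ)) :
    EqOn H F (rightHalfPlane δ) := by
  refine eqOn_rightHalfPlane_of_forall_gt fun δ' hδ' => ?_
  have hmono : rightHalfPlane δ' ⊆ rightHalfPlane δ := fun ζ hζ => lt_trans hδ' hζ
  have := HasCarlsonBound.eqOn_zero (f := fun ζ => H ζ - F ζ) (a := a) hb
    ((hHd.mono hmono).sub (hFd δ' hδ')) ((hHb δ' hδ').sub (hFb δ' hδ'))
    (fun n hn => sub_eq_zero.2 (h0 n (hδ'.trans hn)))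
  exact fun ζ hζ => sub_eq_zero.1 (this hζ)

/-- An H² function is bounded, hence of type 0, but only after the half-plane is shrunk; this is why
uniqueness is proved for every δ' > δ first. -/
theorem IsHardyRight.hasCarlsonBound {b δ δ' : ℝ} {F : ℂ → ℂ} (hb : 0 < b)
    (hF : IsHardyRight δ F) (h : δ < δ') : HasCarlsonBound b δ' F := by
  obtain ⟨C, hC⟩ := hF.exists_norm_le h
  exact hasCarlsonBound_of_bounded hb fun ζ hζ => hC ζ hζ.le

/-! ### Plancherel's theorem and Laplace transforms of functions of subexponential growth. -/

open FourierTransform in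
/-- **Plancherel's theorem** for integrable square-integrable functions. -/
theorem eLpNorm_fourier_eq {f : ℝ → ℂ} (hf1 : Integrable f volume)
    (hf2 : MemLp f 2 volume) : eLpNorm (𝓕 f) 2 volume = eLpNorm f 2 volume := by
  set g : Lp ℂ 2 (volume : Measure ℝ) := 𝓕 (hf2.toLp f) with hg
  have hcont : Continuous (𝓕 f) :=
    VectorFourier.fourierIntegral_continuous (μ := volume) (L := innerₗ ℝ)
      Real.continuous_fourierChar (continuous_inner (𝕜 := ℝ) (E := ℝ)) hf1
  have hgl : LocallyIntegrable (g : ℝ → ℂ) volume :=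
    (Lp.memLp g).locallyIntegrable (by norm_num)
  -- The L² transform and the Fourier integral of f have the same pairing with test functions: in
  -- both cases the transform can be moved onto the test function.
  have hae : ∀ᵐ x ∂(volume : Measure ℝ), g x = 𝓕 f x := by
    refine ae_eq_of_integral_contDiff_smul_eq hgl hcont.locallyIntegrable ?_
    intro φ hφ hφc
    have hφ' : ContDiff ℝ (⊤ : ℕ∞) (fun x => (φ x : ℂ)) := Complex.ofRealCLM.contDiff.comp hφ
    have hφc' : HasCompactSupport (fun x => (φ x : ℂ)) := by
      refine hφc.comp_left (g := fun x : ℝ => (x : ℂ)) (by simp)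
    set ψ : SchwartzMap ℝ ℂ := hφc'.toSchwartzMap hφ' with hψ
    have hψa : ∀ x, ψ x = (φ x : ℂ) := fun x => rfl
    have h1 := congrArg (fun T => T ψ) (Lp.fourier_toTemperedDistribution_eq (hf2.toLp f))
    simp only [TemperedDistribution.fourier_apply, Lp.toTemperedDistribution_apply] at h1
    have h2 : ∫ x, (𝓕 ψ) x • (hf2.toLp f) x = ∫ x, (𝓕 (ψ : ℝ → ℂ)) x • f x := by
      refine integral_congr_ae ?_
      filter_upwards [hf2.coeFn_toLp] with x hx
      rw [hx, SchwartzMap.fourier_coe]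
    have h3 := VectorFourier.integral_fourierIntegral_smul_eq_flip (μ := volume) (ν := volume)
      (L := innerₗ ℝ) (f := (ψ : ℝ → ℂ)) (g := f) Real.continuous_fourierChar
      (by exact continuous_inner) ψ.integrable hf1
    rw [flip_innerₗ] at h3
    have h4 : ∫ x, (𝓕 (ψ : ℝ → ℂ)) x • f x = ∫ x, ψ x • 𝓕 f x := h3
    rw [h2, h4] at h1
    simpa [hψa] using h1.symm
  rw [← eLpNorm_congr_ae hae]
  have h5 := Lp.norm_fourier_eq (hf2.toLp f)
  have h6 : ‖g‖ₑ = ‖hf2.toLp f‖ₑ := by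
    rw [← ofReal_norm, ← ofReal_norm, hg, h5]
  rw [Lp.enorm_def, Lp.enorm_def] at h6
  rw [h6]
  exact eLpNorm_congr_ae hf2.coeFn_toLp

/-- Continuous functions of subexponential growth. -/
def IsSubexponential (J : ℝ → ℂ) : Prop :=
  Continuous J ∧ ∀ η : ℝ, 0 < η → ∃ C : ℝ, ∀ v : ℝ, ‖J v‖ ≤ C * Real.exp (η * |v|)

theorem norm_exp_neg_mul (ζ : ℂ) (v : ℝ) :
    ‖Complex.exp (-(ζ * (v : ℂ)))‖ = Real.exp (-(ζ.re * v)) := by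
  rw [Complex.norm_exp]; simp

theorem IsSubexponential.exists_bound {J : ℝ → ℂ} (hJ : IsSubexponential J) {η : ℝ} (hη : 0 < η) :
    ∃ C : ℝ, 0 ≤ C ∧ ∀ v : ℝ, 0 < v → ‖J v‖ ≤ C * Real.exp (η * v) := by
  obtain ⟨C, hC⟩ := hJ.2 η hη
  refine ⟨C, ?_, fun v hv => by simpa [abs_of_pos hv] using hC v⟩
  have := (norm_nonneg _).trans (hC 0)
  simpa using this

theorem integrableOn_exp_neg_mul {a : ℝ} (ha : 0 < a) :
    IntegrableOn (fun v : ℝ => Real.exp (-(a * v))) (Ioi 0) := by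
  simpa [neg_mul] using exp_neg_integrableOn_Ioi 0 ha

theorem IsSubexponential.integrableOn_laplace {J : ℝ → ℂ} (hJ : IsSubexponential J) {ζ : ℂ}
    (hζ : 0 < ζ.re) :
    IntegrableOn (fun v : ℝ => J v * Complex.exp (-(ζ * (v : ℂ)))) (Ioi (0 : ℝ)) := by
  obtain ⟨C, hC0, hC⟩ := hJ.exists_bound (half_pos hζ)
  have hi : IntegrableOn (fun v : ℝ => C * Real.exp (-(ζ.re / 2 * v))) (Ioi 0) :=
    (integrableOn_exp_neg_mul (half_pos hζ)).const_mul C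
  refine Integrable.mono' hi ?_ ?_
  · have := hJ.1
    exact (by fun_prop : Continuous fun v : ℝ => J v * Complex.exp (-(ζ * (v : ℂ)))).aestronglyMeasurable
  · filter_upwards [ae_restrict_mem measurableSet_Ioi] with v hv
    rw [norm_mul, norm_exp_neg_mul]
    calc _ ≤ C * Real.exp (ζ.re / 2 * v) * Real.exp (-(ζ.re * v)) := by
          gcongr; exact hC v hv
      _ = C * Real.exp (-(ζ.re / 2 * v)) := by
          rw [mul_assoc, ← Real.exp_add]; congr 2; ring

theorem IsSubexponential.exists_norm_laplacePlus_le {J : ℝ → ℂ} (hJ : IsSubexponential J) {δ : ℝ}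
    (hδ : 0 < δ) : ∃ C : ℝ, ∀ ζ : ℂ, δ ≤ ζ.re → ‖laplacePlus J ζ‖ ≤ C := by
  have hi := (hJ.integrableOn_laplace (ζ := (δ : ℂ)) (by simpa using hδ)).norm
  refine ⟨_, fun ζ hζ => norm_integral_le_of_norm_le hi ?_⟩
  filter_upwards [ae_restrict_mem measurableSet_Ioi] with v hv
  rw [norm_mul, norm_mul, norm_exp_neg_mul, norm_exp_neg_mul]
  have hv' : 0 < v := hv
  refine mul_le_mul_of_nonneg_left (Real.exp_le_exp.2 ?_) (norm_nonneg _)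
  rw [Complex.ofReal_re]
  nlinarith

theorem IsSubexponential.differentiableAt_laplacePlus {J : ℝ → ℂ} (hJ : IsSubexponential J) {ζ₀ : ℂ}
    (hζ : 0 < ζ₀.re) : DifferentiableAt ℂ (laplacePlus J) ζ₀ := by
  -- Near ζ₀ the exponential decays at least like exp(-3ρv): one ρ pays for the growth of J, one for
  -- the factor v produced by differentiation, and one is left for integrability.
  set ρ := ζ₀.re / 4 with hρ
  have hρ0 : 0 < ρ := by positivity
  obtain ⟨C, hC0, hC⟩ := hJ.exists_bound hρ0
  have hJc := hJ.1
  have hs : {ζ : ℂ | 3 * ρ < ζ.re} ∈ 𝓝 ζ₀ :=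
    (isOpen_lt continuous_const Complex.continuous_re).mem_nhds
      (by change 3 * ρ < ζ₀.re; linarith)
  have hi : IntegrableOn (fun v : ℝ => C / ρ * Real.exp (-(ρ * v))) (Ioi 0) :=
    (integrableOn_exp_neg_mul hρ0).const_mul _
  refine (hasDerivAt_integral_of_dominated_loc_of_deriv_le
    (F := fun ζ (v : ℝ) => J v * Complex.exp (-(ζ * (v : ℂ))))
    (F' := fun ζ (v : ℝ) => J v * (Complex.exp (-(ζ * (v : ℂ))) * (-(v : ℂ))))
    hs ?_ (hJ.integrableOn_laplace hζ) ?_ ?_ hi ?_).2.differentiableAt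
  · refine Eventually.of_forall fun ζ => ?_
    exact (by fun_prop : Continuous fun v : ℝ => J v * Complex.exp (-(ζ * (v : ℂ)))).aestronglyMeasurable
  · exact (by fun_prop : Continuous fun v : ℝ =>
      J v * (Complex.exp (-(ζ₀ * (v : ℂ))) * (-(v : ℂ)))).aestronglyMeasurable
  · filter_upwards [ae_restrict_mem measurableSet_Ioi] with v hv ζ hζ'
    have hv' : 0 < v := hv
    have hζ2 : 3 * ρ < ζ.re := hζ'
    rw [norm_mul, norm_mul, norm_exp_neg_mul, norm_neg, Complex.norm_real, Real.norm_eq_abs,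
      abs_of_pos hv']
    have h1 : v ≤ 1 / ρ * Real.exp (ρ * v) := by
      have := Real.add_one_le_exp (ρ * v)
      rw [one_div, ← div_eq_inv_mul, le_div_iff₀ hρ0]
      linarith
    calc _ ≤ C * Real.exp (ρ * v) * (Real.exp (-(3 * ρ * v)) * (1 / ρ * Real.exp (ρ * v))) := by
          gcongr
          exact hC v hv
      _ = C / ρ * (Real.exp (ρ * v) * Real.exp (-(3 * ρ * v)) * Real.exp (ρ * v)) := by ring
      _ = _ := by
          rw [← Real.exp_add, ← Real.exp_add]; congr 2; ring
  · refine Eventually.of_forall fun v ζ _ => ?_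
    have h1 : HasDerivAt (fun ζ : ℂ => -(ζ * (v : ℂ))) (-(v : ℂ)) ζ :=
      (hasDerivAt_mul_const (v : ℂ)).fun_neg
    exact (h1.cexp).const_mul (J v)

-- On Re ζ = ξ the transform is the Fourier transform of the cut-off function J(v) exp(-ξv), v > 0,
-- at frequency η/(2π). Plancherel's theorem gives its L² norm, which decreases with ξ, so the value
-- at ξ = δ bounds all of them.
open FourierTransform in
theorem IsSubexponential.isHardyRight_laplacePlus {J : ℝ → ℂ} (hJ : IsSubexponential J) {δ : ℝ}
    (hδ : 0 < δ) : IsHardyRight δ (laplacePlus J) := by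
  refine ⟨fun ζ hζ => (hJ.differentiableAt_laplacePlus (hδ.trans hζ)).differentiableWithinAt, ?_⟩
  have hJc := hJ.1
  set E : ℝ → ℝ → ℂ := fun ξ => (Ioi (0 : ℝ)).indicator fun v => J v * Complex.exp (-((ξ : ℂ) * (v : ℂ)))
    with hE
  have hEin : ∀ ξ v : ℝ, v ∈ Ioi (0 : ℝ) → E ξ v = J v * Complex.exp (-((ξ : ℂ) * (v : ℂ))) :=
    fun ξ v hv => indicator_of_mem hv _
  have hEout : ∀ ξ v : ℝ, v ∉ Ioi (0 : ℝ) → E ξ v = 0 := fun ξ v hv => indicator_of_notMem hv _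
  have hE1 : ∀ ξ : ℝ, 0 < ξ → Integrable (E ξ) := fun ξ hξ =>
    (integrable_indicator_iff measurableSet_Ioi).2
      (hJ.integrableOn_laplace (ζ := (ξ : ℂ)) (by simpa using hξ))
  have hE2 : ∀ ξ : ℝ, 0 < ξ → MemLp (E ξ) 2 := by
    intro ξ hξ
    rw [memLp_two_iff_integrable_sq_norm (hE1 ξ hξ).aestronglyMeasurable]
    obtain ⟨C, hC0, hC⟩ := hJ.exists_bound (half_pos hξ)
    have hi : Integrable ((Ioi (0 : ℝ)).indicator fun v : ℝ => C ^ 2 * Real.exp (-(ξ * v))) :=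
      (integrable_indicator_iff measurableSet_Ioi).2 ((integrableOn_exp_neg_mul hξ).const_mul _)
    refine Integrable.mono' hi ((hE1 ξ hξ).aestronglyMeasurable.norm.pow 2) ?_
    refine Eventually.of_forall fun v => ?_
    by_cases hv : v ∈ Ioi (0 : ℝ)
    · rw [hEin ξ v hv, indicator_of_mem hv, norm_mul, norm_exp_neg_mul,
        Real.norm_eq_abs, abs_of_nonneg (by positivity)]
      calc _ ≤ (C * Real.exp (ξ / 2 * v) * Real.exp (-(ξ * v))) ^ 2 := by
            simp only [Complex.ofReal_re]
            gcongr; exact hC v hv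
        _ = C ^ 2 * (Real.exp (ξ / 2 * v) * Real.exp (-(ξ * v)) *
              (Real.exp (ξ / 2 * v) * Real.exp (-(ξ * v)))) := by ring
        _ = _ := by
            rw [← Real.exp_add, ← Real.exp_add]; congr 2; ring
    · rw [hEout ξ v hv, indicator_of_notMem hv]; simp
  have hfin : 2 * ENNReal.ofReal Real.pi * eLpNorm (E δ) 2 volume ^ 2 ≠ ⊤ :=
    ENNReal.mul_ne_top (ENNReal.mul_ne_top (by simp) ENNReal.ofReal_ne_top)
      (ENNReal.pow_ne_top (hE2 δ hδ).2.ne)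
  refine ⟨(2 * ENNReal.ofReal Real.pi * eLpNorm (E δ) 2 volume ^ 2).toNNReal, fun ξ hξ => ?_⟩
  rw [ENNReal.coe_toNNReal hfin]
  have hξ0 : 0 < ξ := hδ.trans hξ
  have hF : ∀ w : ℝ, laplacePlus J ((ξ : ℂ) + ((2 * Real.pi * w : ℝ) : ℂ) * Complex.I) = 𝓕 (E ξ) w := by
    intro w
    rw [Real.fourier_real_eq_integral_exp_smul, laplacePlus, ← integral_indicator measurableSet_Ioi]
    congr 1
    ext v
    by_cases hv : v ∈ Ioi (0 : ℝ)
    · rw [hEin ξ v hv, indicator_of_mem hv, smul_eq_mul, mul_left_comm, ← Complex.exp_add]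
      congr 2
      push_cast
      ring
    · rw [hEout ξ v hv, indicator_of_notMem hv, smul_zero]
  have hscale : ∫⁻ η : ℝ, ‖laplacePlus J ((ξ : ℂ) + (η : ℂ) * Complex.I)‖ₑ ^ 2 =
      2 * ENNReal.ofReal Real.pi * ∫⁻ w : ℝ, ‖𝓕 (E ξ) w‖ₑ ^ 2 := by
    have h2π : (2 * Real.pi) ≠ 0 := by have := Real.pi_pos; positivity
    have hmap := Real.smul_map_volume_mul_left h2π
    rw [abs_of_pos (by have := Real.pi_pos; positivity)] at hmap
    conv_lhs => rw [← hmap]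
    rw [lintegral_smul_measure]
    have hm := (Homeomorph.mulLeft₀ (2 * Real.pi) h2π).measurableEmbedding.lintegral_map
      (μ := volume) (fun η : ℝ => ‖laplacePlus J ((ξ : ℂ) + (η : ℂ) * Complex.I)‖ₑ ^ 2)
    simp only [Homeomorph.coe_mulLeft₀] at hm
    rw [hm]
    rw [ENNReal.ofReal_mul (by norm_num), ENNReal.ofReal_ofNat, smul_eq_mul]
    congr 1
    refine lintegral_congr fun w => ?_
    rw [← hF w]
  rw [hscale]
  have hsq : ∀ f : ℝ → ℂ, ∫⁻ w : ℝ, ‖f w‖ₑ ^ 2 = eLpNorm f 2 volume ^ 2 := by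
    intro f
    have := eLpNorm_nnreal_pow_eq_lintegral (f := f) (μ := (volume : Measure ℝ)) (p := 2) (by norm_num)
    simp only [NNReal.coe_ofNat, ENNReal.rpow_ofNat, ENNReal.coe_ofNat] at this
    exact this.symm
  rw [hsq, eLpNorm_fourier_eq (hE1 ξ hξ0) (hE2 ξ hξ0)]
  gcongr
  refine eLpNorm_mono fun v => ?_
  by_cases hv : v ∈ Ioi (0 : ℝ)
  · have hv' : 0 < v := hv
    rw [hEin ξ v hv, hEin δ v hv, norm_mul, norm_mul, norm_exp_neg_mul,
      norm_exp_neg_mul]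
    simp only [Complex.ofReal_re]
    gcongr
  · rw [hEout ξ v hv, hEout δ v hv]

/-! ### Generating functions of Laplace transforms: the Stieltjes integral. -/

/-- `∫_0^∞ J(v) w e^{-pv} / (1 - w e^{-pv}) dv`. -/
noncomputable def stieltjes (p : ℝ) (J : ℝ → ℂ) (w : ℂ) : ℂ :=
  ∫ v in Ioi (0 : ℝ), J v *
    (w * (Real.exp (-(p * v)) : ℂ) / (1 - w * (Real.exp (-(p * v)) : ℂ)))

theorem exists_forall_le_norm_one_sub {w : ℂ} (hw : ∀ t : ℝ, t ∈ Icc (0 : ℝ) 1 → 1 - w * t ≠ 0) :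
    ∃ c : ℝ, 0 < c ∧ ∀ t : ℝ, t ∈ Icc (0 : ℝ) 1 → c ≤ ‖1 - w * t‖ := by
  obtain ⟨t, ht, hmin⟩ := (isCompact_Icc (a := (0 : ℝ)) (b := 1)).exists_isMinOn
    ⟨0, by simp⟩ (f := fun t : ℝ => ‖1 - w * t‖) (by fun_prop)
  exact ⟨‖1 - w * t‖, norm_pos_iff.2 (hw t ht), fun s hs => hmin hs⟩

theorem exp_neg_mem_Icc {p v : ℝ} (hp : 0 < p) (hv : 0 < v) :
    Real.exp (-(p * v)) ∈ Icc (0 : ℝ) 1 :=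
  ⟨(Real.exp_pos _).le, Real.exp_le_one_iff.2 (by have := mul_pos hp hv; linarith)⟩

theorem IsSubexponential.integrableOn_mul_exp {J : ℝ → ℂ} (hJ : IsSubexponential J) {p : ℝ}
    (hp : 0 < p) : IntegrableOn (fun v : ℝ => ‖J v‖ * Real.exp (-(p * v))) (Ioi 0) := by
  refine (hJ.integrableOn_laplace (ζ := (p : ℂ)) (by simpa using hp)).norm.congr ?_
  refine Eventually.of_forall fun v => ?_
  simp only [norm_mul, norm_exp_neg_mul, Complex.ofReal_re]

theorem measurable_stieltjes_integrand {J : ℝ → ℂ} (hJ : Continuous J) (p : ℝ) :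
    Measurable fun x : ℂ × ℝ => J x.2 *
      (x.1 * (Real.exp (-(p * x.2)) : ℂ) / (1 - x.1 * (Real.exp (-(p * x.2)) : ℂ))) := by
  have h1 : Measurable fun x : ℂ × ℝ => J x.2 := (hJ.comp continuous_snd).measurable
  have h2 : Measurable fun x : ℂ × ℝ => x.1 * (Real.exp (-(p * x.2)) : ℂ) := by fun_prop
  exact h1.mul (h2.div (measurable_const.sub h2))

/-- The values t = exp(-pv) stay in the compact interval [0, 1], so |1 - zt| is bounded below
uniformly in v and in z near w. The remaining factor exp(-pv) beats the growth of J and permits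
differentiation under the integral. -/
theorem IsSubexponential.differentiableAt_stieltjes {J : ℝ → ℂ} (hJ : IsSubexponential J) {p : ℝ}
    (hp : 0 < p) {w : ℂ} (hw : ∀ t : ℝ, t ∈ Icc (0 : ℝ) 1 → 1 - w * t ≠ 0) :
    DifferentiableAt ℂ (stieltjes p J) w := by
  obtain ⟨c, hc0, hc⟩ := exists_forall_le_norm_one_sub hw
  have hlow : ∀ z ∈ Metric.ball w (c / 2), ∀ t : ℝ, t ∈ Icc (0 : ℝ) 1 → c / 2 ≤ ‖1 - z * t‖ := by
    intro z hz t ht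
    rw [mem_ball_iff_norm] at hz
    have h1 := hc t ht
    have h2 : ‖1 - w * t‖ ≤ ‖1 - z * t‖ + ‖(z - w) * t‖ := by
      have : (1 : ℂ) - w * t = (1 - z * t) + (z - w) * t := by ring
      rw [this]; exact norm_add_le _ _
    have h3 : ‖(z - w) * t‖ ≤ c / 2 := by
      rw [norm_mul, Complex.norm_real, Real.norm_eq_abs, abs_of_nonneg ht.1]
      nlinarith [ht.1, ht.2, norm_nonneg (z - w)]
    linarith
  have hm := measurable_stieltjes_integrand hJ.1 p
  have hm' : ∀ z : ℂ, Measurable fun v : ℝ => J v *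
      (z * (Real.exp (-(p * v)) : ℂ) / (1 - z * (Real.exp (-(p * v)) : ℂ))) := fun z =>
    hm.comp (measurable_const.prodMk measurable_id)
  have hne : ∀ z ∈ Metric.ball w (c / 2), ∀ v : ℝ, 0 < v →
      1 - z * (Real.exp (-(p * v)) : ℂ) ≠ 0 := fun z hz v hv =>
    norm_pos_iff.1 (lt_of_lt_of_le (half_pos hc0) (hlow z hz _ (exp_neg_mem_Icc hp hv)))
  have hint := hJ.integrableOn_mul_exp hp
  refine (hasDerivAt_integral_of_dominated_loc_of_deriv_le
    (F := fun z (v : ℝ) => J v * (z * (Real.exp (-(p * v)) : ℂ) / (1 - z * (Real.exp (-(p * v)) : ℂ))))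
    (F' := fun z (v : ℝ) => J v * ((Real.exp (-(p * v)) : ℂ) / (1 - z * (Real.exp (-(p * v)) : ℂ)) ^ 2))
    (Metric.ball_mem_nhds w (half_pos hc0)) ?_ ?_ ?_ ?_ (hint.mul_const ((c / 2) ^ 2)⁻¹)
    ?_).2.differentiableAt
  · exact Eventually.of_forall fun z => (hm' z).aestronglyMeasurable
  · refine Integrable.mono' (hint.mul_const (‖w‖ / (c / 2))) (hm' w).aestronglyMeasurable ?_
    filter_upwards [ae_restrict_mem measurableSet_Ioi] with v hv
    have hl := hlow w (Metric.mem_ball_self (half_pos hc0)) _ (exp_neg_mem_Icc hp hv)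
    rw [norm_mul, norm_div, norm_mul, Complex.norm_real, Real.norm_eq_abs, Real.abs_exp]
    calc _ ≤ ‖J v‖ * (‖w‖ * Real.exp (-(p * v)) / (c / 2)) := by gcongr
      _ = _ := by ring
  · have hJm := hJ.1.measurable
    refine Measurable.aestronglyMeasurable ?_
    fun_prop
  · filter_upwards [ae_restrict_mem measurableSet_Ioi] with v hv z hz
    have hl := hlow z hz _ (exp_neg_mem_Icc hp hv)
    rw [norm_mul, norm_div, norm_pow, Complex.norm_real, Real.norm_eq_abs, Real.abs_exp]
    calc _ ≤ ‖J v‖ * (Real.exp (-(p * v)) / (c / 2) ^ 2) := by gcongr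
      _ = _ := by rw [div_eq_mul_inv]; ring
  · filter_upwards [ae_restrict_mem measurableSet_Ioi] with v hv z hz
    refine HasDerivAt.const_mul (J v) ?_
    have h1 : HasDerivAt (fun z : ℂ => z * (Real.exp (-(p * v)) : ℂ)) (Real.exp (-(p * v)) : ℂ) z :=
      hasDerivAt_mul_const _
    have h2 := h1.div (h1.const_sub 1) (hne z hz v hv)
    convert h2 using 1
    congr 1
    ring

/-- Geometric expansion of the kernel, integrated term by term. For p = π/β the sample points p(n +
1) are the frequencies ζₙ of positive index. -/
theorem IsSubexponential.hasSum_stieltjes {J : ℝ → ℂ} (hJ : IsSubexponential J) {p : ℝ}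
    (hp : 0 < p) {w : ℂ} (hw : ‖w‖ < 1) :
    HasSum (fun n : ℕ => w ^ (n + 1) * laplacePlus J ((p * (n + 1) : ℝ) : ℂ)) (stieltjes p J w) := by
  have hint := hJ.integrableOn_mul_exp hp
  have hJc := hJ.1
  have key := hasSum_integral_of_dominated_convergence (μ := volume.restrict (Ioi (0 : ℝ)))
    (F := fun (n : ℕ) (v : ℝ) => J v * (w * (Real.exp (-(p * v)) : ℂ)) ^ (n + 1))
    (f := fun v : ℝ => J v *
      (w * (Real.exp (-(p * v)) : ℂ) / (1 - w * (Real.exp (-(p * v)) : ℂ))))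
    (fun n v => ‖w‖ ^ (n + 1) * (‖J v‖ * Real.exp (-(p * v)))) ?_ ?_ ?_ ?_ ?_
  · have e : ∀ n : ℕ, ∫ v in Ioi (0 : ℝ), J v * (w * (Real.exp (-(p * v)) : ℂ)) ^ (n + 1) =
        w ^ (n + 1) * laplacePlus J ((p * (n + 1) : ℝ) : ℂ) := ?_
    · simp_rw [e] at key
      exact key
    intro n
    rw [laplacePlus, ← integral_const_mul]
    refine integral_congr_ae (Eventually.of_forall fun v => ?_)
    dsimp only
    rw [mul_pow, ← Complex.ofReal_pow, ← Real.exp_nat_mul]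
    rw [Complex.ofReal_exp]
    push_cast
    ring_nf
  · intro n
    exact (by fun_prop : Continuous fun v : ℝ =>
      J v * (w * (Real.exp (-(p * v)) : ℂ)) ^ (n + 1)).aestronglyMeasurable
  · intro n
    filter_upwards [ae_restrict_mem measurableSet_Ioi] with v hv
    have ht := exp_neg_mem_Icc hp hv
    rw [norm_mul, norm_pow, norm_mul, Complex.norm_real, Real.norm_eq_abs, Real.abs_exp, mul_pow]
    have : Real.exp (-(p * v)) ^ (n + 1) ≤ Real.exp (-(p * v)) := by
      rw [pow_succ]
      exact mul_le_of_le_one_left ht.1 (pow_le_one₀ ht.1 ht.2)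
    calc _ ≤ ‖J v‖ * (‖w‖ ^ (n + 1) * Real.exp (-(p * v))) := by gcongr
      _ = _ := by ring
  · refine Eventually.of_forall fun v => ?_
    refine Summable.mul_right _ ?_
    exact (summable_nat_add_iff 1).2 (summable_geometric_of_lt_one (norm_nonneg _) hw)
  · simp only [tsum_mul_right]
    exact hint.const_mul _
  · filter_upwards [ae_restrict_mem measurableSet_Ioi] with v hv
    have ht := exp_neg_mem_Icc hp hv
    refine HasSum.mul_left _ ?_
    have hq : ‖w * (Real.exp (-(p * v)) : ℂ)‖ < 1 := by
      rw [norm_mul, Complex.norm_real, Real.norm_eq_abs, Real.abs_exp]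
      nlinarith [ht.1, ht.2, norm_nonneg w]
    have := (hasSum_geometric_of_norm_lt_one hq).mul_left (w * (Real.exp (-(p * v)) : ℂ))
    simpa only [pow_succ', div_eq_mul_inv] using this

/-- Multiplication by the conjugate of w turns the right-hand side into the distance from that
conjugate to the real number t. -/
theorem abs_im_le_norm_one_sub {w : ℂ} (hw : ‖w‖ = 1) (t : ℝ) : |w.im| ≤ ‖1 - w * t‖ := by
  have h1 : ‖1 - w * t‖ = ‖starRingEnd ℂ w - t‖ := by
    have h2 : starRingEnd ℂ w * (1 - w * t) = starRingEnd ℂ w - t := by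
      have : starRingEnd ℂ w * w = 1 := by
        rw [mul_comm, Complex.mul_conj, Complex.normSq_eq_norm_sq, hw]; simp
      linear_combination (-(t : ℂ)) * this
    rw [← h2, norm_mul, RCLike.norm_conj, hw, one_mul]
  rw [h1]
  have := Complex.abs_im_le_norm (starRingEnd ℂ w - t)
  simpa using this

theorem one_sub_le_norm_one_sub {w : ℂ} (hw : ‖w‖ = 1) {t : ℝ} (ht : 0 ≤ t) :
    1 - t ≤ ‖1 - w * t‖ := by
  have := norm_sub_norm_le (1 : ℂ) (w * t)
  rwa [norm_one, norm_mul, hw, Complex.norm_real, Real.norm_eq_abs, abs_of_nonneg ht, one_mul] at this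

/-- Domination of the integrand of the Stieltjes transform on the unit circle by a product. -/
theorem IsSubexponential.exists_stieltjes_bound {J : ℝ → ℂ} (hJ : IsSubexponential J) {p : ℝ}
    (hp : 0 < p) : ∃ Φ : ℝ → ℝ, IntegrableOn Φ (Ioi 0) ∧ ∀ w : ℂ, ‖w‖ = 1 → w.im ≠ 0 →
      ∀ v : ℝ, 0 < v →
      ‖J v * (w * (Real.exp (-(p * v)) : ℂ) / (1 - w * (Real.exp (-(p * v)) : ℂ)))‖
        ≤ |w.im| ^ (-(1 / 4) : ℝ) * Φ v := by
  -- With t = exp(-pv), the quotient t / t^(3/4) leaves exp(-pv/4); growth exp(pv/8) of J still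
  -- leaves the decay exp(-pv/8) in Φ.
  obtain ⟨C, hC0, hC⟩ := hJ.exists_bound (η := p / 8) (by positivity)
  refine ⟨fun v => C * p ^ (-(3 / 4) : ℝ) * (v ^ (-(3 / 4) : ℝ) * Real.exp (-(p / 8) * v ^ (1 : ℝ))),
    ?_, ?_⟩
  · exact (integrableOn_rpow_mul_exp_neg_mul_rpow (by norm_num) (by norm_num)
      (by positivity)).const_mul _
  · intro w hw him v hv
    set t := Real.exp (-(p * v)) with ht
    have ht0 : 0 < t := Real.exp_pos _
    have him' : 0 < |w.im| := abs_pos.2 him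
    have h1 := abs_im_le_norm_one_sub hw t
    have h2 := one_sub_le_norm_one_sub hw ht0.le
    have hpv : 0 < p * v := mul_pos hp hv
    have h3 : p * v * t ≤ 1 - t := by
      have h4 := Real.add_one_le_exp (p * v)
      have h5 : Real.exp (p * v) * t = 1 := by rw [ht, ← Real.exp_add]; simp
      nlinarith
    have hN : 0 < ‖1 - w * (t : ℂ)‖ := lt_of_lt_of_le him' h1
    -- The two lower bounds |Im w| and 1 - t ≥ pvt are interpolated with weights 1/4 and 3/4. The
    -- exponent 3/4 < 1 keeps the power of v integrable at 0, and 1/4 < 1/2 makes the power of |Im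
    -- w| square-integrable on the circle.
    have h6 : ‖1 - w * (t : ℂ)‖⁻¹ ≤ |w.im| ^ (-(1 / 4) : ℝ) * (p * v * t) ^ (-(3 / 4) : ℝ) := by
      have e : ‖1 - w * (t : ℂ)‖⁻¹ =
          ‖1 - w * (t : ℂ)‖ ^ (-(1 / 4) : ℝ) * ‖1 - w * (t : ℂ)‖ ^ (-(3 / 4) : ℝ) := by
        rw [← Real.rpow_add hN, ← Real.rpow_neg_one]; norm_num
      rw [e]
      have hpt : 0 < p * v * t := by positivity
      exact mul_le_mul (Real.rpow_le_rpow_of_nonpos him' h1 (by norm_num))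
        (Real.rpow_le_rpow_of_nonpos hpt (h3.trans h2) (by norm_num)) (by positivity) (by positivity)
    have h7 : (p * v * t) ^ (-(3 / 4) : ℝ) =
        p ^ (-(3 / 4) : ℝ) * v ^ (-(3 / 4) : ℝ) * Real.exp (3 / 4 * (p * v)) := by
      rw [Real.mul_rpow hpv.le ht0.le, Real.mul_rpow hp.le hv.le, ht, ← Real.exp_mul]
      congr 2
      ring
    rw [norm_mul, norm_div, norm_mul, hw, one_mul, Complex.norm_real, Real.norm_eq_abs,
      abs_of_pos ht0, div_eq_mul_inv]
    calc _ ≤ C * Real.exp (p / 8 * v) * (t * (|w.im| ^ (-(1 / 4) : ℝ) *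
            (p ^ (-(3 / 4) : ℝ) * v ^ (-(3 / 4) : ℝ) * Real.exp (3 / 4 * (p * v))))) := by
          rw [h7] at h6
          gcongr
          exact hC v hv
      _ = |w.im| ^ (-(1 / 4) : ℝ) * (C * p ^ (-(3 / 4) : ℝ) * (v ^ (-(3 / 4) : ℝ) *
            (Real.exp (p / 8 * v) * t * Real.exp (3 / 4 * (p * v))))) := by ring
      _ = _ := by
          dsimp only
          rw [ht, ← Real.exp_add, ← Real.exp_add, Real.rpow_one]
          congr 4
          ring

theorem IsSubexponential.exists_norm_stieltjes_le {J : ℝ → ℂ} (hJ : IsSubexponential J) {p : ℝ}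
    (hp : 0 < p) : ∃ C : ℝ, ∀ w : ℂ, ‖w‖ = 1 → w.im ≠ 0 →
      ‖stieltjes p J w‖ ≤ C * |w.im| ^ (-(1 / 4) : ℝ) := by
  obtain ⟨Φ, hΦ, h⟩ := hJ.exists_stieltjes_bound hp
  refine ⟨∫ v in Ioi (0 : ℝ), Φ v, fun w hw him => ?_⟩
  rw [mul_comm, ← integral_const_mul]
  refine norm_integral_le_of_norm_le (hΦ.const_mul _) ?_
  filter_upwards [ae_restrict_mem measurableSet_Ioi] with v hv
  exact h w hw him v hv

/-! ### Fourier coefficients on the unit circle. -/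

theorem intervalIntegrable_abs_rpow {s : ℝ} (hs : -1 < s) (c : ℝ) :
    IntervalIntegrable (fun x : ℝ => |x| ^ s) volume (-c) c := by
  have hpos : ∀ c : ℝ, 0 ≤ c → IntervalIntegrable (fun x : ℝ => |x| ^ s) volume 0 c := by
    intro c hc
    refine (intervalIntegral.intervalIntegrable_rpow' hs (a := 0) (b := c)).congr ?_
    intro x hx
    rw [uIoc_of_le hc] at hx
    simp only [abs_of_pos hx.1]
  have hall : ∀ c : ℝ, IntervalIntegrable (fun x : ℝ => |x| ^ s) volume 0 c := by
    intro c
    rcases le_total 0 c with hc | hc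
    · exact hpos c hc
    · have := hpos (-c) (by linarith)
      rw [IntervalIntegrable.iff_comp_neg] at this
      simpa using this
  exact (hall (-c)).symm.trans (hall c)

/-- By π-periodicity only [-π/2, π/2] matters, where Jordan's inequality |sin x| ≥ 2|x|/π applies.
-/
theorem intervalIntegrable_abs_sin_rpow {s : ℝ} (hs : 0 ≤ s) (hs1 : s < 1) (a b : ℝ) :
    IntervalIntegrable (fun x : ℝ => |Real.sin x| ^ (-s)) volume a b := by
  have hper : Function.Periodic (fun x : ℝ => |Real.sin x| ^ (-s)) Real.pi := by
    intro x
    simp only [Real.sin_add_pi, abs_neg]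
  refine hper.intervalIntegrable Real.pi_ne_zero (t := -(Real.pi / 2)) ?_ a b
  have e : -(Real.pi / 2) + Real.pi = Real.pi / 2 := by ring
  rw [e]
  refine IntervalIntegrable.mono_fun
    ((intervalIntegrable_abs_rpow (s := -s) (by linarith) (Real.pi / 2)).const_mul
      ((2 / Real.pi) ^ (-s))) ?_ ?_
  · have : Measurable fun x : ℝ => |Real.sin x| ^ (-s) := by fun_prop
    exact this.aestronglyMeasurable
  · have h0 : ∀ᵐ x : ℝ, x ≠ 0 := by simp [ae_iff]
    filter_upwards [ae_restrict_mem measurableSet_uIoc, ae_restrict_of_ae h0] with x hx hx0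
    rw [uIoc_of_le (by linarith [Real.pi_pos])] at hx
    have hpi := Real.pi_pos
    have h1 := Real.mul_abs_le_abs_sin (x := x) (abs_le.2 ⟨hx.1.le, hx.2⟩)
    have hx' : 0 < |x| := abs_pos.2 hx0
    rw [Real.norm_of_nonneg (by positivity), Real.norm_of_nonneg (by positivity),
      ← Real.mul_rpow (by positivity) (abs_nonneg x)]
    exact Real.rpow_le_rpow_of_nonpos (by positivity) h1 (by linarith)

theorem intervalIntegrable_abs_sin_mul_rpow {s k : ℝ} (hs : 0 ≤ s) (hs1 : s < 1) (hk : k ≠ 0)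
    (a b : ℝ) : IntervalIntegrable (fun u : ℝ => |Real.sin (k * u)| ^ (-s)) volume a b := by
  have := (intervalIntegrable_abs_sin_rpow hs hs1 (k * a) (k * b)).comp_mul_left (c := k)
  simpa [mul_div_cancel_left₀ _ hk] using this

/-- `exp(-iπτ/β)`. -/
noncomputable def nome (β : ℝ) (τ : ℂ) : ℂ :=
  Complex.exp (-(Complex.I * ((Real.pi / β : ℝ) : ℂ) * τ))

theorem norm_nome (β : ℝ) (τ : ℂ) : ‖nome β τ‖ = Real.exp (Real.pi / β * τ.im) := by
  rw [nome, Complex.norm_exp]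
  congr 1
  simp

theorem norm_nome_ofReal (β u : ℝ) : ‖nome β (u : ℂ)‖ = 1 := by
  rw [norm_nome]; simp

theorem nome_ofReal_im (β u : ℝ) : (nome β (u : ℂ)).im = -Real.sin (Real.pi / β * u) := by
  have : nome β (u : ℂ) = Complex.exp (((-(Real.pi / β * u) : ℝ) : ℂ) * Complex.I) := by
    rw [nome]; congr 1; push_cast; ring
  rw [this, Complex.exp_ofReal_mul_I_im, Real.sin_neg]

theorem nome_ne_zero (β : ℝ) (τ : ℂ) : nome β τ ≠ 0 := Complex.exp_ne_zero _

theorem exp_matsubara (β : ℝ) (n : ℤ) (τ : ℂ) :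
    Complex.exp (-(Complex.I * (matsubara β n : ℂ) * τ)) = nome β τ ^ n := by
  rw [nome, ← Complex.exp_int_mul, matsubara]
  congr 1
  push_cast
  ring

theorem exp_matsubara' (β : ℝ) (n : ℤ) (τ : ℂ) :
    Complex.exp (Complex.I * (matsubara β n : ℂ) * τ) = nome β τ ^ (-n) := by
  rw [zpow_neg, ← exp_matsubara, ← Complex.exp_neg, neg_neg]

theorem continuous_nome (β : ℝ) : Continuous (nome β) := by
  unfold nome
  fun_prop

theorem integral_nome_zpow {β : ℝ} (hβ : 0 < β) (n : ℤ) :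
    ∫ u in (-β)..β, nome β (u : ℂ) ^ n = if n = 0 then 2 * (β : ℂ) else 0 := by
  split_ifs with h
  · subst h
    simp
    norm_cast
    ring
  · set c : ℂ := -(Complex.I * ((Real.pi / β : ℝ) : ℂ)) * n with hc
    have hβ' : (β : ℂ) ≠ 0 := by exact_mod_cast hβ.ne'
    have hc0 : c ≠ 0 := by
      have h1 : (Real.pi : ℂ) ≠ 0 := by exact_mod_cast Real.pi_ne_zero
      have h2 : (n : ℂ) ≠ 0 := by exact_mod_cast h
      rw [hc]
      push_cast
      simp [Complex.I_ne_zero, h1, hβ', h2]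
    have h1 : ∀ u : ℝ, nome β (u : ℂ) ^ n = Complex.exp (c * u) := by
      intro u
      rw [nome, ← Complex.exp_int_mul, hc]
      congr 1
      ring
    simp_rw [h1]
    rw [integral_exp_mul_complex hc0, div_eq_zero_iff, sub_eq_zero]
    left
    rw [Complex.exp_eq_exp_iff_exists_int]
    refine ⟨-n, ?_⟩
    rw [hc]
    push_cast
    field_simp
    ring

/-- In the geometric series only the term m + 1 = n survives by orthogonality; hence no index n ≤ 0
occurs. -/
theorem integral_geometric_nome {β : ℝ} (hβ : 0 < β) {q : ℂ} (hq : ‖q‖ < 1) (n : ℤ) :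
    ∫ u in (-β)..β, (q * nome β (u : ℂ) / (1 - q * nome β (u : ℂ))) *
        Complex.exp (Complex.I * (matsubara β n : ℂ) * (u : ℂ))
      = if 1 ≤ n then 2 * (β : ℂ) * q ^ n else 0 := by
  have hnc : ∀ k : ℤ, Continuous fun u : ℝ => nome β (u : ℂ) ^ k := fun k =>
    ((continuous_nome β).comp Complex.continuous_ofReal).zpow₀ k fun u => Or.inl (nome_ne_zero _ _)
  have key := intervalIntegral.hasSum_integral_of_dominated_convergence (μ := volume) (a := -β) (b := β)
    (F := fun (m : ℕ) (u : ℝ) => q ^ (m + 1) * nome β (u : ℂ) ^ ((m : ℤ) + 1 - n))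
    (f := fun u : ℝ => (q * nome β (u : ℂ) / (1 - q * nome β (u : ℂ))) *
        Complex.exp (Complex.I * (matsubara β n : ℂ) * (u : ℂ)))
    (fun m _ => ‖q‖ ^ (m + 1)) ?_ ?_ ?_ ?_ ?_
  · have hval : ∀ m : ℕ, (∫ u in (-β)..β, q ^ (m + 1) * nome β (u : ℂ) ^ ((m : ℤ) + 1 - n)) =
        if (m : ℤ) + 1 = n then 2 * (β : ℂ) * q ^ n else 0 := by
      intro m
      rw [intervalIntegral.integral_const_mul, integral_nome_zpow hβ]
      by_cases h : (m : ℤ) + 1 = n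
      · rw [if_pos (by omega), if_pos h, ← h, mul_comm]
        norm_cast
      · rw [if_neg (by omega), if_neg h, mul_zero]
    simp_rw [hval] at key
    refine key.unique ?_
    split_ifs with hn
    · obtain ⟨k, hk⟩ := Int.eq_ofNat_of_zero_le (show 0 ≤ n - 1 by omega)
      have e : ∀ m : ℕ, (m : ℤ) + 1 = n ↔ m = k := fun m => by omega
      simp_rw [e]
      exact hasSum_ite_eq k (2 * (β : ℂ) * q ^ n)
    · have e : ∀ m : ℕ, ¬ ((m : ℤ) + 1 = n) := fun m => by omega
      simp_rw [if_neg (e _)]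
      exact hasSum_zero
  · intro m
    exact (continuous_const.mul (hnc _)).aestronglyMeasurable
  · intro m
    refine Eventually.of_forall fun u _ => ?_
    rw [norm_mul, norm_zpow, norm_nome_ofReal, one_zpow, mul_one, norm_pow]
  · refine Eventually.of_forall fun u _ => ?_
    exact (summable_nat_add_iff 1).2 (summable_geometric_of_lt_one (norm_nonneg _) hq)
  · exact intervalIntegrable_const
  · refine Eventually.of_forall fun u _ => ?_
    have hq' : ‖q * nome β (u : ℂ)‖ < 1 := by rwa [norm_mul, norm_nome_ofReal, mul_one]
    have h1 := ((hasSum_geometric_of_norm_lt_one hq').mul_left (q * nome β (u : ℂ))).mul_right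
      (Complex.exp (Complex.I * (matsubara β n : ℂ) * (u : ℂ)))
    rw [← div_eq_mul_inv] at h1
    have e : ∀ m : ℕ, q ^ (m + 1) * nome β (u : ℂ) ^ ((m : ℤ) + 1 - n) =
        q * nome β (u : ℂ) * (q * nome β (u : ℂ)) ^ m *
          Complex.exp (Complex.I * (matsubara β n : ℂ) * (u : ℂ)) := ?_
    · simp_rw [e]
      exact h1
    intro m
    rw [exp_matsubara', ← pow_succ', mul_pow, mul_assoc, ← zpow_natCast (nome β u),
      ← zpow_add₀ (nome_ne_zero _ _)]
    congr 2

/-- The Fourier coefficients of the Stieltjes transform on the unit circle. -/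
theorem IsSubexponential.integral_stieltjes_nome {J : ℝ → ℂ} (hJ : IsSubexponential J) {β : ℝ}
    (hβ : 0 < β) {σ : ℝ} (hσ : |σ| = 1) (n : ℤ) :
    ∫ u in (-β)..β, stieltjes (Real.pi / β) J (σ * nome β (u : ℂ)) *
        Complex.exp (Complex.I * (matsubara β n : ℂ) * (u : ℂ))
      = if 1 ≤ n then 2 * (β : ℂ) * σ ^ n * laplacePlus J (matsubara β n : ℂ) else 0 := by
  set p := Real.pi / β with hp
  have hp0 : 0 < p := div_pos Real.pi_pos hβ
  obtain ⟨Φ, hΦ, hb⟩ := hJ.exists_stieltjes_bound hp0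
  have hw1 : ∀ u : ℝ, ‖(σ : ℂ) * nome β (u : ℂ)‖ = 1 := by
    intro u
    rw [norm_mul, norm_nome_ofReal, Complex.norm_real, Real.norm_eq_abs, hσ, one_mul]
  have hwim : ∀ u : ℝ, |((σ : ℂ) * nome β (u : ℂ)).im| = |Real.sin (p * u)| := by
    intro u
    rw [Complex.im_ofReal_mul, abs_mul, hσ, one_mul, nome_ofReal_im, abs_neg]
  have hsin := intervalIntegrable_abs_sin_mul_rpow (s := 1 / 4) (by norm_num) (by norm_num)
    hp0.ne' (-β) β
  rw [intervalIntegrable_iff] at hsin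
  have hsin0 : ∀ᵐ u : ℝ, Real.sin (p * u) ≠ 0 := by
    have hcount : {u : ℝ | Real.sin (p * u) = 0}.Countable := by
      refine (countable_range fun k : ℤ => (k : ℝ) * Real.pi / p).mono ?_
      intro u hu
      obtain ⟨k, hk⟩ := Real.sin_eq_zero_iff.1 hu
      refine ⟨k, ?_⟩
      simp only [hk]
      field_simp
    simpa [ae_iff] using hcount.measure_zero volume
  set f : ℝ → ℝ → ℂ := fun u v => (J v *
      ((σ * nome β (u : ℂ)) * (Real.exp (-(p * v)) : ℂ) /
        (1 - (σ * nome β (u : ℂ)) * (Real.exp (-(p * v)) : ℂ)))) *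
        Complex.exp (Complex.I * (matsubara β n : ℂ) * (u : ℂ)) with hf
  have hfm : Measurable (Function.uncurry f) := by
    have h1 : Measurable fun x : ℝ × ℝ => ((σ : ℂ) * nome β (x.1 : ℂ), x.2) :=
      (((continuous_nome β).comp (Complex.continuous_ofReal.comp continuous_fst)).measurable.const_mul
        _).prodMk measurable_snd
    have h2 := (measurable_stieltjes_integrand hJ.1 p).comp h1
    have h3 : Measurable fun x : ℝ × ℝ =>
      Complex.exp (Complex.I * (matsubara β n : ℂ) * (x.1 : ℂ)) := by fun_prop
    exact h2.mul h3
  -- The product bound |sin(pu)|^(-1/4) Φ(v) justifies Fubini although the kernel is singular at the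
  -- points of the circle where σw = 1 and v = 0. After the exchange the inner integral has |q| < 1.
  have hint : Integrable (Function.uncurry f)
      ((volume.restrict (uIoc (-β) β)).prod (volume.restrict (Ioi (0 : ℝ)))) := by
    refine Integrable.mono' (hsin.mul_prod hΦ) hfm.aestronglyMeasurable ?_
    rw [Measure.prod_restrict]
    have h1 : ∀ᵐ x : ℝ × ℝ ∂(volume.prod volume), Real.sin (p * x.1) ≠ 0 :=
      Measure.quasiMeasurePreserving_fst.ae hsin0
    filter_upwards [ae_restrict_mem (measurableSet_uIoc.prod measurableSet_Ioi),
      ae_restrict_of_ae h1] with x hx hx0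
    have h2 : ‖Complex.exp (Complex.I * (matsubara β n : ℂ) * (x.1 : ℂ))‖ = 1 := by
      rw [Complex.norm_exp]; simp
    rw [Function.uncurry, hf]
    dsimp only
    rw [norm_mul, h2, mul_one, ← hwim]
    exact hb _ (hw1 _) (by rw [← abs_pos, hwim]; exact abs_pos.2 hx0) _ hx.2
  have hswap := intervalIntegral_integral_swap hint
  have hleft : ∀ u : ℝ, ∫ v in Ioi (0 : ℝ), f u v = stieltjes p J (σ * nome β (u : ℂ)) *
      Complex.exp (Complex.I * (matsubara β n : ℂ) * (u : ℂ)) := by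
    intro u
    rw [stieltjes, ← integral_mul_const]
  simp_rw [hleft] at hswap
  rw [hswap]
  have hright : ∀ v ∈ Ioi (0 : ℝ), ∫ u in (-β)..β, f u v =
      if 1 ≤ n then 2 * (β : ℂ) * σ ^ n * (J v * Complex.exp (-((matsubara β n : ℂ) * (v : ℂ))))
        else 0 := by
    intro v hv
    have hq : ‖(σ : ℂ) * (Real.exp (-(p * v)) : ℂ)‖ < 1 := by
      rw [norm_mul, Complex.norm_real, Complex.norm_real, Real.norm_eq_abs, Real.norm_eq_abs, hσ,
        one_mul, Real.abs_exp, Real.exp_lt_one_iff]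
      have := mul_pos hp0 hv
      linarith
    have h1 := integral_geometric_nome hβ hq n
    have h2 : ∀ u : ℝ, f u v = J v * (((σ : ℂ) * (Real.exp (-(p * v)) : ℂ)) * nome β (u : ℂ) /
        (1 - ((σ : ℂ) * (Real.exp (-(p * v)) : ℂ)) * nome β (u : ℂ)) *
        Complex.exp (Complex.I * (matsubara β n : ℂ) * (u : ℂ))) := by
      intro u
      rw [hf]
      ring_nf
    simp_rw [h2]
    rw [intervalIntegral.integral_const_mul, h1]
    split_ifs
    · rw [mul_zpow, Complex.ofReal_exp, ← Complex.exp_int_mul]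
      have : (n : ℂ) * ((-(p * v) : ℝ) : ℂ) = -((matsubara β n : ℂ) * (v : ℂ)) := by
        rw [matsubara, hp]; push_cast; ring
      rw [this]
      ring
    · rw [mul_zero]
  rw [setIntegral_congr_fun measurableSet_Ioi hright]
  split_ifs
  · rw [integral_const_mul, laplacePlus]
  · simp

/-! ### Strips, boundary values of G and its jumps. -/

theorem mem_cutPlane_iff {β : ℝ} {τ : ℂ} : τ ∈ cutPlane β ↔ ∀ k : ℤ, τ.re ≠ k * β := by
  constructor
  · intro h k hk
    refine h ?_
    have e : τ = (k : ℂ) * (β : ℂ) + (τ.im : ℂ) * Complex.I := by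
      apply Complex.ext <;> simp [hk]
    rcases le_total 0 τ.im with hv | hv
    · exact Or.inl ⟨k, τ.im, hv, e⟩
    · exact Or.inr ⟨k, τ.im, hv, e⟩
  · rintro h (⟨k, v, -, rfl⟩ | ⟨k, v, -, rfl⟩)
    · exact h k (by simp)
    · exact h k (by simp)

theorem strip_eq (β : ℝ) (k : ℤ) :
    strip β k = Complex.re ⁻¹' Ioo (k * β) ((k + 1) * β) := rfl

theorem closedStrip_eq (β : ℝ) (k : ℤ) :
    closedStrip β k = Complex.re ⁻¹' Icc (k * β) ((k + 1) * β) := rfl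

theorem isOpen_strip (β : ℝ) (k : ℤ) : IsOpen (strip β k) :=
  isOpen_Ioo.preimage Complex.continuous_re

theorem strip_subset_closedStrip (β : ℝ) (k : ℤ) : strip β k ⊆ closedStrip β k :=
  preimage_mono Ioo_subset_Icc_self

theorem closedStrip_subset_closure {β : ℝ} (hβ : 0 < β) (k : ℤ) :
    closedStrip β k ⊆ closure (strip β k) := by
  rw [strip_eq, closedStrip_eq, Complex.closure_preimage_re, closure_Ioo]
  exact (by nlinarith : (k : ℝ) * β < (k + 1) * β).ne

theorem strip_subset_cutPlane {β : ℝ} (hβ : 0 < β) (k : ℤ) : strip β k ⊆ cutPlane β := by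
  rintro τ ⟨h1, h2⟩
  rw [mem_cutPlane_iff]
  intro m hm
  rw [hm] at h1 h2
  have h3 : (k : ℝ) < m := lt_of_mul_lt_mul_right h1 hβ.le
  have h4 : (m : ℝ) < k + 1 := lt_of_mul_lt_mul_right h2 hβ.le
  norm_cast at h3 h4
  omega

theorem exists_mem_strip {β : ℝ} (hβ : 0 < β) {τ : ℂ} (hτ : τ ∈ cutPlane β) :
    ∃ k : ℤ, τ ∈ strip β k := by
  refine ⟨⌊τ.re / β⌋, ?_, ?_⟩
  · refine lt_of_le_of_ne ?_ (Ne.symm (mem_cutPlane_iff.1 hτ _))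
    exact (le_div_iff₀ hβ).1 (Int.floor_le _)
  · exact (div_lt_iff₀ hβ).1 (Int.lt_floor_add_one _)

theorem exists_mem_closedStrip {β : ℝ} (k : ℤ) (hβ : 0 < β) (v : ℝ) :
    (k : ℂ) * (β : ℂ) + (v : ℂ) * Complex.I ∈ closedStrip β k ∧
    (k : ℂ) * (β : ℂ) + (v : ℂ) * Complex.I ∈ closedStrip β (k - 1) := by
  constructor
  · constructor <;> simp; nlinarith
  · constructor <;> simp; linarith

/-- The continuous extension of `G` from the `k`-th open strip to the closed one. -/
noncomputable def stripExt (β : ℝ) (G : ℂ → ℂ) (k : ℤ) : ℂ → ℂ := extendFrom (strip β k) G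

/-- `i {G(kβ + 0 + iv) - G(kβ - 0 + iv)}`. -/
noncomputable def thermalJump (β : ℝ) (G : ℂ → ℂ) (k : ℤ) (v : ℝ) : ℂ :=
  Complex.I * (stripExt β G k ((k : ℂ) * (β : ℂ) + (v : ℂ) * Complex.I)
    - stripExt β G (k - 1) ((k : ℂ) * (β : ℂ) + (v : ℂ) * Complex.I))

section
variable {β : ℝ} {s : Statistics} {G : ℂ → ℂ}

/-- Density of the strip in its closure makes `extendFrom` agree with any continuous extension, so
the boundary values become a function of G and k alone and can be compared between strips. -/
theorem IsThermalGreen.stripExt_eqOn (hβ : 0 < β) (hG : IsThermalGreen β s G) (k : ℤ) :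
    ContinuousOn (stripExt β G k) (closedStrip β k) ∧ EqOn (stripExt β G k) G (strip β k) := by
  obtain ⟨g, hgc, hge⟩ := hG.continuous_boundary k
  have h1 : EqOn (stripExt β G k) g (closedStrip β k) := by
    intro τ hτ
    refine extendFrom_eq (closedStrip_subset_closure hβ k hτ) ?_
    have h2 : Tendsto g (𝓝[strip β k] τ) (𝓝 (g τ)) :=
      (hgc τ hτ).mono_left (nhdsWithin_mono _ (strip_subset_closedStrip β k))
    exact h2.congr' (eventually_mem_nhdsWithin.mono fun x hx => hge hx)
  exact ⟨hgc.congr h1, fun τ hτ => (h1 (strip_subset_closedStrip β k hτ)).trans (hge hτ)⟩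

theorem IsThermalGreen.exists_norm_stripExt_le (hβ : 0 < β) (hG : IsThermalGreen β s G) {η : ℝ}
    (hη : 0 < η) : ∃ C : ℝ, 0 ≤ C ∧ ∀ (k : ℤ) (τ : ℂ), τ ∈ closedStrip β k →
      ‖stripExt β G k τ‖ ≤ C * Real.exp (η * |τ.im|) := by
  obtain ⟨C, α, hC⟩ := hG.slow_growth
  obtain ⟨K, hK0, hK⟩ : ∃ K : ℝ, 0 ≤ K ∧ ∀ x : ℝ, 0 ≤ x → (1 + x) ^ α ≤ K * Real.exp (η * x) := by
    -- The inequality log y ≤ y at y = (1 + x)η/a bounds |α| log(1 + x) by η(1 + x) plus a constant.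
    -- The added 1 keeps a positive when α = 0.
    set a := |α| + 1 with ha
    have ha0 : 0 < a := by positivity
    refine ⟨Real.exp (η + |α| * Real.log (a / η)), (Real.exp_pos _).le, fun x hx => ?_⟩
    have h1 : (1 + x) ^ α ≤ (1 + x) ^ |α| :=
      Real.rpow_le_rpow_of_exponent_le (by linarith) (le_abs_self α)
    refine h1.trans ?_
    rw [Real.rpow_def_of_pos (by linarith), ← Real.exp_add, Real.exp_le_exp]
    have h2 : Real.log (1 + x) = Real.log ((1 + x) * (η / a)) + Real.log (a / η) := by
      rw [← Real.log_mul (by positivity) (by positivity)]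
      congr 1
      field_simp
    have h3 : Real.log ((1 + x) * (η / a)) ≤ (1 + x) * (η / a) := by
      have := Real.log_le_sub_one_of_pos (show 0 < (1 + x) * (η / a) by positivity)
      linarith
    have h4 : (1 + x) * (η / a) * |α| ≤ (1 + x) * η := by
      have : (1 + x) * (η / a) * |α| = (1 + x) * η * (|α| / a) := by ring
      rw [this]
      have h5 : |α| / a ≤ 1 := by
        rw [div_le_one ha0, ha]; linarith
      exact mul_le_of_le_one_right (by positivity) h5
    rw [h2]
    nlinarith [mul_le_mul_of_nonneg_right h3 (abs_nonneg α)]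
  refine ⟨|C| * K, by positivity, fun k τ hτ => ?_⟩
  obtain ⟨hc, he⟩ := hG.stripExt_eqOn hβ k
  refine ContinuousWithinAt.closure_le (closedStrip_subset_closure hβ k hτ)
    (f := fun τ => ‖stripExt β G k τ‖) (g := fun τ => |C| * K * Real.exp (η * |τ.im|))
    ((hc τ hτ).mono (strip_subset_closedStrip β k)).norm ?_ ?_
  · refine Continuous.continuousWithinAt ?_
    have := Complex.continuous_im
    fun_prop
  · intro w hw
    rw [he hw]
    refine (hC w (strip_subset_cutPlane hβ k hw)).trans ?_
    calc C * (1 + |w.im|) ^ α ≤ |C| * (1 + |w.im|) ^ α := by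
          gcongr; exact le_abs_self C
      _ ≤ |C| * (K * Real.exp (η * |w.im|)) := by
          gcongr; exact hK _ (abs_nonneg _)
      _ = _ := by ring

theorem IsThermalGreen.stripExt_add (hβ : 0 < β) (hG : IsThermalGreen β s G) (k : ℤ) {τ : ℂ}
    (hτ : τ ∈ closedStrip β k) : stripExt β G (k + 1) (τ + β) = s.sign * stripExt β G k τ := by
  obtain ⟨hc, he⟩ := hG.stripExt_eqOn hβ k
  obtain ⟨hc', he'⟩ := hG.stripExt_eqOn hβ (k + 1)
  have h1 : EqOn (fun τ => stripExt β G (k + 1) (τ + β)) (fun τ => s.sign * stripExt β G k τ)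
      (strip β k) := by
    intro w hw
    have hw' : w + β ∈ strip β (k + 1) := by
      obtain ⟨h1, h2⟩ := hw
      constructor <;> push_cast <;> simp <;> nlinarith
    change stripExt β G (k + 1) (w + β) = s.sign * stripExt β G k w
    rw [he' hw', he hw, hG.periodic w (strip_subset_cutPlane hβ k hw)]
  refine h1.of_subset_closure ?_ (hc.const_mul _) (strip_subset_closedStrip β k)
    (closedStrip_subset_closure hβ k) hτ
  refine hc'.comp (by fun_prop) ?_
  intro w hw
  obtain ⟨h1, h2⟩ := hw
  constructor <;> push_cast <;> simp <;> nlinarith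

theorem Statistics.sign_mul_self (s : Statistics) : s.sign * s.sign = 1 := by
  cases s <;> simp [Statistics.sign]

/-- Two translations cost the square of the sign, which is 1; so both statistics have period 2β, and
only the cuts at 0 and β carry independent jumps. -/
theorem IsThermalGreen.stripExt_add_two (hβ : 0 < β) (hG : IsThermalGreen β s G) (k : ℤ) {τ : ℂ}
    (hτ : τ ∈ closedStrip β k) : stripExt β G (k + 2) (τ + 2 * β) = stripExt β G k τ := by
  have h1 := hG.stripExt_add hβ k hτ
  have hτ' : τ + β ∈ closedStrip β (k + 1) := by
    obtain ⟨h1, h2⟩ := hτ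
    constructor <;> push_cast <;> simp <;> nlinarith
  have h2 := hG.stripExt_add hβ (k + 1) hτ'
  rw [h1, ← mul_assoc, Statistics.sign_mul_self, one_mul] at h2
  rw [← h2]
  have e1 : k + 2 = k + 1 + 1 := by ring
  have e2 : τ + 2 * β = τ + β + β := by ring
  rw [e1, e2]

theorem IsThermalGreen.continuous_stripExt_line (hβ : 0 < β) (hG : IsThermalGreen β s G) (k : ℤ) :
    Continuous (fun v : ℝ => stripExt β G k ((k : ℂ) * (β : ℂ) + (v : ℂ) * Complex.I)) ∧
    Continuous (fun v : ℝ => stripExt β G (k - 1) ((k : ℂ) * (β : ℂ) + (v : ℂ) * Complex.I)) := by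
  constructor
  · exact (hG.stripExt_eqOn hβ k).1.comp_continuous (by fun_prop)
      fun v => (exists_mem_closedStrip k hβ v).1
  · exact (hG.stripExt_eqOn hβ (k - 1)).1.comp_continuous (by fun_prop)
      fun v => (exists_mem_closedStrip k hβ v).2

theorem IsThermalGreen.isSubexponential_stripExt (hβ : 0 < β) (hG : IsThermalGreen β s G) (k : ℤ) :
    IsSubexponential (fun v : ℝ => stripExt β G k ((k : ℂ) * (β : ℂ) + (v : ℂ) * Complex.I)) ∧
    IsSubexponential
      (fun v : ℝ => stripExt β G (k - 1) ((k : ℂ) * (β : ℂ) + (v : ℂ) * Complex.I)) := by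
  obtain ⟨h1, h2⟩ := hG.continuous_stripExt_line hβ k
  refine ⟨⟨h1, fun η hη => ?_⟩, ⟨h2, fun η hη => ?_⟩⟩
  · obtain ⟨C, -, hC⟩ := hG.exists_norm_stripExt_le hβ hη
    exact ⟨C, fun v => by simpa using hC _ _ (exists_mem_closedStrip k hβ v).1⟩
  · obtain ⟨C, -, hC⟩ := hG.exists_norm_stripExt_le hβ hη
    exact ⟨C, fun v => by simpa using hC _ _ (exists_mem_closedStrip k hβ v).2⟩

theorem IsThermalGreen.isSubexponential_thermalJump (hβ : 0 < β) (hG : IsThermalGreen β s G)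
    (k : ℤ) : IsSubexponential (thermalJump β G k) := by
  obtain ⟨h1, h2⟩ := hG.isSubexponential_stripExt hβ k
  refine ⟨continuous_const.mul (h1.1.sub h2.1), fun η hη => ?_⟩
  obtain ⟨C, hC⟩ := h1.2 η hη
  obtain ⟨C', hC'⟩ := h2.2 η hη
  refine ⟨C + C', fun v => ?_⟩
  rw [thermalJump, norm_mul, Complex.norm_I, one_mul, add_mul]
  exact (norm_sub_le _ _).trans (add_le_add (hC v) (hC' v))

theorem IsThermalGreen.thermalJump_add_two (hβ : 0 < β) (hG : IsThermalGreen β s G) (k : ℤ) :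
    thermalJump β G (k + 2) = thermalJump β G k := by
  ext v
  obtain ⟨h1, h2⟩ := exists_mem_closedStrip k hβ v
  have e : ((k + 2 : ℤ) : ℂ) * (β : ℂ) + (v : ℂ) * Complex.I =
      ((k : ℂ) * (β : ℂ) + (v : ℂ) * Complex.I) + 2 * β := by push_cast; ring
  have e2 : k + 2 - 1 = k - 1 + 2 := by ring
  rw [thermalJump, thermalJump, e, e2, hG.stripExt_add_two hβ k h1,
    hG.stripExt_add_two hβ (k - 1) h2]

theorem IsThermalGreen.tendsto_right (hβ : 0 < β) (hG : IsThermalGreen β s G) (k : ℤ) (v : ℝ) :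
    Tendsto (fun e : ℝ => G ((k : ℂ) * (β : ℂ) + (e : ℂ) + (v : ℂ) * Complex.I)) (𝓝[>] 0)
      (𝓝 (stripExt β G k ((k : ℂ) * (β : ℂ) + (v : ℂ) * Complex.I))) := by
  obtain ⟨hc, he⟩ := hG.stripExt_eqOn hβ k
  have hin : ∀ᶠ e : ℝ in 𝓝[>] 0,
      (k : ℂ) * (β : ℂ) + (e : ℂ) + (v : ℂ) * Complex.I ∈ strip β k := by
    filter_upwards [Ioo_mem_nhdsGT hβ] with e he
    obtain ⟨h1, h2⟩ := he
    constructor <;> simp <;> nlinarith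
  have h1 := hc _ (exists_mem_closedStrip k hβ v).1
  have h2 : Tendsto (fun e : ℝ => (k : ℂ) * (β : ℂ) + (e : ℂ) + (v : ℂ) * Complex.I) (𝓝[>] 0)
      (𝓝[closedStrip β k] ((k : ℂ) * (β : ℂ) + (v : ℂ) * Complex.I)) := by
    refine tendsto_nhdsWithin_iff.2 ⟨?_, hin.mono fun e h => strip_subset_closedStrip β k h⟩
    refine Tendsto.mono_left ?_ nhdsWithin_le_nhds
    have : Continuous fun e : ℝ => (k : ℂ) * (β : ℂ) + (e : ℂ) + (v : ℂ) * Complex.I := by fun_prop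
    simpa using this.tendsto 0
  exact (h1.tendsto.comp h2).congr' (hin.mono fun e h => he h)

theorem IsThermalGreen.tendsto_left (hβ : 0 < β) (hG : IsThermalGreen β s G) (k : ℤ) (v : ℝ) :
    Tendsto (fun e : ℝ => G ((k : ℂ) * (β : ℂ) - (e : ℂ) + (v : ℂ) * Complex.I)) (𝓝[>] 0)
      (𝓝 (stripExt β G (k - 1) ((k : ℂ) * (β : ℂ) + (v : ℂ) * Complex.I))) := by
  obtain ⟨hc, he⟩ := hG.stripExt_eqOn hβ (k - 1)
  have hin : ∀ᶠ e : ℝ in 𝓝[>] 0,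
      (k : ℂ) * (β : ℂ) - (e : ℂ) + (v : ℂ) * Complex.I ∈ strip β (k - 1) := by
    filter_upwards [Ioo_mem_nhdsGT hβ] with e he
    obtain ⟨h1, h2⟩ := he
    constructor <;> simp <;> nlinarith
  have h1 := hc _ (exists_mem_closedStrip k hβ v).2
  have h2 : Tendsto (fun e : ℝ => (k : ℂ) * (β : ℂ) - (e : ℂ) + (v : ℂ) * Complex.I) (𝓝[>] 0)
      (𝓝[closedStrip β (k - 1)] ((k : ℂ) * (β : ℂ) + (v : ℂ) * Complex.I)) := by
    refine tendsto_nhdsWithin_iff.2 ⟨?_, hin.mono fun e h => strip_subset_closedStrip β _ h⟩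
    refine Tendsto.mono_left ?_ nhdsWithin_le_nhds
    have : Continuous fun e : ℝ => (k : ℂ) * (β : ℂ) - (e : ℂ) + (v : ℂ) * Complex.I := by fun_prop
    simpa using this.tendsto 0
  exact (h1.tendsto.comp h2).congr' (hin.mono fun e h => he h)

/-! ### Contour shift: Fourier coefficients as Laplace transforms of jumps. -/

/-- Cauchy's theorem on a rectangle of height R standing on the segment. Since ζ > 0, the factor
exp(iζτ) decays upwards and beats the growth of G: the top side disappears as R → ∞ and the vertical
sides become Laplace integrals. -/
theorem IsThermalGreen.integral_strip (hβ : 0 < β) (hG : IsThermalGreen β s G) (k : ℤ) {ζ : ℝ}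
    (hζ : 0 < ζ) :
    IntervalIntegrable (fun u : ℝ => G (u : ℂ) * Complex.exp (Complex.I * (ζ : ℂ) * (u : ℂ)))
      volume (k * β) ((k + 1) * β) ∧
    ∫ u in (k * β)..((k + 1) * β), G (u : ℂ) * Complex.exp (Complex.I * (ζ : ℂ) * (u : ℂ)) =
      Complex.I * (Complex.exp (Complex.I * (ζ : ℂ) * ((k : ℂ) * β)) *
          laplacePlus (fun v => stripExt β G k ((k : ℂ) * (β : ℂ) + (v : ℂ) * Complex.I)) ζ
        - Complex.exp (Complex.I * (ζ : ℂ) * (((k + 1 : ℤ) : ℂ) * β)) *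
          laplacePlus (fun v =>
            stripExt β G k (((k + 1 : ℤ) : ℂ) * (β : ℂ) + (v : ℂ) * Complex.I)) ζ) := by
  obtain ⟨hc, he⟩ := hG.stripExt_eqOn hβ k
  have hlt : (k : ℝ) * β < (k + 1) * β := by nlinarith
  set E : ℂ → ℂ := fun z => stripExt β G k z * Complex.exp (Complex.I * (ζ : ℂ) * z) with hE
  have hEc : ContinuousOn E (closedStrip β k) := hc.mul (by fun_prop)
  have hEd : DifferentiableOn ℂ E (strip β k) := by
    refine DifferentiableOn.mul ((hG.analytic k).congr fun z hz => he hz) ?_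
    fun_prop
  have hcl : ∀ u ∈ Icc ((k : ℝ) * β) ((k + 1) * β), ∀ R : ℝ,
      (u : ℂ) + (R : ℂ) * Complex.I ∈ closedStrip β k := by
    intro u hu R
    constructor
    · simpa using hu.1
    · simpa using hu.2
  have hIoo : EqOn (fun u : ℝ => G (u : ℂ) * Complex.exp (Complex.I * (ζ : ℂ) * (u : ℂ)))
      (fun u : ℝ => E (u : ℂ)) (Ioo (k * β) ((k + 1) * β)) := by
    intro u hu
    have hus : (u : ℂ) ∈ strip β k := ⟨by simpa using hu.1, by simpa using hu.2⟩
    simp only [hE, he hus]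
  have hEi : IntervalIntegrable (fun u : ℝ => E (u : ℂ)) volume (k * β) ((k + 1) * β) := by
    refine ContinuousOn.intervalIntegrable ?_
    rw [uIcc_of_le hlt.le]
    refine hEc.comp (by fun_prop) fun u hu => ?_
    simpa using hcl u hu 0
  constructor
  · rw [intervalIntegrable_iff_integrableOn_Ioo_of_le hlt.le] at hEi ⊢
    exact hEi.congr_fun hIoo.symm measurableSet_Ioo
  have hI : ∫ u in (k * β)..((k + 1) * β), G (u : ℂ) * Complex.exp (Complex.I * (ζ : ℂ) * (u : ℂ)) =
      ∫ u in (k * β)..((k + 1) * β), E (u : ℂ) := by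
    rw [intervalIntegral.integral_of_le hlt.le, intervalIntegral.integral_of_le hlt.le,
      integral_Ioc_eq_integral_Ioo, integral_Ioc_eq_integral_Ioo]
    exact setIntegral_congr_fun measurableSet_Ioo hIoo
  rw [hI]
  have hrect : ∀ R : ℝ, 0 < R → (∫ u in (k * β)..((k + 1) * β), E (u : ℂ)) =
      (∫ u in (k * β)..((k + 1) * β), E ((u : ℂ) + (R : ℂ) * Complex.I)) +
      Complex.I * ((∫ v in (0 : ℝ)..R, E ((k : ℂ) * β + (v : ℂ) * Complex.I)) -
        ∫ v in (0 : ℝ)..R, E (((k + 1 : ℤ) : ℂ) * β + (v : ℂ) * Complex.I)) := by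
    intro R hR
    have h := Complex.integral_boundary_rect_eq_zero_of_continuousOn_of_differentiableOn E
      (((k * β : ℝ) : ℂ)) ((((k + 1) * β : ℝ) : ℂ) + (R : ℂ) * Complex.I) ?_ ?_
    · simp only [Complex.ofReal_re, Complex.ofReal_im, Complex.add_re, Complex.add_im,
        Complex.mul_re, Complex.mul_im, Complex.I_re, Complex.I_im, mul_zero, mul_one, sub_zero,
        zero_add, add_zero, smul_eq_mul, Complex.ofReal_zero, zero_mul] at h
      push_cast at h ⊢
      linear_combination h
    · refine hEc.mono ?_
      intro z hz
      have hz1 := mem_preimage.1 hz.1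
      simp only [Complex.ofReal_re, Complex.add_re, Complex.mul_re, Complex.I_re, mul_zero,
        Complex.I_im, Complex.ofReal_im, mul_one, sub_zero, add_zero] at hz1
      rw [uIcc_of_le hlt.le] at hz1
      exact hz1
    · refine hEd.mono ?_
      intro z hz
      have hz1 := mem_preimage.1 hz.1
      simp only [Complex.ofReal_re, Complex.add_re, Complex.mul_re, Complex.I_re, mul_zero,
        Complex.I_im, Complex.ofReal_im, mul_one, sub_zero, add_zero] at hz1
      rw [min_eq_left hlt.le, max_eq_right hlt.le] at hz1
      exact hz1
  have htop : Tendsto (fun R : ℝ => ∫ u in (k * β)..((k + 1) * β), E ((u : ℂ) + (R : ℂ) * Complex.I))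
      atTop (𝓝 0) := by
    obtain ⟨C, hC0, hC⟩ := hG.exists_norm_stripExt_le hβ (half_pos hζ)
    have hlim : Tendsto (fun R : ℝ => C * Real.exp (-(R * (ζ / 2))) * |(k + 1) * β - k * β|)
        atTop (𝓝 0) := by
      have := (Real.tendsto_exp_neg_atTop_nhds_zero.comp
        (tendsto_id.atTop_mul_const (half_pos hζ))).const_mul C
      simpa using this.mul_const (|(k + 1) * β - k * β|)
    refine squeeze_zero_norm' ?_ hlim
    filter_upwards [eventually_gt_atTop 0] with R hR
    refine intervalIntegral.norm_integral_le_of_norm_le_const fun u hu => ?_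
    rw [uIoc_of_le hlt.le] at hu
    have h1 := hC k _ (hcl u ⟨hu.1.le, hu.2⟩ R)
    have him : ((u : ℂ) + (R : ℂ) * Complex.I).im = R := by simp
    rw [him, abs_of_pos hR] at h1
    have h2 : ‖Complex.exp (Complex.I * (ζ : ℂ) * ((u : ℂ) + (R : ℂ) * Complex.I))‖ =
        Real.exp (-(ζ * R)) := by
      rw [Complex.norm_exp]; simp
    rw [hE, norm_mul, h2]
    calc _ ≤ C * Real.exp (ζ / 2 * R) * Real.exp (-(ζ * R)) := by gcongr
      _ = _ := by rw [mul_assoc, ← Real.exp_add]; congr 2; ring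
  have hline : ∀ m : ℤ, IsSubexponential
      (fun v : ℝ => stripExt β G k ((m : ℂ) * (β : ℂ) + (v : ℂ) * Complex.I)) →
      Tendsto (fun R : ℝ => ∫ v in (0 : ℝ)..R, E ((m : ℂ) * β + (v : ℂ) * Complex.I)) atTop
        (𝓝 (Complex.exp (Complex.I * (ζ : ℂ) * ((m : ℂ) * β)) * laplacePlus
          (fun v => stripExt β G k ((m : ℂ) * (β : ℂ) + (v : ℂ) * Complex.I)) ζ)) := by
    intro m hm
    have h1 : ∀ v : ℝ, E ((m : ℂ) * β + (v : ℂ) * Complex.I) =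
        Complex.exp (Complex.I * (ζ : ℂ) * ((m : ℂ) * β)) *
          (stripExt β G k ((m : ℂ) * (β : ℂ) + (v : ℂ) * Complex.I) *
            Complex.exp (-((ζ : ℂ) * (v : ℂ)))) := by
      intro v
      rw [mul_left_comm, ← Complex.exp_add]
      simp only [hE]
      congr 2
      linear_combination (ζ : ℂ) * v * Complex.I_mul_I
    simp_rw [h1, intervalIntegral.integral_const_mul]
    refine Tendsto.const_mul _ ?_
    exact intervalIntegral_tendsto_integral_Ioi 0
      (hm.integrableOn_laplace (ζ := (ζ : ℂ)) (by simpa using hζ)) tendsto_id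
  have hl := hline k (hG.isSubexponential_stripExt hβ k).1
  have hr := hline (k + 1) (by
    have := (hG.isSubexponential_stripExt hβ (k + 1)).2
    rwa [add_sub_cancel_right] at this)
  have hlim := htop.add ((hl.sub hr).const_mul Complex.I)
  rw [zero_add] at hlim
  refine tendsto_nhds_unique (tendsto_const_nhds.congr' ?_) hlim
  filter_upwards [eventually_gt_atTop 0] with R hR
  exact hrect R hR

theorem exp_matsubara_mul {β : ℝ} (hβ : 0 < β) (n k : ℤ) :
    Complex.exp (Complex.I * (matsubara β n : ℂ) * ((k : ℂ) * β)) = (-1) ^ (n * k) := by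
  have hβ' : (β : ℂ) ≠ 0 := by exact_mod_cast hβ.ne'
  have e : Complex.I * (matsubara β n : ℂ) * ((k : ℂ) * β) =
      ((n * k : ℤ) : ℂ) * (Real.pi * Complex.I) := by
    rw [matsubara]; push_cast; field_simp
  rw [e, Complex.exp_int_mul, Complex.exp_pi_mul_I]

theorem laplacePlus_sub {J K : ℝ → ℂ} (hJ : IsSubexponential J) (hK : IsSubexponential K) {ζ : ℂ}
    (hζ : 0 < ζ.re) : laplacePlus (fun v => J v - K v) ζ = laplacePlus J ζ - laplacePlus K ζ := by
  simp only [laplacePlus]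
  rw [← integral_sub (hJ.integrableOn_laplace hζ) (hK.integrableOn_laplace hζ)]
  simp only [sub_mul]

theorem laplacePlus_const_mul (c : ℂ) (J : ℝ → ℂ) (ζ : ℂ) :
    laplacePlus (fun v => c * J v) ζ = c * laplacePlus J ζ := by
  simp only [laplacePlus]
  rw [← integral_const_mul]
  simp only [mul_assoc]

/-- The Fourier coefficients of positive index are interpolated by the Laplace transforms of the
jumps. -/
theorem IsThermalGreen.greenCoeff_eq (hβ : 0 < β) (hG : IsThermalGreen β s G) {n : ℤ}
    (hn : 1 ≤ n) : greenCoeff β G n = laplacePlus (thermalJump β G 0) (matsubara β n) +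
      (-1) ^ n * laplacePlus (thermalJump β G 1) (matsubara β n) := by
  have hζ : 0 < matsubara β n := by
    have : (0 : ℝ) < n := by exact_mod_cast hn
    exact div_pos (mul_pos this Real.pi_pos) hβ
  have hζ' : 0 < ((matsubara β n : ℝ) : ℂ).re := by simpa using hζ
  obtain ⟨hi0, h0⟩ := hG.integral_strip hβ 0 hζ
  obtain ⟨hi1, h1⟩ := hG.integral_strip hβ (-1) hζ
  have hend : ∀ k : ℤ, thermalJump β G k = fun v : ℝ => Complex.I *
      (stripExt β G k ((k : ℂ) * (β : ℂ) + (v : ℂ) * Complex.I)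
        - stripExt β G (k - 1) ((k : ℂ) * (β : ℂ) + (v : ℂ) * Complex.I)) := fun k => rfl
  have hJ : ∀ k : ℤ, laplacePlus (thermalJump β G k) (matsubara β n) = Complex.I *
      (laplacePlus (fun v => stripExt β G k ((k : ℂ) * (β : ℂ) + (v : ℂ) * Complex.I)) (matsubara β n)
      - laplacePlus (fun v => stripExt β G (k - 1) ((k : ℂ) * (β : ℂ) + (v : ℂ) * Complex.I))
          (matsubara β n)) := by
    intro k
    obtain ⟨hs1, hs2⟩ := hG.isSubexponential_stripExt hβ k
    rw [hend, laplacePlus_const_mul, laplacePlus_sub hs1 hs2 hζ']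
  -- The boundary value of the strip -1 on its left side, at -β, is that of the strip 1 at β.
  -- Together with the right side of the strip 0 it forms the jump at β.
  have hper : (fun v : ℝ => stripExt β G 1 (((1 : ℤ) : ℂ) * (β : ℂ) + (v : ℂ) * Complex.I)) =
      fun v : ℝ => stripExt β G (-1) (((-1 : ℤ) : ℂ) * (β : ℂ) + (v : ℂ) * Complex.I) := by
    ext v
    rw [← hG.stripExt_add_two hβ (-1) (exists_mem_closedStrip (-1) hβ v).1]
    congr 1
    push_cast
    ring
  rw [hJ 0, hJ 1, hper]
  have e1 : ((-1 : ℤ) : ℝ) * β = -β := by simp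
  have e2 : (((-1 : ℤ) : ℝ) + 1) * β = 0 := by simp
  have e3 : ((0 : ℤ) : ℝ) * β = 0 := by simp
  have e4 : (((0 : ℤ) : ℝ) + 1) * β = β := by simp
  rw [e1, e2] at hi1 h1
  rw [e3, e4] at hi0 h0
  rw [greenCoeff, ← intervalIntegral.integral_add_adjacent_intervals hi1 hi0, h0, h1]
  rw [exp_matsubara_mul hβ, exp_matsubara_mul hβ, exp_matsubara_mul hβ, exp_matsubara_mul hβ]
  have p1 : (-1 : ℂ) ^ (n * -1) = (-1) ^ n := by
    rw [mul_neg_one, zpow_neg, ← inv_zpow]; norm_num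
  have p2 : (0 : ℤ) + 1 = 1 := rfl
  have p3 : (-1 : ℤ) + 1 = 0 := rfl
  have p4 : (0 : ℤ) - 1 = -1 := rfl
  have p5 : (1 : ℤ) - 1 = 0 := rfl
  rw [p1, p2, p3, p4, p5, mul_zero, mul_one, zpow_zero]
  ring

end

/-! ### The plus part of the Fourier series. -/

/-- Squaring treats the cuts with even and odd k together. Taking logarithms gives τ = kβ + iv with
v = -(β/π) log t, which is nonnegative because t ≤ 1. -/
theorem mem_cutUp_of_nome_sq {β : ℝ} (hβ : 0 < β) {τ : ℂ} {t : ℝ} (ht : t ∈ Icc (0 : ℝ) 1)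
    (h : (nome β τ * t) ^ 2 = 1) : τ ∈ cutUp β := by
  have ht0 : 0 < t := by
    refine lt_of_le_of_ne ht.1 ?_
    rintro rfl
    simp at h
  have hlog : Real.log t ≤ 0 := Real.log_nonpos ht.1 ht.2
  have hβ' : (β : ℂ) ≠ 0 := by exact_mod_cast hβ.ne'
  have hπ : (Real.pi : ℂ) ≠ 0 := by exact_mod_cast Real.pi_ne_zero
  have e : (t : ℂ) = Complex.exp (Real.log t : ℂ) := by
    rw [← Complex.ofReal_exp, Real.exp_log ht0]
  rw [e, nome, ← Complex.exp_add, ← Complex.exp_nat_mul, Complex.exp_eq_one_iff] at h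
  obtain ⟨m, hm⟩ := h
  refine ⟨-m, -(β / Real.pi * Real.log t), ?_, ?_⟩
  · have : 0 ≤ β / Real.pi := by have := Real.pi_pos; positivity
    nlinarith
  · push_cast at hm ⊢
    field_simp at hm ⊢
    linear_combination Complex.I * hm + (τ * Real.pi + m * β * Real.pi) * Complex.I_mul_I

theorem one_sub_nome_ne_zero {β : ℝ} (hβ : 0 < β) {τ : ℂ} (hτ : τ ∉ cutUp β) {σ : ℝ}
    (hσ : |σ| = 1) (t : ℝ) (ht : t ∈ Icc (0 : ℝ) 1) : 1 - (σ * nome β τ) * t ≠ 0 := by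
  intro h
  refine hτ (mem_cutUp_of_nome_sq hβ ht ?_)
  have h1 : (σ : ℂ) ^ 2 = 1 := by
    rw [← Complex.ofReal_pow, ← sq_abs, hσ]; simp
  have h2 : (σ : ℂ) * nome β τ * t = 1 := (sub_eq_zero.1 h).symm
  calc (nome β τ * t) ^ 2 = (σ : ℂ) ^ 2 * (nome β τ * t) ^ 2 := by rw [h1, one_mul]
    _ = (σ * nome β τ * t) ^ 2 := by ring
    _ = 1 := by rw [h2, one_pow]

theorem differentiableAt_nome (β : ℝ) (τ : ℂ) : DifferentiableAt ℂ (nome β) τ := by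
  unfold nome
  fun_prop

theorem IsSubexponential.differentiableAt_stieltjes_nome {J : ℝ → ℂ} (hJ : IsSubexponential J)
    {β : ℝ} (hβ : 0 < β) {σ : ℝ} (hσ : |σ| = 1) {τ : ℂ} (hτ : τ ∉ cutUp β) :
    DifferentiableAt ℂ (fun τ => stieltjes (Real.pi / β) J (σ * nome β τ)) τ :=
  DifferentiableAt.comp (g := stieltjes (Real.pi / β) J) (f := fun τ => (σ : ℂ) * nome β τ) τ
    (hJ.differentiableAt_stieltjes (div_pos Real.pi_pos hβ) (one_sub_nome_ne_zero hβ hτ hσ))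
    ((differentiableAt_nome β τ).const_mul _)

/-- The points of the real axis which lie in the cut plane. -/
theorem ae_mem_cutPlane (β : ℝ) : ∀ᵐ u : ℝ, (u : ℂ) ∈ cutPlane β := by
  have hcount : {u : ℝ | (u : ℂ) ∉ cutPlane β}.Countable := by
    refine (countable_range fun k : ℤ => (k : ℝ) * β).mono ?_
    intro u hu
    have hu' : ¬ ((u : ℂ) ∈ cutPlane β) := hu
    rw [mem_cutPlane_iff] at hu'
    push Not at hu'
    obtain ⟨k, hk⟩ := hu'
    exact ⟨k, by simpa using hk.symm⟩
  exact hcount.measure_zero volume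

theorem isOpen_cutPlane {β : ℝ} (hβ : 0 < β) : IsOpen (cutPlane β) := by
  rw [isOpen_iff_mem_nhds]
  intro τ hτ
  obtain ⟨k, hk⟩ := exists_mem_strip hβ hτ
  exact mem_of_superset ((isOpen_strip β k).mem_nhds hk) (strip_subset_cutPlane hβ k)

theorem aestronglyMeasurable_of_continuousAt {β : ℝ} (hβ : 0 < β) {F : ℂ → ℂ}
    (hF : ∀ τ ∈ cutPlane β, ContinuousAt F τ) :
    AEStronglyMeasurable (fun u : ℝ => F (u : ℂ)) volume := by
  have hS : MeasurableSet {u : ℝ | (u : ℂ) ∈ cutPlane β} :=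
    ((isOpen_cutPlane hβ).preimage Complex.continuous_ofReal).measurableSet
  have hr : volume.restrict {u : ℝ | (u : ℂ) ∈ cutPlane β} = volume :=
    Measure.restrict_eq_self_of_ae_mem (ae_mem_cutPlane β)
  rw [← hr]
  refine ContinuousOn.aestronglyMeasurable ?_ hS
  intro u hu
  exact ((hF _ hu).comp Complex.continuous_ofReal.continuousAt).continuousWithinAt

theorem notMem_cutUp_of_mem_cutPlane {β : ℝ} {τ : ℂ} (hτ : τ ∈ cutPlane β) : τ ∉ cutUp β :=
  fun h => hτ (Or.inl h)

/-- The square of the bound |sin|^(-1/4) is |sin|^(-1/2), still integrable. -/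
theorem IsSubexponential.memLp_stieltjes_nome {J : ℝ → ℂ} (hJ : IsSubexponential J)
    {β : ℝ} (hβ : 0 < β) {σ : ℝ} (hσ : |σ| = 1) :
    MemLp (fun u : ℝ => stieltjes (Real.pi / β) J (σ * nome β (u : ℂ))) 2
      (volume.restrict (Ioc (-β) β)) := by
  have hp : 0 < Real.pi / β := div_pos Real.pi_pos hβ
  have hm : AEStronglyMeasurable (fun u : ℝ => stieltjes (Real.pi / β) J (σ * nome β (u : ℂ)))
      volume :=
    aestronglyMeasurable_of_continuousAt hβ
      (F := fun τ => stieltjes (Real.pi / β) J (σ * nome β τ)) fun τ hτ =>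
      (hJ.differentiableAt_stieltjes_nome hβ hσ (notMem_cutUp_of_mem_cutPlane hτ)).continuousAt
  rw [memLp_two_iff_integrable_sq_norm hm.restrict]
  obtain ⟨C, hC⟩ := hJ.exists_norm_stieltjes_le hp
  have hsin := (intervalIntegrable_abs_sin_mul_rpow (s := 1 / 2) (by norm_num) (by norm_num)
    hp.ne' (-β) β).const_mul (C ^ 2)
  rw [intervalIntegrable_iff, uIoc_of_le (by linarith)] at hsin
  refine Integrable.mono' hsin (hm.restrict.norm.pow 2) ?_
  filter_upwards [ae_restrict_of_ae (ae_mem_cutPlane β)] with u hu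
  have him : |((σ : ℂ) * nome β (u : ℂ)).im| = |Real.sin (Real.pi / β * u)| := by
    rw [Complex.im_ofReal_mul, abs_mul, hσ, one_mul, nome_ofReal_im, abs_neg]
  have hn : ‖(σ : ℂ) * nome β (u : ℂ)‖ = 1 := by
    rw [norm_mul, norm_nome_ofReal, Complex.norm_real, Real.norm_eq_abs, hσ, one_mul]
  have hsin0 : Real.sin (Real.pi / β * u) ≠ 0 := by
    intro h0
    obtain ⟨k, hk⟩ := Real.sin_eq_zero_iff.1 h0
    refine mem_cutPlane_iff.1 hu k ?_
    rw [Complex.ofReal_re]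
    have := Real.pi_ne_zero
    field_simp at hk
    linarith
  have h1 := hC _ hn (by rw [← abs_pos, him]; exact abs_pos.2 hsin0)
  rw [him] at h1
  rw [Real.norm_of_nonneg (by positivity)]
  calc _ ≤ (C * |Real.sin (Real.pi / β * u)| ^ (-(1 / 4) : ℝ)) ^ 2 := by gcongr
    _ = _ := by
      rw [mul_pow, ← Real.rpow_natCast (|Real.sin (Real.pi / β * u)| ^ (-(1 / 4) : ℝ)),
        ← Real.rpow_mul (abs_nonneg _)]
      norm_num

/-- The part of the Fourier series of `G` with non-negative indices, as a Cauchy integral over the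
cuts. -/
noncomputable def greenPlus (β : ℝ) (G : ℂ → ℂ) (τ : ℂ) : ℂ :=
  1 / (2 * (β : ℂ)) * greenCoeff β G 0 + 1 / (2 * (β : ℂ)) *
    (stieltjes (Real.pi / β) (thermalJump β G 0) ((1 : ℝ) * nome β τ) +
      stieltjes (Real.pi / β) (thermalJump β G 1) ((-1 : ℝ) * nome β τ))

section
variable {β : ℝ} {s : Statistics} {G : ℂ → ℂ}

theorem IsThermalGreen.differentiableAt_greenPlus (hβ : 0 < β) (hG : IsThermalGreen β s G) {τ : ℂ}
    (hτ : τ ∉ cutUp β) : DifferentiableAt ℂ (greenPlus β G) τ := by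
  refine (differentiableAt_const _).add (DifferentiableAt.const_mul (DifferentiableAt.add ?_ ?_) _)
  · exact (hG.isSubexponential_thermalJump hβ 0).differentiableAt_stieltjes_nome hβ (by simp) hτ
  · exact (hG.isSubexponential_thermalJump hβ 1).differentiableAt_stieltjes_nome hβ (by simp) hτ

/-- For Im τ < 0 both arguments ±`nome β τ` lie in the unit disc, and the powers of -1 from the
second one are the signs in `IsThermalGreen.greenCoeff_eq`. The term of index 0 is the separate
constant, hence the shift by one. -/
theorem IsThermalGreen.hasSum_greenPlus (hβ : 0 < β) (hG : IsThermalGreen β s G) {τ : ℂ}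
    (hτ : τ.im < 0) : HasSum (fun n : ℕ => greenTerm β G (n : ℤ) τ) (greenPlus β G τ) := by
  have hp : 0 < Real.pi / β := div_pos Real.pi_pos hβ
  have hw : ∀ σ : ℝ, |σ| = 1 → ‖(σ : ℂ) * nome β τ‖ < 1 := by
    intro σ hσ
    rw [norm_mul, norm_nome, Complex.norm_real, Real.norm_eq_abs, hσ, one_mul, Real.exp_lt_one_iff]
    exact mul_neg_of_pos_of_neg hp hτ
  have h0 := (hG.isSubexponential_thermalJump hβ 0).hasSum_stieltjes hp (hw 1 (by simp))
  have h1 := (hG.isSubexponential_thermalJump hβ 1).hasSum_stieltjes hp (hw (-1) (by simp))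
  have h2 := (h0.add h1).mul_left (1 / (2 * (β : ℂ)))
  rw [← hasSum_nat_add_iff' 1]
  have e0 : greenPlus β G τ - ∑ i ∈ Finset.range 1, greenTerm β G ((i : ℕ) : ℤ) τ =
      1 / (2 * (β : ℂ)) * (stieltjes (Real.pi / β) (thermalJump β G 0) ((1 : ℝ) * nome β τ) +
        stieltjes (Real.pi / β) (thermalJump β G 1) ((-1 : ℝ) * nome β τ)) := by
    rw [Finset.sum_range_one, greenTerm, greenPlus, exp_matsubara]
    simp
  rw [e0]
  have e1 : ∀ n : ℕ, greenTerm β G ((n + 1 : ℕ) : ℤ) τ = 1 / (2 * (β : ℂ)) *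
      ((((1 : ℝ) : ℂ) * nome β τ) ^ (n + 1) *
          laplacePlus (thermalJump β G 0) ((Real.pi / β * (n + 1) : ℝ) : ℂ) +
        (((-1 : ℝ) : ℂ) * nome β τ) ^ (n + 1) *
          laplacePlus (thermalJump β G 1) ((Real.pi / β * (n + 1) : ℝ) : ℂ)) := by
    intro n
    rw [greenTerm, exp_matsubara, hG.greenCoeff_eq hβ (by push_cast; omega)]
    have e2 : matsubara β ((n + 1 : ℕ) : ℤ) = Real.pi / β * (n + 1) := by
      rw [matsubara]; push_cast; ring
    rw [e2, zpow_natCast, zpow_natCast, mul_pow, mul_pow]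
    simp only [Complex.ofReal_one, Complex.ofReal_neg, one_pow]
    ring
  simp_rw [e1]
  exact h2

theorem IsThermalGreen.memLp_greenPlus (hβ : 0 < β) (hG : IsThermalGreen β s G) :
    MemLp (fun u : ℝ => greenPlus β G (u : ℂ)) 2 (volume.restrict (Ioc (-β) β)) := by
  have h0 := (hG.isSubexponential_thermalJump hβ 0).memLp_stieltjes_nome hβ (σ := 1) (by simp)
  have h1 := (hG.isSubexponential_thermalJump hβ 1).memLp_stieltjes_nome hβ (σ := -1) (by simp)
  have h2 := (memLp_const (p := 2) (μ := volume.restrict (Ioc (-β) β))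
    (1 / (2 * (β : ℂ)) * greenCoeff β G 0)).add ((h0.add h1).const_mul (1 / (2 * (β : ℂ))))
  refine h2.ae_eq (Eventually.of_forall fun u => ?_)
  simp only [greenPlus, Pi.add_apply]

theorem MemLp.intervalIntegrable_mul_exp {f : ℝ → ℂ} (hβ : 0 < β)
    (hf : MemLp f 2 (volume.restrict (Ioc (-β) β))) (n : ℤ) :
    IntervalIntegrable (fun u : ℝ => f u *
      Complex.exp (Complex.I * (matsubara β n : ℂ) * (u : ℂ))) volume (-β) β := by
  have h1 : IntervalIntegrable f volume (-β) β := by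
    rw [intervalIntegrable_iff, uIoc_of_le (by linarith)]
    exact hf.integrable (by norm_num)
  exact h1.mul_continuousOn (by fun_prop)

/-- The coefficients come from `IsSubexponential.integral_stieltjes_nome` on the real axis itself,
so no limit from Im τ < 0 has to be taken. -/
theorem IsThermalGreen.greenCoeff_greenPlus (hβ : 0 < β) (hG : IsThermalGreen β s G) (n : ℤ) :
    greenCoeff β (greenPlus β G) n = if 0 ≤ n then greenCoeff β G n else 0 := by
  have hβ' : (β : ℂ) ≠ 0 := by exact_mod_cast hβ.ne'
  have hJ0 := hG.isSubexponential_thermalJump hβ 0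
  have hJ1 := hG.isSubexponential_thermalJump hβ 1
  have i0 := MemLp.intervalIntegrable_mul_exp hβ
    (hJ0.memLp_stieltjes_nome hβ (σ := 1) (by simp)) n
  have i1 := MemLp.intervalIntegrable_mul_exp hβ
    (hJ1.memLp_stieltjes_nome hβ (σ := -1) (by simp)) n
  have c0 := hJ0.integral_stieltjes_nome hβ (σ := 1) (by simp) n
  have c1 := hJ1.integral_stieltjes_nome hβ (σ := -1) (by simp) n
  have cc : ∫ u in (-β)..β, Complex.exp (Complex.I * (matsubara β n : ℂ) * (u : ℂ)) =
      if n = 0 then 2 * (β : ℂ) else 0 := by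
    simp_rw [exp_matsubara']
    rw [integral_nome_zpow hβ]
    simp
  have ic : IntervalIntegrable (fun u : ℝ => 1 / (2 * (β : ℂ)) * greenCoeff β G 0 *
      Complex.exp (Complex.I * (matsubara β n : ℂ) * (u : ℂ))) volume (-β) β :=
    Continuous.intervalIntegrable (by fun_prop) _ _
  have hsplit : greenCoeff β (greenPlus β G) n =
      1 / (2 * (β : ℂ)) * greenCoeff β G 0 *
        (∫ u in (-β)..β, Complex.exp (Complex.I * (matsubara β n : ℂ) * (u : ℂ))) +
      1 / (2 * (β : ℂ)) *
        ((∫ u in (-β)..β, stieltjes (Real.pi / β) (thermalJump β G 0) ((1 : ℝ) * nome β (u : ℂ)) *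
          Complex.exp (Complex.I * (matsubara β n : ℂ) * (u : ℂ))) +
        ∫ u in (-β)..β, stieltjes (Real.pi / β) (thermalJump β G 1) ((-1 : ℝ) * nome β (u : ℂ)) *
          Complex.exp (Complex.I * (matsubara β n : ℂ) * (u : ℂ))) := by
    rw [← intervalIntegral.integral_add i0 i1, ← intervalIntegral.integral_const_mul,
      ← intervalIntegral.integral_const_mul,
      ← intervalIntegral.integral_add ic ((i0.add i1).const_mul _)]
    rw [greenCoeff]
    refine intervalIntegral.integral_congr fun u _ => ?_
    simp only [greenPlus]
    ring
  rw [hsplit, cc, c0, c1]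
  rcases lt_trichotomy n 0 with h | h | h
  · rw [if_neg h.ne, if_neg (by omega), if_neg (by omega), if_neg (by omega)]
    ring
  · subst h
    simp
    field_simp
  · rw [if_neg h.ne', if_pos (by omega), if_pos (by omega), if_pos (by omega),
      hG.greenCoeff_eq hβ (n := n) (by omega)]
    simp only [Complex.ofReal_one, Complex.ofReal_neg, one_zpow]
    field_simp
    ring

theorem nome_add_two (hβ : 0 < β) (τ : ℂ) : nome β (τ + 2 * β) = nome β τ := by
  have hβ' : (β : ℂ) ≠ 0 := by exact_mod_cast hβ.ne'
  rw [nome, nome, Complex.exp_eq_exp_iff_exists_int]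
  refine ⟨-1, ?_⟩
  push_cast
  field_simp
  ring

theorem greenPlus_add_two (hβ : 0 < β) (τ : ℂ) :
    greenPlus β G (τ + 2 * β) = greenPlus β G τ := by
  simp only [greenPlus, nome_add_two hβ]

/-- A function on `[-β, β]` all of whose Fourier coefficients vanish. -/
theorem ae_eq_zero_of_greenCoeff {D : ℂ → ℂ} (hβ : 0 < β)
    (hD : MemLp (fun u : ℝ => D (u : ℂ)) 2 (volume.restrict (Ioc (-β) β)))
    (h0 : ∀ n : ℤ, greenCoeff β D n = 0) :
    (fun u : ℝ => D (u : ℂ)) =ᵐ[volume.restrict (Ioc (-β) β)] 0 := by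
  have hab : -β < β := by linarith
  have h1 := hasSum_sq_fourierCoeffOn hab hD
  have hβ' : (β : ℂ) ≠ 0 := by exact_mod_cast hβ.ne'
  have h2 : ∀ n : ℤ, fourierCoeffOn hab (fun u : ℝ => D (u : ℂ)) n = 0 := by
    intro n
    rw [fourierCoeffOn_eq_integral]
    have h3 : (∫ x in (-β)..β, fourier (-n) (x : AddCircle (β - -β)) • D (x : ℂ)) =
        greenCoeff β D (-n) := by
      rw [greenCoeff]
      refine intervalIntegral.integral_congr fun u _ => ?_
      simp only [fourier_coe_apply, smul_eq_mul]
      rw [mul_comm]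
      congr 2
      rw [matsubara]
      push_cast
      field_simp
      ring
    rw [h3, h0, smul_zero]
  simp_rw [h2, norm_zero, zero_pow two_ne_zero] at h1
  have h4 := h1.unique hasSum_zero
  rw [smul_eq_mul, mul_eq_zero] at h4
  have h5 : ∫ x in (-β)..β, ‖D (x : ℂ)‖ ^ 2 = 0 := by
    refine h4.resolve_left (inv_ne_zero ?_)
    linarith
  rw [intervalIntegral.integral_of_le hab.le, integral_eq_zero_iff_of_nonneg
    (fun u => by positivity) ((memLp_two_iff_integrable_sq_norm hD.1).1 hD)] at h5
  filter_upwards [h5] with u hu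
  simpa using hu

end

/-! ### Reflection, the minus part, and the sum of the two parts. -/

theorem neg_mem_cutPlane {β : ℝ} {τ : ℂ} (hτ : τ ∈ cutPlane β) : -τ ∈ cutPlane β := by
  rw [mem_cutPlane_iff] at hτ ⊢
  intro k hk
  refine hτ (-k) ?_
  push_cast
  rw [Complex.neg_re] at hk
  linarith

theorem neg_mem_cutUp {β : ℝ} {τ : ℂ} (hτ : -τ ∈ cutUp β) : τ ∈ cutDown β := by
  obtain ⟨k, v, hv, h⟩ := hτ
  refine ⟨-k, -v, by linarith, ?_⟩
  push_cast
  linear_combination -h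

theorem neg_mem_strip {β : ℝ} {k : ℤ} {τ : ℂ} (hτ : τ ∈ strip β k) : -τ ∈ strip β (-k - 1) := by
  obtain ⟨h1, h2⟩ := hτ
  constructor <;> push_cast <;> rw [Complex.neg_re] <;> linarith

theorem neg_mem_closedStrip {β : ℝ} {k : ℤ} {τ : ℂ} (hτ : τ ∈ closedStrip β k) :
    -τ ∈ closedStrip β (-k - 1) := by
  obtain ⟨h1, h2⟩ := hτ
  constructor <;> push_cast <;> rw [Complex.neg_re] <;> linarith

section
variable {β : ℝ} {s : Statistics} {G : ℂ → ℂ}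

/-- The reflection exchanges the strips k and -k - 1, upward and downward cuts, and the indices n
and -n. Periodicity survives because the sign is its own inverse. The minus half of the theorem thus
reduces to the plus half. -/
theorem IsThermalGreen.comp_neg (hβ : 0 < β) (hG : IsThermalGreen β s G) :
    IsThermalGreen β s (fun τ => G (-τ)) where
  analytic k := (hG.analytic (-k - 1)).comp differentiable_neg.differentiableOn
    fun _ hτ => neg_mem_strip hτ
  continuous_boundary k := by
    obtain ⟨g, hgc, hge⟩ := hG.continuous_boundary (-k - 1)
    exact ⟨fun τ => g (-τ), hgc.comp continuous_neg.continuousOn fun _ hτ => neg_mem_closedStrip hτ,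
      fun τ hτ => hge (neg_mem_strip hτ)⟩
  periodic τ hτ := by
    have h1 : -(τ + β) ∈ cutPlane β := by
      obtain ⟨k, hk⟩ := exists_mem_strip hβ hτ
      refine neg_mem_cutPlane (strip_subset_cutPlane hβ (k + 1) ?_)
      obtain ⟨h1, h2⟩ := hk
      constructor <;> push_cast <;> simp <;> linarith
    have h2 := hG.periodic _ h1
    have e : -(τ + β) + β = -τ := by ring
    rw [e] at h2
    change G (-(τ + β)) = s.sign * G (-τ)
    rw [h2, ← mul_assoc, Statistics.sign_mul_self, one_mul]
  slow_growth := by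
    obtain ⟨C, α, hC⟩ := hG.slow_growth
    exact ⟨C, α, fun τ hτ => by simpa using hC _ (neg_mem_cutPlane hτ)⟩

theorem greenCoeff_comp_neg (n : ℤ) :
    greenCoeff β (fun τ => G (-τ)) n = greenCoeff β G (-n) := by
  have h := intervalIntegral.integral_comp_neg (a := -β) (b := β)
    (fun u : ℝ => G (u : ℂ) * Complex.exp (Complex.I * (matsubara β (-n) : ℂ) * (u : ℂ)))
  rw [neg_neg] at h
  rw [greenCoeff, greenCoeff, ← h]
  refine intervalIntegral.integral_congr fun u _ => ?_
  simp only [matsubara]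
  push_cast
  congr 2
  ring

/-- Reflection exchanges the two sides of a cut, whence the minus sign; it is the one by which
`gapMinus` differs from `gapPlus`. -/
theorem IsThermalGreen.thermalJump_comp_neg (hβ : 0 < β) (hG : IsThermalGreen β s G) (k : ℤ)
    (v : ℝ) : thermalJump β (fun τ => G (-τ)) k v = -thermalJump β G (-k) (-v) := by
  have key : ∀ (k : ℤ) (τ : ℂ), τ ∈ closedStrip β k →
      stripExt β (fun τ => G (-τ)) k τ = stripExt β G (-k - 1) (-τ) := by
    intro k τ hτ
    obtain ⟨hc, he⟩ := (hG.comp_neg hβ).stripExt_eqOn hβ k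
    obtain ⟨hc', he'⟩ := hG.stripExt_eqOn hβ (-k - 1)
    have h1 : EqOn (stripExt β (fun τ => G (-τ)) k) (fun τ => stripExt β G (-k - 1) (-τ))
        (strip β k) := fun w hw => (he hw).trans (he' (neg_mem_strip hw)).symm
    exact h1.of_subset_closure hc
      (hc'.comp continuous_neg.continuousOn fun _ hτ => neg_mem_closedStrip hτ)
      (strip_subset_closedStrip β k) (closedStrip_subset_closure hβ k) hτ
  obtain ⟨h1, h2⟩ := exists_mem_closedStrip k hβ v
  rw [thermalJump, thermalJump, key _ _ h1, key _ _ h2]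
  have e1 : -((k : ℂ) * (β : ℂ) + (v : ℂ) * Complex.I) =
      ((-k : ℤ) : ℂ) * (β : ℂ) + ((-v : ℝ) : ℂ) * Complex.I := by push_cast; ring
  have e2 : -(k - 1) - 1 = -k := by ring
  rw [e1, e2]
  ring

/-- The part of the Fourier series of `G` with negative indices. -/
noncomputable def greenMinus (β : ℝ) (G : ℂ → ℂ) (τ : ℂ) : ℂ :=
  greenPlus β (fun τ => G (-τ)) (-τ) - 1 / (2 * (β : ℂ)) * greenCoeff β G 0

theorem IsThermalGreen.differentiableAt_greenMinus (hβ : 0 < β) (hG : IsThermalGreen β s G) {τ : ℂ}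
    (hτ : τ ∉ cutDown β) : DifferentiableAt ℂ (greenMinus β G) τ := by
  refine DifferentiableAt.sub_const ?_ _
  refine DifferentiableAt.comp (g := greenPlus β fun τ => G (-τ)) (f := fun τ => -τ) τ ?_
    differentiableAt_id.neg
  exact (hG.comp_neg hβ).differentiableAt_greenPlus hβ fun h => hτ (neg_mem_cutUp h)

/-- Index 0 belongs to the plus part: the constant subtracted in `greenMinus` is the zeroth term of
the reflected series. -/
theorem IsThermalGreen.hasSum_greenMinus (hβ : 0 < β) (hG : IsThermalGreen β s G) {τ : ℂ}
    (hτ : 0 < τ.im) :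
    HasSum (fun n : ℕ => greenTerm β G (-((n : ℤ) + 1)) τ) (greenMinus β G τ) := by
  have h1 := (hG.comp_neg hβ).hasSum_greenPlus hβ (τ := -τ) (by simpa using hτ)
  rw [← hasSum_nat_add_iff' 1] at h1
  have e0 : greenPlus β (fun τ => G (-τ)) (-τ) -
      ∑ i ∈ Finset.range 1, greenTerm β (fun τ => G (-τ)) ((i : ℕ) : ℤ) (-τ) = greenMinus β G τ := by
    rw [Finset.sum_range_one, greenTerm, greenMinus, greenCoeff_comp_neg]
    simp [matsubara]
  rw [e0] at h1
  have e1 : ∀ n : ℕ, greenTerm β (fun τ => G (-τ)) ((n + 1 : ℕ) : ℤ) (-τ) =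
      greenTerm β G (-((n : ℤ) + 1)) τ := by
    intro n
    rw [greenTerm, greenTerm, greenCoeff_comp_neg]
    simp only [matsubara]
    push_cast
    congr 2
    ring
  simp_rw [e1] at h1
  exact h1

theorem memLp_comp_neg_Ioc {f : ℝ → ℂ} (hf : MemLp f 2 (volume.restrict (Ioc (-β) β))) :
    MemLp (fun u => f (-u)) 2 (volume.restrict (Ioc (-β) β)) := by
  rw [← Measure.restrict_congr_set Ioo_ae_eq_Ioc] at hf ⊢
  have h := (Measure.measurePreserving_neg (volume : Measure ℝ)).restrict_preimage
    (s := Ioo (-β) β) measurableSet_Ioo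
  have e : (Neg.neg : ℝ → ℝ) ⁻¹' Ioo (-β) β = Ioo (-β) β := by
    ext x; simp only [mem_preimage, mem_Ioo]; constructor <;> rintro ⟨h1, h2⟩ <;> constructor <;> linarith
  rw [e] at h
  exact hf.comp_measurePreserving h

theorem IsThermalGreen.memLp_greenMinus (hβ : 0 < β) (hG : IsThermalGreen β s G) :
    MemLp (fun u : ℝ => greenMinus β G (u : ℂ)) 2 (volume.restrict (Ioc (-β) β)) := by
  have h1 := (memLp_comp_neg_Ioc ((hG.comp_neg hβ).memLp_greenPlus hβ)).sub
    (memLp_const (p := 2) (μ := volume.restrict (Ioc (-β) β))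
      (1 / (2 * (β : ℂ)) * greenCoeff β G 0))
  refine h1.ae_eq (Eventually.of_forall fun u => ?_)
  simp only [greenMinus, Pi.sub_apply, Complex.ofReal_neg]

theorem greenCoeff_sub {F H : ℂ → ℂ} (hβ : 0 < β)
    (hF : MemLp (fun u : ℝ => F (u : ℂ)) 2 (volume.restrict (Ioc (-β) β)))
    (hH : MemLp (fun u : ℝ => H (u : ℂ)) 2 (volume.restrict (Ioc (-β) β))) (n : ℤ) :
    greenCoeff β (fun τ => F τ - H τ) n = greenCoeff β F n - greenCoeff β H n := by
  simp only [greenCoeff]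
  rw [← intervalIntegral.integral_sub (MemLp.intervalIntegrable_mul_exp hβ hF n)
    (MemLp.intervalIntegrable_mul_exp hβ hH n)]
  simp only [sub_mul]

theorem greenCoeff_const (hβ : 0 < β) (c : ℂ) (n : ℤ) :
    greenCoeff β (fun _ => c) n = if n = 0 then 2 * (β : ℂ) * c else 0 := by
  rw [greenCoeff, intervalIntegral.integral_const_mul]
  simp_rw [exp_matsubara']
  rw [integral_nome_zpow hβ]
  simp only [neg_eq_zero]
  split_ifs <;> ring

theorem IsThermalGreen.greenCoeff_greenMinus (hβ : 0 < β) (hG : IsThermalGreen β s G) (n : ℤ) :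
    greenCoeff β (greenMinus β G) n = if n < 0 then greenCoeff β G n else 0 := by
  have hβ' : (β : ℂ) ≠ 0 := by exact_mod_cast hβ.ne'
  have hG' := hG.comp_neg hβ
  have h1 : greenCoeff β (greenMinus β G) n =
      greenCoeff β (fun τ => greenPlus β (fun τ => G (-τ)) (-τ)) n -
        greenCoeff β (fun _ => 1 / (2 * (β : ℂ)) * greenCoeff β G 0) n := by
    refine greenCoeff_sub hβ (F := fun τ => greenPlus β (fun τ => G (-τ)) (-τ)) ?_ (memLp_const _) n
    simpa only [Complex.ofReal_neg] using memLp_comp_neg_Ioc (hG'.memLp_greenPlus hβ)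
  rw [h1, greenCoeff_comp_neg, hG'.greenCoeff_greenPlus hβ, greenCoeff_const hβ,
    greenCoeff_comp_neg, neg_neg]
  rcases lt_trichotomy n 0 with h | h | h
  · rw [if_pos (by omega), if_neg (by omega), if_pos h, sub_zero]
  · subst h
    simp
    field_simp
    ring
  · rw [if_neg (by omega), if_neg (by omega), if_neg (by omega), sub_zero]

theorem IsThermalGreen.differentiableAt (hβ : 0 < β) (hG : IsThermalGreen β s G) {τ : ℂ}
    (hτ : τ ∈ cutPlane β) : DifferentiableAt ℂ G τ := by
  obtain ⟨k, hk⟩ := exists_mem_strip hβ hτ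
  exact (hG.analytic k).differentiableAt ((isOpen_strip β k).mem_nhds hk)

theorem IsThermalGreen.memLp (hβ : 0 < β) (hG : IsThermalGreen β s G) :
    MemLp (fun u : ℝ => G (u : ℂ)) 2 (volume.restrict (Ioc (-β) β)) := by
  obtain ⟨C, α, hC⟩ := hG.slow_growth
  refine MemLp.of_bound (aestronglyMeasurable_of_continuousAt hβ
    fun τ hτ => (hG.differentiableAt hβ hτ).continuousAt).restrict C ?_
  filter_upwards [ae_restrict_of_ae (ae_mem_cutPlane β)] with u hu
  simpa using hC _ hu

/-- The two series converge in opposite half-planes, so they meet only on the real axis, as L²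
functions. There the defect D has zero Fourier coefficients, hence vanishes almost everywhere, then
by continuity on open segments, and by the identity theorem on the strips above them. -/
theorem IsThermalGreen.greenPlus_add_greenMinus (hβ : 0 < β) (hG : IsThermalGreen β s G) {τ : ℂ}
    (hτ : τ ∈ cutPlane β) : G τ = greenPlus β G τ + greenMinus β G τ := by
  set D : ℂ → ℂ := fun τ => G τ - greenPlus β G τ - greenMinus β G τ with hD
  have hGp := hG.memLp_greenPlus hβ
  have hGm := hG.memLp_greenMinus hβ
  have hGl := hG.memLp hβ
  have hDl : MemLp (fun u : ℝ => D (u : ℂ)) 2 (volume.restrict (Ioc (-β) β)) :=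
    (hGl.sub hGp).sub hGm
  have hD0 : ∀ n : ℤ, greenCoeff β D n = 0 := by
    intro n
    have h1 : greenCoeff β D n = greenCoeff β G n - greenCoeff β (greenPlus β G) n -
        greenCoeff β (greenMinus β G) n := by
      rw [← greenCoeff_sub hβ hGl hGp]
      exact greenCoeff_sub hβ (F := fun τ => G τ - greenPlus β G τ) (hGl.sub hGp) hGm n
    rw [h1, hG.greenCoeff_greenPlus hβ, hG.greenCoeff_greenMinus hβ]
    rcases lt_or_ge n 0 with h | h
    · rw [if_neg (by omega), if_pos h]; ring
    · rw [if_pos h, if_neg (by omega)]; ring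
  have hae := ae_eq_zero_of_greenCoeff hβ hDl hD0
  have hDd : ∀ τ ∈ cutPlane β, DifferentiableAt ℂ D τ := fun τ hτ =>
    ((hG.differentiableAt hβ hτ).sub
      (hG.differentiableAt_greenPlus hβ fun h => hτ (Or.inl h))).sub
      (hG.differentiableAt_greenMinus hβ fun h => hτ (Or.inr h))
  have hstrip : ∀ k : ℤ, Ioo ((k : ℝ) * β) ((k + 1) * β) ⊆ Ioc (-β) β → EqOn D 0 (strip β k) := by
    intro k hk
    have hreal : EqOn (fun u : ℝ => D (u : ℂ)) 0 (Ioo ((k : ℝ) * β) ((k + 1) * β)) := by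
      refine Measure.eqOn_open_of_ae_eq (ae_restrict_of_ae_restrict_of_subset hk hae) isOpen_Ioo ?_
        continuousOn_const
      intro u hu
      have hu' : (u : ℂ) ∈ cutPlane β :=
        strip_subset_cutPlane hβ k ⟨by simpa using hu.1, by simpa using hu.2⟩
      exact ((hDd _ hu').continuousAt.comp
        Complex.continuous_ofReal.continuousAt).continuousWithinAt
    have hana : AnalyticOnNhd ℂ D (strip β k) := by
      refine DifferentiableOn.analyticOnNhd (fun τ hτ => ?_) (isOpen_strip β k)
      exact (hDd τ (strip_subset_cutPlane hβ k hτ)).differentiableWithinAt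
    have hconv : Convex ℝ (strip β k) :=
      (convex_Ioo ((k : ℝ) * β) ((k + 1) * β)).linear_preimage Complex.reLm
    set x₀ : ℝ := (k + 1 / 2) * β with hx₀
    have hx₀m : (x₀ : ℂ) ∈ strip β k := by
      constructor <;> rw [Complex.ofReal_re, hx₀] <;> nlinarith
    refine hana.eqOn_zero_of_preconnected_of_frequently_eq_zero hconv.isPreconnected hx₀m ?_
    have ht : Tendsto (fun t : ℝ => ((x₀ + t : ℝ) : ℂ)) (𝓝[>] 0) (𝓝[≠] (x₀ : ℂ)) := by
      refine tendsto_nhdsWithin_iff.2 ⟨?_, ?_⟩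
      · refine Tendsto.mono_left ?_ nhdsWithin_le_nhds
        have : Continuous fun t : ℝ => ((x₀ + t : ℝ) : ℂ) := by fun_prop
        simpa using this.tendsto 0
      · filter_upwards [self_mem_nhdsWithin] with t ht
        have ht' : 0 < t := ht
        simp only [mem_compl_iff, mem_singleton_iff, Complex.ofReal_inj]
        linarith
    refine ht.frequently (Eventually.frequently ?_)
    filter_upwards [Ioo_mem_nhdsGT (show (0 : ℝ) < β / 2 by positivity)] with t ht
    refine hreal (x := x₀ + t) ?_
    constructor <;> rw [hx₀] <;> nlinarith [ht.1, ht.2]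
  -- The interval (-β, β] gives only the strips -1 and 0; the others follow by 2β-periodicity,
  -- according to the parity of k.
  have hper : ∀ τ ∈ cutPlane β, ∀ m : ℤ, D (τ + m * (2 * β)) = D τ := by
    have hstep : ∀ τ ∈ cutPlane β, τ + 2 * β ∈ cutPlane β ∧ D (τ + 2 * β) = D τ := by
      intro τ hτ
      have hmem : ∀ τ ∈ cutPlane β, τ + β ∈ cutPlane β := by
        intro τ hτ
        rw [mem_cutPlane_iff] at hτ ⊢
        intro k hk
        refine hτ (k - 1) ?_
        push_cast
        rw [Complex.add_re, Complex.ofReal_re] at hk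
        linarith
      have e : τ + 2 * β = τ + β + β := by ring
      refine ⟨by rw [e]; exact hmem _ (hmem _ hτ), ?_⟩
      have hGper : G (τ + 2 * β) = G τ := by
        rw [e, hG.periodic _ (hmem _ hτ), hG.periodic _ hτ, ← mul_assoc,
          Statistics.sign_mul_self, one_mul]
      have hmper : greenMinus β G (τ + 2 * β) = greenMinus β G τ := by
        rw [greenMinus, greenMinus, ← greenPlus_add_two hβ (-(τ + 2 * β))]
        congr 2
        ring
      simp only [hD, hGper, hmper, greenPlus_add_two hβ]
    have hnat : ∀ n : ℕ, ∀ τ ∈ cutPlane β,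
        τ + n * (2 * β) ∈ cutPlane β ∧ D (τ + n * (2 * β)) = D τ := by
      intro n
      induction n with
      | zero => intro τ hτ; simpa using hτ
      | succ n ih =>
        intro τ hτ
        obtain ⟨h1, h2⟩ := hstep _ (ih τ hτ).1
        have e : τ + ((n + 1 : ℕ) : ℂ) * (2 * β) = τ + n * (2 * β) + 2 * β := by push_cast; ring
        rw [e]
        exact ⟨h1, h2.trans (ih τ hτ).2⟩
    intro τ hτ m
    obtain ⟨n, rfl | rfl⟩ := m.eq_nat_or_neg
    · exact_mod_cast (hnat n τ hτ).2
    · have hτ' : τ + ((-(n : ℤ) : ℤ) : ℂ) * (2 * β) ∈ cutPlane β := by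
        rw [mem_cutPlane_iff] at hτ ⊢
        intro k hk
        refine hτ (k + 2 * n) ?_
        push_cast
        simp at hk
        linarith
      have := (hnat n _ hτ').2
      rw [← this]
      congr 1
      push_cast
      ring
  obtain ⟨k, hk⟩ := exists_mem_strip hβ hτ
  have hDτ : D τ = 0 := by
    rcases Int.emod_two_eq_zero_or_one k with h | h
    · have hs := hstrip 0 (by
        intro u hu
        obtain ⟨h1, h2⟩ := hu
        simp at h1 h2
        constructor <;> linarith)
      rw [← hper τ hτ (-(k / 2))]
      refine hs ?_
      have hk2 : (k : ℝ) = 2 * ((k / 2 : ℤ) : ℝ) := by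
        have : k = 2 * (k / 2) := by omega
        exact_mod_cast this
      obtain ⟨h1, h2⟩ := hk
      rw [hk2] at h1 h2
      constructor <;> simp <;> nlinarith
    · have hs := hstrip (-1) (by
        intro u hu
        obtain ⟨h1, h2⟩ := hu
        simp at h1 h2
        constructor <;> linarith)
      rw [← hper τ hτ (-(k / 2 + 1))]
      refine hs ?_
      have hk2 : (k : ℝ) = 2 * ((k / 2 : ℤ) : ℝ) + 1 := by
        have : k = 2 * (k / 2) + 1 := by omega
        exact_mod_cast this
      obtain ⟨h1, h2⟩ := hk
      rw [hk2] at h1 h2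
      constructor <;> simp <;> nlinarith
  have : G τ - greenPlus β G τ - greenMinus β G τ = 0 := hDτ
  linear_combination this

theorem IsThermalGreen.isSplitting (hβ : 0 < β) (hG : IsThermalGreen β s G) :
    IsSplitting β G (greenPlus β G) (greenMinus β G) where
  series_plus _ hτ := hG.hasSum_greenPlus hβ hτ
  series_minus _ hτ := hG.hasSum_greenMinus hβ hτ
  memLp_plus := by
    rw [← Measure.restrict_congr_set Ioc_ae_eq_Icc]
    exact hG.memLp_greenPlus hβ
  memLp_minus := by
    rw [← Measure.restrict_congr_set Ioc_ae_eq_Icc]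
    exact hG.memLp_greenMinus hβ
  coeff_plus := hG.greenCoeff_greenPlus hβ
  coeff_minus := hG.greenCoeff_greenMinus hβ
  add _ hτ := hG.greenPlus_add_greenMinus hβ hτ

end

/-! ### Reflected function classes and the interpolation theorem. -/

theorem IsSubexponential.sub_const_mul {J K : ℝ → ℂ} (hJ : IsSubexponential J)
    (hK : IsSubexponential K) (c : ℂ) : IsSubexponential fun v => J v - c * K v := by
  refine ⟨hJ.1.sub (continuous_const.mul hK.1), fun η hη => ?_⟩
  obtain ⟨C, hC⟩ := hJ.2 η hη
  obtain ⟨D, hD⟩ := hK.2 η hη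
  refine ⟨C + ‖c‖ * D, fun v => (norm_sub_le _ _).trans ?_⟩
  rw [norm_mul, add_mul, mul_assoc]
  gcongr
  · exact hC v
  · exact hD v

theorem IsHardyRight.congr {δ : ℝ} {F H : ℂ → ℂ} (hF : IsHardyRight δ F)
    (h : EqOn H F (rightHalfPlane δ)) : IsHardyRight δ H := by
  obtain ⟨hd, M, hM⟩ := hF
  refine ⟨hd.congr h, M, fun ξ hξ => ?_⟩
  have : ∀ η : ℝ, H ((ξ : ℂ) + (η : ℂ) * Complex.I) = F ((ξ : ℂ) + (η : ℂ) * Complex.I) :=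
    fun η => h (by simpa [rightHalfPlane] using hξ)
  simpa only [this] using hM ξ hξ

theorem neg_mem_rightHalfPlane_iff {δ : ℝ} {ζ : ℂ} : -ζ ∈ rightHalfPlane δ ↔ ζ ∈ leftHalfPlane δ := by
  change δ < (-ζ).re ↔ ζ.re < -δ
  rw [Complex.neg_re]
  constructor <;> intro h <;> linarith

theorem neg_mem_leftHalfPlane_iff {δ : ℝ} {ζ : ℂ} : -ζ ∈ leftHalfPlane δ ↔ ζ ∈ rightHalfPlane δ := by
  rw [← neg_mem_rightHalfPlane_iff, neg_neg]

theorem IsHardyRight.comp_neg {δ : ℝ} {F : ℂ → ℂ} (hF : IsHardyRight δ F) :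
    IsHardyLeft δ fun ζ => F (-ζ) := by
  obtain ⟨hd, M, hM⟩ := hF
  refine ⟨hd.comp differentiable_neg.differentiableOn fun _ h => neg_mem_rightHalfPlane_iff.2 h, M,
    fun ξ hξ => ?_⟩
  refine le_trans (le_of_eq ?_) (hM (-ξ) (by linarith))
  rw [← lintegral_neg_eq_self]
  refine lintegral_congr fun η => ?_
  congr 3
  push_cast
  ring_nf

theorem IsHardyLeft.comp_neg {δ : ℝ} {F : ℂ → ℂ} (hF : IsHardyLeft δ F) :
    IsHardyRight δ fun ζ => F (-ζ) := by
  obtain ⟨hd, M, hM⟩ := hF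
  refine ⟨hd.comp differentiable_neg.differentiableOn fun _ h => neg_mem_leftHalfPlane_iff.2 h, M,
    fun ξ hξ => ?_⟩
  refine le_trans (le_of_eq ?_) (hM (-ξ) (by linarith))
  rw [← lintegral_neg_eq_self]
  refine lintegral_congr fun η => ?_
  congr 3
  push_cast
  ring_nf

theorem IsCarlsonRight.comp_neg {b δ : ℝ} {F : ℂ → ℂ} (hF : IsCarlsonRight b δ F) :
    IsCarlsonLeft b δ fun ζ => F (-ζ) := by
  obtain ⟨hd, ⟨C, A, hC⟩, D, c, hcb, hD⟩ := hF
  refine ⟨hd.comp differentiable_neg.diffContOnCl fun _ h => neg_mem_rightHalfPlane_iff.2 h,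
    ⟨C, A, fun ζ hζ => ?_⟩, D, c, hcb, fun η => ?_⟩
  · simpa using hC (-ζ) (by rw [Complex.neg_re]; linarith)
  · have := hD (-η)
    rw [abs_neg] at this
    convert this using 3
    push_cast
    ring

theorem IsCarlsonLeft.comp_neg {b δ : ℝ} {F : ℂ → ℂ} (hF : IsCarlsonLeft b δ F) :
    IsCarlsonRight b δ fun ζ => F (-ζ) := by
  obtain ⟨hd, ⟨C, A, hC⟩, D, c, hcb, hD⟩ := hF
  refine ⟨hd.comp differentiable_neg.diffContOnCl fun _ h => neg_mem_leftHalfPlane_iff.2 h,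
    ⟨C, A, fun ζ hζ => ?_⟩, D, c, hcb, fun η => ?_⟩
  · simpa using hC (-ζ) (by rw [Complex.neg_re]; linarith)
  · have := hD (-η)
    rw [abs_neg] at this
    convert this using 3
    push_cast
    ring

theorem matsubara_neg (β : ℝ) (n : ℤ) : matsubara β (-n) = -matsubara β n := by
  simp only [matsubara]
  push_cast
  ring

section
variable {β : ℝ} {s : Statistics} {G : ℂ → ℂ}

theorem IsUniqueInterpolantRight.comp_neg {S T : Set ℤ} {F : ℂ → ℂ}
    (hF : IsUniqueInterpolantRight β (fun τ => G (-τ)) S F) (hT : ∀ n, n ∈ T ↔ -n ∈ S) :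
    IsUniqueInterpolantLeft β G T fun ζ => F (-ζ) where
  interpolates n hn := by
    have := hF.interpolates (-n) ((hT n).1 hn)
    rwa [greenCoeff_comp_neg, neg_neg, matsubara_neg, Complex.ofReal_neg] at this
  hardy δ hδ := (hF.hardy δ hδ).comp_neg
  carlson δ hδ := (hF.carlson δ hδ).comp_neg
  unique_hardy δ H hδ hH h ζ hζ := by
    have := hF.unique_hardy δ _ hδ hH.comp_neg (fun n hn hδn => ?_)
      (neg_mem_rightHalfPlane_iff.2 hζ)
    · simpa using this
    · rw [← Complex.ofReal_neg, ← matsubara_neg, greenCoeff_comp_neg]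
      exact h _ ((hT _).2 (by simpa using hn)) (by rw [matsubara_neg]; linarith)
  unique_carlson δ H hδ hH h ζ hζ := by
    have := hF.unique_carlson δ _ hδ hH.comp_neg (fun n hn hδn => ?_)
      (neg_mem_rightHalfPlane_iff.2 hζ)
    · simpa using this
    · rw [← Complex.ofReal_neg, ← matsubara_neg, greenCoeff_comp_neg]
      exact h _ ((hT _).2 (by simpa using hn)) (by rw [matsubara_neg]; linarith)

/-- The combination of the Laplace transforms of the jumps at `0` and `β` is the unique
interpolation of the Fourier coefficients with positive index of the parity of the statistics. -/
theorem IsThermalGreen.isUniqueInterpolantRight (hβ : 0 < β) (hG : IsThermalGreen β s G) {p : ℤ}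
    {S : Set ℤ} (hp : 1 ≤ p) (hps : (-1 : ℂ) ^ p = s.sign)
    (hS : ∀ n, n ∈ S ↔ ∃ k : ℕ, n = p + 2 * k) :
    IsUniqueInterpolantRight β G S fun ζ =>
      laplacePlus (thermalJump β G 0) ζ + s.sign * laplacePlus (thermalJump β G 1) ζ := by
  set F : ℂ → ℂ := fun ζ =>
    laplacePlus (thermalJump β G 0) ζ + s.sign * laplacePlus (thermalJump β G 1) ζ with hF
  have h0 := hG.isSubexponential_thermalJump hβ 0
  have h1 := hG.isSubexponential_thermalJump hβ 1
  -- Written as one Laplace transform, the combination inherits the H² bound without a triangle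
  -- inequality; the double sign fits `IsSubexponential.sub_const_mul`.
  set J : ℝ → ℂ := fun v => thermalJump β G 0 v - (-s.sign) * thermalJump β G 1 v
  have hJ : IsSubexponential J := h0.sub_const_mul h1 _
  have hFd : ∀ ζ : ℂ, 0 < ζ.re → DifferentiableAt ℂ F ζ := fun ζ hζ =>
    (h0.differentiableAt_laplacePlus hζ).add ((h1.differentiableAt_laplacePlus hζ).const_mul _)
  have hFb : ∀ δ : ℝ, 0 < δ → ∃ C : ℝ, ∀ ζ : ℂ, δ ≤ ζ.re → ‖F ζ‖ ≤ C := by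
    intro δ hδ
    obtain ⟨C, hC⟩ := h0.exists_norm_laplacePlus_le hδ
    obtain ⟨D, hD⟩ := h1.exists_norm_laplacePlus_le hδ
    refine ⟨C + ‖s.sign‖ * D, fun ζ hζ => (norm_add_le _ _).trans ?_⟩
    rw [norm_mul]
    gcongr
    · exact hC ζ hζ
    · exact hD ζ hζ
  have hint : ∀ n ∈ S, F (matsubara β n : ℂ) = greenCoeff β G n := by
    intro n hn
    obtain ⟨k, rfl⟩ := (hS n).1 hn
    have hsign : (-1 : ℂ) ^ (p + 2 * (k : ℤ)) = s.sign := by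
      rw [zpow_add₀ (by norm_num), hps, zpow_mul]
      norm_num
    rw [hG.greenCoeff_eq hβ (by omega), hsign]
  have huniq : ∀ (δ : ℝ) (H : ℂ → ℂ), 0 ≤ δ → DifferentiableOn ℂ H (rightHalfPlane δ) →
      (∀ δ' : ℝ, δ < δ' → HasCarlsonBound (β / 2) δ' H) →
      (∀ n ∈ S, δ < matsubara β n → H (matsubara β n : ℂ) = greenCoeff β G n) →
      EqOn H F (rightHalfPlane δ) := by
    intro δ H hδ hHd hHb h
    refine eqOn_of_carlson (a := matsubara β p) (half_pos hβ) (fun δ' hδ' ζ hζ => ?_)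
      (fun δ' hδ' => ?_) hHd hHb fun k hk => ?_
    · exact (hFd ζ ((hδ.trans_lt hδ').trans hζ)).differentiableWithinAt
    · obtain ⟨C, hC⟩ := hFb δ' (hδ.trans_lt hδ')
      exact hasCarlsonBound_of_bounded (half_pos hβ) fun ζ hζ => hC ζ hζ.le
    -- Consecutive nodes of equal parity are 2π/β apart, which is the spacing in Carlson's theorem
    -- for type below b = β/2.
    · have e : matsubara β p + k * (Real.pi / (β / 2)) = matsubara β (p + 2 * k) := by
        simp only [matsubara]
        push_cast
        field_simp
      rw [e] at hk ⊢
      have hmem : p + 2 * (k : ℤ) ∈ S := (hS _).2 ⟨k, rfl⟩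
      rw [h _ hmem hk, hint _ hmem]
  refine ⟨hint, fun δ hδ => ?_, fun δ hδ => ?_, fun δ H hδ hH h => ?_, fun δ H hδ hH h => ?_⟩
  · refine (hJ.isHardyRight_laplacePlus hδ).congr fun ζ hζ => ?_
    have h2 : IsSubexponential fun v => -s.sign * thermalJump β G 1 v := by
      simpa using (show IsSubexponential fun _ => (0 : ℂ) from
        ⟨continuous_const, fun η _ => ⟨0, by simp⟩⟩).sub_const_mul h1 s.sign
    rw [laplacePlus_sub h0 h2 (hδ.trans hζ), laplacePlus_const_mul]
    simp only [hF]
    ring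
  · obtain ⟨C, hC⟩ := hFb δ hδ
    refine ⟨DifferentiableOn.diffContOnCl fun ζ hζ => ?_, ⟨C, 0, fun ζ hζ => ?_⟩, C, 0,
      half_pos hβ, fun η => ?_⟩
    · rw [closure_rightHalfPlane] at hζ
      exact (hFd ζ (hδ.trans_le hζ)).differentiableWithinAt
    · simpa using hC ζ hζ
    · simpa using hC ((δ : ℂ) + (η : ℂ) * Complex.I) (by simp)
  · exact huniq δ H hδ hH.1 (fun δ' hδ' => hH.hasCarlsonBound (half_pos hβ) hδ') h
  · exact huniq δ H hδ hH.1.differentiableOn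
      (fun δ' hδ' => (hH.hasCarlsonBound (half_pos hβ)).mono hδ'.le) h

/-! ### Jumps of an arbitrary splitting. -/

/-- Identification on the half-plane of convergence is enough: only continuity of each part across
the lines on its own side is needed to compute the jump of the other. -/
theorem IsSplitting.eqOn_greenPlus (hβ : 0 < β) (hG : IsThermalGreen β s G) {Gp Gm : ℂ → ℂ}
    (h : IsSplitting β G Gp Gm) : EqOn Gp (greenPlus β G) {τ | τ.im < 0} := fun τ hτ =>
  (h.series_plus τ hτ).unique (hG.hasSum_greenPlus hβ hτ)

theorem IsSplitting.eqOn_greenMinus (hβ : 0 < β) (hG : IsThermalGreen β s G) {Gp Gm : ℂ → ℂ}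
    (h : IsSplitting β G Gp Gm) : EqOn Gm (greenMinus β G) {τ | 0 < τ.im} := fun τ hτ =>
  (h.series_minus τ hτ).unique (hG.hasSum_greenMinus hβ hτ)

theorem IsSplitting.continuousAt_plus (hβ : 0 < β) (hG : IsThermalGreen β s G) {Gp Gm : ℂ → ℂ}
    (h : IsSplitting β G Gp Gm) {τ : ℂ} (hτ : τ.im < 0) : ContinuousAt Gp τ := by
  have h1 : τ ∉ cutUp β := by
    rintro ⟨k, v, hv, rfl⟩
    simp at hτ
    linarith
  refine (hG.differentiableAt_greenPlus hβ h1).continuousAt.congr ?_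
  filter_upwards [(isOpen_lt Complex.continuous_im continuous_const).mem_nhds hτ] with w hw
  exact (h.eqOn_greenPlus hβ hG hw).symm

theorem IsSplitting.continuousAt_minus (hβ : 0 < β) (hG : IsThermalGreen β s G) {Gp Gm : ℂ → ℂ}
    (h : IsSplitting β G Gp Gm) {τ : ℂ} (hτ : 0 < τ.im) : ContinuousAt Gm τ := by
  have h1 : τ ∉ cutDown β := by
    rintro ⟨k, v, hv, rfl⟩
    simp at hτ
    linarith
  refine (hG.differentiableAt_greenMinus hβ h1).continuousAt.congr ?_
  filter_upwards [(isOpen_lt continuous_const Complex.continuous_im).mem_nhds hτ] with w hw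
  exact (h.eqOn_greenMinus hβ hG hw).symm

/-- Subtracting from `G` a function continuous at a point of a cut does not change the jump there. -/
theorem tendsto_gapPlus_of_sub_continuousAt (hβ : 0 < β) (hG : IsThermalGreen β s G)
    {F H : ℂ → ℂ} {k : ℤ} {v : ℝ} (hFH : ∀ τ ∈ cutPlane β, G τ = F τ + H τ)
    (hH : ContinuousAt H ((k : ℂ) * (β : ℂ) + (v : ℂ) * Complex.I)) :
    Tendsto (gapPlus β F k v) (𝓝[>] (0 : ℝ)) (𝓝 (thermalJump β G k v)) := by
  have hr : Tendsto (fun e : ℝ => (k : ℂ) * (β : ℂ) + (e : ℂ) + (v : ℂ) * Complex.I) (𝓝[>] 0)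
      (𝓝 ((k : ℂ) * (β : ℂ) + (v : ℂ) * Complex.I)) := by
    refine Tendsto.mono_left ?_ nhdsWithin_le_nhds
    have : Continuous fun e : ℝ => (k : ℂ) * (β : ℂ) + (e : ℂ) + (v : ℂ) * Complex.I := by fun_prop
    simpa using this.tendsto 0
  have hl : Tendsto (fun e : ℝ => (k : ℂ) * (β : ℂ) - (e : ℂ) + (v : ℂ) * Complex.I) (𝓝[>] 0)
      (𝓝 ((k : ℂ) * (β : ℂ) + (v : ℂ) * Complex.I)) := by
    refine Tendsto.mono_left ?_ nhdsWithin_le_nhds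
    have : Continuous fun e : ℝ => (k : ℂ) * (β : ℂ) - (e : ℂ) + (v : ℂ) * Complex.I := by fun_prop
    simpa using this.tendsto 0
  have h1 := (((hG.tendsto_right hβ k v).sub (hH.tendsto.comp hr)).sub
    ((hG.tendsto_left hβ k v).sub (hH.tendsto.comp hl))).const_mul Complex.I
  rw [sub_sub_sub_cancel_right] at h1
  refine Tendsto.congr' ?_ h1
  filter_upwards [Ioo_mem_nhdsGT hβ] with e he
  have h2 : (k : ℂ) * (β : ℂ) + (e : ℂ) + (v : ℂ) * Complex.I ∈ cutPlane β := by
    refine strip_subset_cutPlane hβ k ⟨?_, ?_⟩ <;> simp <;> linarith [he.1, he.2]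
  have h3 : (k : ℂ) * (β : ℂ) - (e : ℂ) + (v : ℂ) * Complex.I ∈ cutPlane β := by
    refine strip_subset_cutPlane hβ (k - 1) ⟨?_, ?_⟩ <;> simp <;> linarith [he.1, he.2]
  simp only [gapPlus, Function.comp_apply]
  rw [hFH _ h2, hFH _ h3]
  ring

theorem IsSplitting.tendsto_gapPlus (hβ : 0 < β) (hG : IsThermalGreen β s G) {Gp Gm : ℂ → ℂ}
    (h : IsSplitting β G Gp Gm) (k : ℤ) {v : ℝ} (hv : 0 < v) :
    Tendsto (gapPlus β Gp k v) (𝓝[>] (0 : ℝ)) (𝓝 (thermalJump β G k v)) :=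
  tendsto_gapPlus_of_sub_continuousAt hβ hG h.add (h.continuousAt_minus hβ hG (by simpa using hv))

theorem IsSplitting.tendsto_gapMinus (hβ : 0 < β) (hG : IsThermalGreen β s G) {Gp Gm : ℂ → ℂ}
    (h : IsSplitting β G Gp Gm) (k : ℤ) {v : ℝ} (hv : v < 0) :
    Tendsto (gapMinus β Gm k v) (𝓝[>] (0 : ℝ)) (𝓝 (-thermalJump β G k v)) := by
  have h1 := (tendsto_gapPlus_of_sub_continuousAt hβ hG
    (fun τ hτ => (h.add τ hτ).trans (add_comm _ _))
    (h.continuousAt_plus hβ hG (τ := (k : ℂ) * (β : ℂ) + (v : ℂ) * Complex.I)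
      (by simpa using hv))).neg
  refine h1.congr fun e => ?_
  simp only [gapPlus, gapMinus, neg_mul]

theorem IsSplitting.jumpPlus_eq (hβ : 0 < β) (hG : IsThermalGreen β s G) {Gp Gm : ℂ → ℂ}
    (h : IsSplitting β G Gp Gm) (k : ℤ) {v : ℝ} (hv : 0 < v) :
    jumpPlus β Gp k v = thermalJump β G k v :=
  (h.tendsto_gapPlus hβ hG k hv).limUnder_eq

theorem IsSplitting.jumpMinus_eq (hβ : 0 < β) (hG : IsThermalGreen β s G) {Gp Gm : ℂ → ℂ}
    (h : IsSplitting β G Gp Gm) (k : ℤ) {v : ℝ} (hv : v < 0) :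
    jumpMinus β Gm k v = thermalJump β (fun τ => G (-τ)) (-k) (-v) := by
  rw [hG.thermalJump_comp_neg hβ, neg_neg, neg_neg]
  exact (h.tendsto_gapMinus hβ hG k hv).limUnder_eq

theorem IsSplitting.laplacePlus_jumpPlus (hβ : 0 < β) (hG : IsThermalGreen β s G) {Gp Gm : ℂ → ℂ}
    (h : IsSplitting β G Gp Gm) (k : ℤ) :
    laplacePlus (jumpPlus β Gp k) = laplacePlus (thermalJump β G k) := by
  funext ζ
  refine setIntegral_congr_fun measurableSet_Ioi fun v hv => ?_
  simp only [h.jumpPlus_eq hβ hG k hv]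

/-- Reflection sends the cut at β to the one at -β; 2β-periodicity brings it back. -/
theorem IsThermalGreen.thermalJump_neg (hβ : 0 < β) (hG : IsThermalGreen β s G) {k : ℤ}
    (hk : k = 0 ∨ k = 1) : thermalJump β G (-k) = thermalJump β G k := by
  rcases hk with rfl | rfl
  · rfl
  · exact (hG.thermalJump_add_two hβ (-1)).symm

theorem IsSplitting.laplaceMinus_jumpMinus (hβ : 0 < β) (hG : IsThermalGreen β s G)
    {Gp Gm : ℂ → ℂ} (h : IsSplitting β G Gp Gm) {k : ℤ} (hk : k = 0 ∨ k = 1) :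
    laplaceMinus (jumpMinus β Gm k) =
      fun ζ => laplacePlus (thermalJump β (fun τ => G (-τ)) k) (-ζ) := by
  funext ζ
  have h1 := integral_comp_neg_Iic (0 : ℝ) (fun v : ℝ =>
    thermalJump β (fun τ => G (-τ)) k v * Complex.exp (-(-ζ * (v : ℂ))))
  rw [neg_zero] at h1
  rw [laplacePlus, ← h1, integral_Iic_eq_integral_Iio]
  refine setIntegral_congr_fun measurableSet_Iio fun v hv => ?_
  simp only [h.jumpMinus_eq hβ hG k hv, (hG.comp_neg hβ).thermalJump_neg hβ hk]
  congr 2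
  push_cast
  ring

theorem IsSplitting.integrableOn_jumpPlus (hβ : 0 < β) (hG : IsThermalGreen β s G)
    {Gp Gm : ℂ → ℂ} (h : IsSplitting β G Gp Gm) (k : ℤ) {ζ : ℂ} (hζ : 0 < ζ.re) :
    IntegrableOn (fun v : ℝ => jumpPlus β Gp k v * Complex.exp (-(ζ * (v : ℂ)))) (Ioi (0 : ℝ)) := by
  refine IntegrableOn.congr_fun ((hG.isSubexponential_thermalJump hβ k).integrableOn_laplace hζ)
    (fun v hv => ?_) measurableSet_Ioi
  simp only [h.jumpPlus_eq hβ hG k hv]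

theorem IsSplitting.integrableOn_jumpMinus (hβ : 0 < β) (hG : IsThermalGreen β s G)
    {Gp Gm : ℂ → ℂ} (h : IsSplitting β G Gp Gm) (k : ℤ) {ζ : ℂ} (hζ : ζ.re < 0) :
    IntegrableOn (fun v : ℝ => jumpMinus β Gm k v * Complex.exp (-(ζ * (v : ℂ))))
      (Iio (0 : ℝ)) := by
  have h1 := (((hG.comp_neg hβ).isSubexponential_thermalJump hβ (-k)).integrableOn_laplace
    (ζ := -ζ) (by rw [Complex.neg_re]; linarith))
  rw [← (Measure.measurePreserving_neg (volume : Measure ℝ)).integrableOn_comp_preimage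
    (Homeomorph.neg ℝ).measurableEmbedding] at h1
  have e : (Neg.neg : ℝ → ℝ) ⁻¹' Ioi 0 = Iio 0 := by ext x; simp
  rw [e] at h1
  refine h1.congr_fun (fun v hv => ?_) measurableSet_Iio
  simp only [Function.comp_apply, h.jumpMinus_eq hβ hG k hv]
  congr 2
  push_cast
  ring

end
end ThermalGreen

/-! ### Assembly of the theorem. -/

theorem theorem1 (β : ℝ) (hβ : 0 < β) (s : Statistics) (G : ℂ → ℂ)
    (hG : IsThermalGreen β s G) :
    -- the two parts exist and are holomorphic in the cut domains
    (∃ Gp Gm : ℂ → ℂ, IsSplitting β G Gp Gm ∧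
      DifferentiableOn ℂ Gp (cutUp β)ᶜ ∧ DifferentiableOn ℂ Gm (cutDown β)ᶜ) ∧
    ∀ Gp Gm : ℂ → ℂ, IsSplitting β G Gp Gm →
      -- the jumps across all the cuts are well defined
      (∀ (k : ℤ) (v : ℝ), 0 < v →
        Tendsto (gapPlus β Gp k v) (𝓝[>] (0 : ℝ)) (𝓝 (jumpPlus β Gp k v))) ∧
      (∀ (k : ℤ) (v : ℝ), v < 0 →
        Tendsto (gapMinus β Gm k v) (𝓝[>] (0 : ℝ)) (𝓝 (jumpMinus β Gm k v))) ∧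
      -- the Laplace transforms at `Re τ = 0` and `Re τ = β` converge, are holomorphic, and
      -- belong to the Hardy spaces of the shifted half-planes
      (∀ k : ℤ, k = 0 ∨ k = 1 →
        (∀ ζ : ℂ, 0 < ζ.re →
          IntegrableOn (fun v : ℝ => jumpPlus β Gp k v * Complex.exp (-(ζ * (v : ℂ))))
            (Ioi (0 : ℝ))) ∧
        (∀ ζ : ℂ, ζ.re < 0 →
          IntegrableOn (fun v : ℝ => jumpMinus β Gm k v * Complex.exp (-(ζ * (v : ℂ))))
            (Iio (0 : ℝ))) ∧
        DifferentiableOn ℂ (laplacePlus (jumpPlus β Gp k)) {ζ : ℂ | 0 < ζ.re} ∧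
        DifferentiableOn ℂ (laplaceMinus (jumpMinus β Gm k)) {ζ : ℂ | ζ.re < 0} ∧
        (∀ δ : ℝ, 0 < δ → IsHardyRight δ (laplacePlus (jumpPlus β Gp k))) ∧
        (∀ δ : ℝ, 0 < δ → IsHardyLeft δ (laplaceMinus (jumpMinus β Gm k)))) ∧
      -- bosons
      (s = Statistics.boson →
        (∀ m : ℤ, 1 ≤ m →
          laplacePlus (jumpPlus β Gp 0) ((2 * (m : ℝ) * Real.pi / β : ℝ) : ℂ)
            + laplacePlus (jumpPlus β Gp 1) ((2 * (m : ℝ) * Real.pi / β : ℝ) : ℂ)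
            = greenCoeff β G (2 * m)) ∧
        (∀ m : ℤ, m ≤ -1 →
          laplaceMinus (jumpMinus β Gm 0) ((2 * (m : ℝ) * Real.pi / β : ℝ) : ℂ)
            + laplaceMinus (jumpMinus β Gm 1) ((2 * (m : ℝ) * Real.pi / β : ℝ) : ℂ)
            = greenCoeff β G (2 * m)) ∧
        IsUniqueInterpolantRight β G {n : ℤ | ∃ m : ℤ, 1 ≤ m ∧ n = 2 * m}
          (fun ζ => laplacePlus (jumpPlus β Gp 0) ζ + laplacePlus (jumpPlus β Gp 1) ζ) ∧
        IsUniqueInterpolantLeft β G {n : ℤ | ∃ m : ℤ, m ≤ -1 ∧ n = 2 * m}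
          (fun ζ => laplaceMinus (jumpMinus β Gm 0) ζ + laplaceMinus (jumpMinus β Gm 1) ζ)) ∧
      -- fermions
      (s = Statistics.fermion →
        (∀ m : ℤ, 0 ≤ m →
          laplacePlus (jumpPlus β Gp 0) (((2 * (m : ℝ) + 1) * Real.pi / β : ℝ) : ℂ)
            - laplacePlus (jumpPlus β Gp 1) (((2 * (m : ℝ) + 1) * Real.pi / β : ℝ) : ℂ)
            = greenCoeff β G (2 * m + 1)) ∧
        (∀ m : ℤ, m ≤ -1 →
          laplaceMinus (jumpMinus β Gm 0) (((2 * (m : ℝ) + 1) * Real.pi / β : ℝ) : ℂ)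
            - laplaceMinus (jumpMinus β Gm 1) (((2 * (m : ℝ) + 1) * Real.pi / β : ℝ) : ℂ)
            = greenCoeff β G (2 * m + 1)) ∧
        IsUniqueInterpolantRight β G {n : ℤ | ∃ m : ℤ, 0 ≤ m ∧ n = 2 * m + 1}
          (fun ζ => laplacePlus (jumpPlus β Gp 0) ζ - laplacePlus (jumpPlus β Gp 1) ζ) ∧
        IsUniqueInterpolantLeft β G {n : ℤ | ∃ m : ℤ, m ≤ -1 ∧ n = 2 * m + 1}
          (fun ζ => laplaceMinus (jumpMinus β Gm 0) ζ - laplaceMinus (jumpMinus β Gm 1) ζ)) := by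
  refine ⟨⟨_, _, hG.isSplitting hβ,
    fun τ hτ => (hG.differentiableAt_greenPlus hβ hτ).differentiableWithinAt,
    fun τ hτ => (hG.differentiableAt_greenMinus hβ hτ).differentiableWithinAt⟩, fun Gp Gm h => ?_⟩
  have hG' := hG.comp_neg hβ
  have hP := h.laplacePlus_jumpPlus hβ hG
  have hM0 := h.laplaceMinus_jumpMinus hβ hG (Or.inl rfl)
  have hM1 := h.laplaceMinus_jumpMinus hβ hG (Or.inr rfl)
  refine ⟨fun k v hv => ?_, fun k v hv => ?_, fun k hk => ⟨fun ζ hζ => ?_, fun ζ hζ => ?_, ?_, ?_,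
    fun δ hδ => ?_, fun δ hδ => ?_⟩, ?_, ?_⟩
  · rw [h.jumpPlus_eq hβ hG k hv]
    exact h.tendsto_gapPlus hβ hG k hv
  · exact tendsto_nhds_limUnder ⟨_, h.tendsto_gapMinus hβ hG k hv⟩
  · exact h.integrableOn_jumpPlus hβ hG k hζ
  · exact h.integrableOn_jumpMinus hβ hG k hζ
  · rw [hP]
    exact fun ζ hζ => ((hG.isSubexponential_thermalJump hβ k).differentiableAt_laplacePlus
      hζ).differentiableWithinAt
  · rw [h.laplaceMinus_jumpMinus hβ hG hk]
    intro ζ hζ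
    have hζ' : 0 < (-ζ).re := by
      rw [Complex.neg_re]
      exact neg_pos.2 hζ
    exact (((hG'.isSubexponential_thermalJump hβ k).differentiableAt_laplacePlus
      hζ').comp ζ differentiableAt_id.neg).differentiableWithinAt
  · rw [hP]
    exact (hG.isSubexponential_thermalJump hβ k).isHardyRight_laplacePlus hδ
  · rw [h.laplaceMinus_jumpMinus hβ hG hk]
    exact ((hG'.isSubexponential_thermalJump hβ k).isHardyRight_laplacePlus hδ).comp_neg
  · rintro rfl
    -- The first boson node is n = 2, since ζ₀ = 0 lies on the boundary of the half-plane.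
    have hS : ∀ n : ℤ, n ∈ {n : ℤ | ∃ m : ℤ, 1 ≤ m ∧ n = 2 * m} ↔ ∃ k : ℕ, n = 2 + 2 * k := by
      intro n
      constructor
      · rintro ⟨m, hm, rfl⟩
        exact ⟨(m - 1).toNat, by omega⟩
      · rintro ⟨k, rfl⟩
        exact ⟨k + 1, by omega, by ring⟩
    have hT : ∀ n : ℤ, n ∈ {n : ℤ | ∃ m : ℤ, m ≤ -1 ∧ n = 2 * m} ↔
        -n ∈ {n : ℤ | ∃ m : ℤ, 1 ≤ m ∧ n = 2 * m} := by
      intro n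
      constructor <;> rintro ⟨m, hm, hn⟩ <;> exact ⟨-m, by omega, by omega⟩
    have hR := hG.isUniqueInterpolantRight hβ (p := 2) (by norm_num)
      (by norm_num [Statistics.sign]) hS
    have hL := (hG'.isUniqueInterpolantRight hβ (p := 2) (by norm_num)
      (by norm_num [Statistics.sign]) hS).comp_neg hT
    have hnode : ∀ m : ℤ, matsubara β (2 * m) = 2 * (m : ℝ) * Real.pi / β := by
      intro m
      rw [matsubara]
      push_cast
      rfl
    simp only [Statistics.sign, one_mul] at hR hL
    rw [hP, hP, hM0, hM1]
    refine ⟨fun m hm => ?_, fun m hm => ?_, hR, hL⟩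
    · rw [← hnode]
      exact hR.interpolates _ ⟨m, hm, rfl⟩
    · rw [← hnode]
      exact hL.interpolates _ ⟨m, hm, rfl⟩
  · rintro rfl
    have hS : ∀ n : ℤ, n ∈ {n : ℤ | ∃ m : ℤ, 0 ≤ m ∧ n = 2 * m + 1} ↔ ∃ k : ℕ, n = 1 + 2 * k := by
      intro n
      constructor
      · rintro ⟨m, hm, rfl⟩
        exact ⟨m.toNat, by omega⟩
      · rintro ⟨k, rfl⟩
        exact ⟨k, by omega, by ring⟩
    -- Since -(2m + 1) = 2(-m - 1) + 1, the range m ≤ -1 corresponds to m ≥ 0.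
    have hT : ∀ n : ℤ, n ∈ {n : ℤ | ∃ m : ℤ, m ≤ -1 ∧ n = 2 * m + 1} ↔
        -n ∈ {n : ℤ | ∃ m : ℤ, 0 ≤ m ∧ n = 2 * m + 1} := by
      intro n
      constructor <;> rintro ⟨m, hm, hn⟩ <;> exact ⟨-m - 1, by omega, by omega⟩
    have hR := hG.isUniqueInterpolantRight hβ (p := 1) le_rfl
      (by norm_num [Statistics.sign]) hS
    have hL := (hG'.isUniqueInterpolantRight hβ (p := 1) le_rfl
      (by norm_num [Statistics.sign]) hS).comp_neg hT
    have hnode : ∀ m : ℤ, matsubara β (2 * m + 1) = (2 * (m : ℝ) + 1) * Real.pi / β := by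
      intro m
      rw [matsubara]
      push_cast
      rfl
    simp only [Statistics.sign, neg_one_mul, ← sub_eq_add_neg] at hR hL
    rw [hP, hP, hM0, hM1]
    refine ⟨fun m hm => ?_, fun m hm => ?_, hR, hL⟩
    · rw [← hnode]
      exact hR.interpolates _ ⟨m, hm, rfl⟩
    · rw [← hnode]
      exact hL.interpolates _ ⟨m, hm, rfl⟩
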